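/- Let $\sigma>0$, $p\ge 0$, $T>0$, and set $\mathfrak a(r)=\frac{2r-1}{r}$, $\mathfrak h(r)=\frac{(1-r)(2r-1)}{r}$ for $r\in[\frac12,1]$, and $J(r)=r(1-r)$ for $r\in[0,1]$. **The mapping $\Phi$.** For a measurable $\rho:[0,1]\to[\frac12,1]$ let $m_\rho=\int_0^1\rho\,du$, $v_\rho(u)=\frac1{m_\rho}\int_0^u\rho(u')\,du'$, let $u_\rho:[0,1]\to[0,1]$ be the inverse function of $v_\rho$, and let $\Phi(\rho)(v)=\mathfrak a\big(\rho(u_\rho(v))\big)$ for $v\in[0,1]$. For a measurable $\omega:[0,1]\to[0,1]$ let $\Phi^{-1}(\omega)(u)=\frac1{2-\omega(v(u))}$ for $u\in[0,1]$, where $u\mapsto v(u)$ is the inverse function of $v\mapsto \mu\int_0^v(2-\omega(v'))\,dv'$ with $\mu=\big(\int_0^1(2-\omega)\,dv'\big)^{-1}$. **Weak solutions.** Let $K\subset\mathbb R$ be an interval, $a,h:K\to\mathbb R$ smooth functions, $s>0$, $q\ge0$, and $\rho^{\rm ini}:[0,1]\to K$ measurable. A measurable function $\rho:[0,T]\times[0,1]\to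 K$ is a weak solution of $\partial_t\rho=s\,\partial_u^2a(\rho)-q\,\partial_uh(\rho)$, $\rho_0=\rho^{\rm ini}$, with Robin boundary conditions $\big(s\,\partial_ua(\rho_t)-q\,h(\rho_t)\big)\big|_{u=0,1}=0$, if for all $G\in C^{1,2}([0,T]\times[0,1])$ and all $t\in[0,T]$ $$\int_0^1\rho_tG_t\,du-\int_0^1\rho^{\rm ini}G_0\,du-\int_0^t\!\!\int_0^1\rho_\tau\,\partial_tG_\tau\,du\,d\tau=s\int_0^t\!\!\int_0^1a(\rho_\tau)\,\partial_u^2G_\tau\,du\,d\tau+q\int_0^t\!\!\int_0^1h(\rho_\tau)\,\partial_uG_\tau\,du\,d\tau-s\int_0^t\big\{a(\rho_\tau(1))\partial_uG_\tau(1)-a(\rho_\tau(0))\partial_uG_\tau(0)\big\}d\tau .$$ A weak solution of $\partial_t\rho=s\,\partial_u^2a(\rho)$ with Neumann boundary conditions $\partial_ua(\rho_t)(0)=\partial_ua(\rho_t)(1)=0$ is defined by the same identity with $q=0$. A weak solution is called unique if every weak solution with values in the same $K$ and with the same initial profile agrees with it, for every $t\in[0,T]$, almost everywhere on $[0,1]$.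 **Statement.** $\Phi$ is a bijection from the measurable functions $[0,1]\to[\frac12,1]$ to the measurable functions $[0,1]\to[0,1]$, with inverse $\Phi^{-1}$. Let $\rho^{\rm ini}:[0,1]\to[\frac12,1]$ be measurable, $m=\int_0^1\rho^{\rm ini}\,du$ and $\omega^{\rm ini}=\Phi(\rho^{\rm ini})$. (i) If $\omega:[0,T]\times[0,1]\to[0,1]$ is a weak solution of the heat equation $\partial_t\omega=\frac{\sigma}{m^2}\partial_v^2\omega$, $\omega_0=\omega^{\rm ini}$, with Neumann boundary conditions $\partial_v\omega_t(0)=\partial_v\omega_t(1)=0$, then it is the unique one, and $\rho_t:=\Phi^{-1}(\omega_t)$, $t\in[0,T]$, defines the unique weak solution $\rho:[0,T]\times[0,1]\to[\frac12,1]$ of the fast diffusion equation $\partial_t\rho=\sigma\,\partial_u^2\mathfrak a(\rho)$, $\rho_0=\rho^{\rm ini}$, with Neumann boundary conditions $\partial_u\mathfrak a(\rho_t)(0)=\partial_u\mathfrak a(\rho_t)(1)=0$. (ii) If $\omega:[0,T]\times[0,1]\to[0,1]$ is a weak solution of the viscous Burgers equation $\partial_t\omega=\frac{\sigma}{m^2}\partial_v^2\omega-\frac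 pm\partial_vJ(\omega)$, $\omega_0=\omega^{\rm ini}$, with Robin boundary conditions $\big[\frac{\sigma}{m^2}\partial_v\omega_t-\frac pmJ(\omega_t)\big]\big|_{v=0,1}=0$, then it is the unique one, and $\rho_t:=\Phi^{-1}(\omega_t)$, $t\in[0,T]$, defines the unique weak solution $\rho:[0,T]\times[0,1]\to[\frac12,1]$ of the convection–diffusion equation $\partial_t\rho=\sigma\,\partial_u^2\mathfrak a(\rho)-p\,\partial_u\mathfrak h(\rho)$, $\rho_0=\rho^{\rm ini}$, with Robin boundary conditions $\big[\sigma\,\partial_u\mathfrak a(\rho_t)-p\,\mathfrak h(\rho_t)\big]\big|_{u=0,1}=0$. -/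

import Mathlib

open MeasureTheory Set

noncomputable section

namespace FacilitatedExclusion

/-- The diffusion function `𝔞(r) = (2r - 1) / r` (used for `r ∈ [1/2, 1]`). -/
def frakA (r : ℝ) : ℝ := (2 * r - 1) / r

/-- The flux function `𝔥(r) = (1 - r)(2r - 1) / r` (used for `r ∈ [1/2, 1]`). -/
def frakH (r : ℝ) : ℝ := (1 - r) * (2 * r - 1) / r

/-- The macroscopic current `J(r) = r (1 - r)` of the simple exclusion process. -/
def currentJ (r : ℝ) : ℝ := r * (1 - r)

/-- `f` restricts to a (Borel) measurable function `[0,1] → K`.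
Only the values of `f` on `[0,1]` matter. -/
def IsProfile (K : Set ℝ) (f : ℝ → ℝ) : Prop :=
  Measurable (fun u : Icc (0 : ℝ) 1 => f u) ∧ ∀ u ∈ Icc (0 : ℝ) 1, f u ∈ K

/-- Total mass `m_ρ = ∫₀¹ ρ(u) du`. -/
def totalMass (ρ : ℝ → ℝ) : ℝ := ∫ u in (0 : ℝ)..1, ρ u

/-- `v_ρ(u) = (1 / m_ρ) ∫₀ᵘ ρ(u') du'`. -/
def vMap (ρ : ℝ → ℝ) (u : ℝ) : ℝ := 1 / totalMass ρ * ∫ u' in (0 : ℝ)..u, ρ u'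

/-- `u_ρ : [0,1] → [0,1]`, the inverse function of `v_ρ : [0,1] → [0,1]`. -/
def uMap (ρ : ℝ → ℝ) : ℝ → ℝ := Function.invFunOn (vMap ρ) (Icc (0 : ℝ) 1)

/-- The macroscopic mapping `Φ(ρ)(v) = (2 ρ(u_ρ(v)) - 1) / ρ(u_ρ(v))`, for `v ∈ [0,1]`. -/
def Phi (ρ : ℝ → ℝ) (v : ℝ) : ℝ := (2 * ρ (uMap ρ v) - 1) / ρ (uMap ρ v)

/-- In terms of `ω = Φ(ρ)`, the function `u_ρ` reads `v ↦ m ∫₀ᵛ (2 - ω(v')) dv'`, where the mass `m`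
is determined by `m ∫₀¹ (2 - ω(v')) dv' = 1`. -/
def uOf (ω : ℝ → ℝ) (v : ℝ) : ℝ :=
  (1 / ∫ v' in (0 : ℝ)..1, (2 - ω v')) * ∫ v' in (0 : ℝ)..v, (2 - ω v')

/-- The inverse mapping `Φ⁻¹(ω)(u) = 1 / (2 - ω(v(u)))`, for `u ∈ [0,1]`, where `v : [0,1] → [0,1]`
is the inverse function of `v ↦ m ∫₀ᵛ (2 - ω)`. -/
def PhiInv (ω : ℝ → ℝ) (u : ℝ) : ℝ :=
  1 / (2 - ω (Function.invFunOn (uOf ω) (Icc (0 : ℝ) 1) u))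

/-- `G` is a test function of class `C^{1,2}([0,T] × [0,1])`, with partial derivatives
`Gt = ∂ₜG`, `Gu = ∂ᵤG`, `Guu = ∂ᵤ²G` (one-sided at the boundary of the rectangle). -/
structure IsTestFunction (T : ℝ) (G Gt Gu Guu : ℝ → ℝ → ℝ) : Prop where
  continuousOn : ContinuousOn (fun z : ℝ × ℝ => G z.1 z.2) (Icc 0 T ×ˢ Icc 0 1)
  continuousOn_t : ContinuousOn (fun z : ℝ × ℝ => Gt z.1 z.2) (Icc 0 T ×ˢ Icc 0 1)
  continuousOn_u : ContinuousOn (fun z : ℝ × ℝ => Gu z.1 z.2) (Icc 0 T ×ˢ Icc 0 1)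
  continuousOn_uu : ContinuousOn (fun z : ℝ × ℝ => Guu z.1 z.2) (Icc 0 T ×ˢ Icc 0 1)
  deriv_t : ∀ t ∈ Icc 0 T, ∀ u ∈ Icc (0 : ℝ) 1,
    HasDerivWithinAt (fun s => G s u) (Gt t u) (Icc 0 T) t
  deriv_u : ∀ t ∈ Icc 0 T, ∀ u ∈ Icc (0 : ℝ) 1,
    HasDerivWithinAt (fun x => G t x) (Gu t u) (Icc 0 1) u
  deriv_uu : ∀ t ∈ Icc 0 T, ∀ u ∈ Icc (0 : ℝ) 1,
    HasDerivWithinAt (fun x => Gu t x) (Guu t u) (Icc 0 1) u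

/-- `ρ` is a weak solution, on `[0,T] × [0,1]`, of
`∂ₜρ = σ ∂ᵤ² a(ρ) - p ∂ᵤ h(ρ)`, `ρ₀ = ρini`, with the Robin boundary conditions
`σ ∂ᵤ a(ρₜ) = p h(ρₜ)` at `u = 0, 1`.
The set `K` is the one in which densities take their values. -/
structure IsWeakSolutionRobin (K : Set ℝ) (σ p : ℝ) (a h : ℝ → ℝ) (T : ℝ)
    (ρini : ℝ → ℝ) (ρ : ℝ → ℝ → ℝ) : Prop where
  measurable : Measurable (fun z : Icc (0 : ℝ) T × Icc (0 : ℝ) 1 => ρ z.1 z.2)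
  mem : ∀ t ∈ Icc 0 T, ∀ u ∈ Icc (0 : ℝ) 1, ρ t u ∈ K
  weak : ∀ G Gt Gu Guu : ℝ → ℝ → ℝ, IsTestFunction T G Gt Gu Guu → ∀ t ∈ Icc 0 T,
    (∫ u in (0 : ℝ)..1, ρ t u * G t u) - (∫ u in (0 : ℝ)..1, ρini u * G 0 u)
        - (∫ s in (0 : ℝ)..t, ∫ u in (0 : ℝ)..1, ρ s u * Gt s u)
      = σ * (∫ s in (0 : ℝ)..t, ∫ u in (0 : ℝ)..1, a (ρ s u) * Guu s u)
        + p * (∫ s in (0 : ℝ)..t, ∫ u in (0 : ℝ)..1, h (ρ s u) * Gu s u)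
        - σ * (∫ s in (0 : ℝ)..t, (a (ρ s 1) * Gu s 1 - a (ρ s 0) * Gu s 0))

/-- `ρ` is a weak solution, on `[0,T] × [0,1]`, of `∂ₜρ = σ ∂ᵤ² a(ρ)`, `ρ₀ = ρini`, with the
Neumann boundary conditions `∂ᵤ a(ρₜ)(0) = ∂ᵤ a(ρₜ)(1) = 0`: the case `p = 0` of the above. -/
def IsWeakSolutionNeumann (K : Set ℝ) (σ : ℝ) (a : ℝ → ℝ) (T : ℝ)
    (ρini : ℝ → ℝ) (ρ : ℝ → ℝ → ℝ) : Prop :=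
  IsWeakSolutionRobin K σ 0 a (fun _ => 0) T ρini ρ

/-- `ρ` is the unique element of the class `S` of functions on `[0,T] × [0,1]`, where functions are
identified when they agree, at each time of `[0,T]`, almost everywhere on `[0,1]`. -/
def IsUniqueIn (T : ℝ) (S : (ℝ → ℝ → ℝ) → Prop) (ρ : ℝ → ℝ → ℝ) : Prop :=
  S ρ ∧ ∀ ρ', S ρ' → ∀ t ∈ Icc 0 T, ∀ᵐ u ∂(volume.restrict (Icc (0 : ℝ) 1)), ρ' t u = ρ t u

end FacilitatedExclusion

end

open FacilitatedExclusion

/-! Put s = σ/m², q = p/m and u_t(v) = m ∫₀ᵛ (2 - ω_t). Along u = u_t(v) one has du = m(2 - ω_t) dv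
and ρ_t = 1/(2 - ω_t), so ρ_t du becomes m dv, 𝔞(ρ_t) becomes ω_t and 𝔥(ρ_t)/ρ_t becomes J(ω_t). In
particular ∫ ρ_t G_t du = m ∫ G_t(u_t(v)) dv. Formally ∂_t u = s ∂_v²u + m q J(ω), because the flux
vanishes at v = 0. Differentiating the right side in time, integrating G_u(u) ∂_v²u by parts and
writing (2 - ω)² = 2(2 - ω) - ω(2 - ω) gives the weak formulation for ρ, with coefficients s m² = σ
and m q = p.

The difficulty is that ω is only measurable, so ∂_vω has no meaning. In its place stand Fejér means
of the cosine series of ω_t. Testing the weak formulation with cosines shows that each coefficient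
is a primitive in time of a bounded function (`IsWeakSolutionRobin.cosC_sub`). The Fejér kernel is
positive and keeps the mass, so the approximate change of variables is smooth in v, monotone and
fixes 0 and 1. It satisfies an exact identity (`IsGlobalTest.approx_identity`), and L¹ convergence
of the means handles the bulk terms in the limit (`IsGlobalTest.limit_identity`). The boundary
values of ω occur pointwise in the weak formulation, and L¹ convergence says nothing about them.
They are recovered, weakly in time, by testing with a second primitive of the Fejér kernel at the
boundary point (`tendsto_boundary`). `IsWeakSolutionRobin.phiInv` assembles the pieces.

Uniqueness, for both equations, is an energy estimate in the dual of H¹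
(`IsWeakSolutionRobin.ae_eq`): the squared cosine coefficients of the difference of two solutions,
divided by (nπ)², are summed. The monotone diffusion gives a negative term that absorbs the
Lipschitz flux, and Grönwall's inequality concludes.

The bijectivity of Φ rests on the same fact: v_ρ and v ↦ m ∫₀ᵛ (2 - Φ(ρ)) are inverse to each other
(`integral_two_sub_Phi`). -/

namespace FacilitatedExclusion

open Filter Topology

/-! ### Bounded measurable functions -/

/-- A real function which is measurable and bounded. -/
structure BddMeas {α : Type*} [MeasurableSpace α] (f : α → ℝ) : Prop where
  meas : Measurable f
  bdd : ∃ C : ℝ, ∀ x, |f x| ≤ C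

namespace BddMeas

variable {α β : Type*} [MeasurableSpace α] [MeasurableSpace β] {f g : α → ℝ}

theorem const (c : ℝ) : BddMeas (fun _ : α => c) := ⟨measurable_const, |c|, fun _ => le_rfl⟩

theorem add (hf : BddMeas f) (hg : BddMeas g) : BddMeas (fun x => f x + g x) := by
  obtain ⟨C, hC⟩ := hf.bdd
  obtain ⟨D, hD⟩ := hg.bdd
  exact ⟨hf.meas.add hg.meas, C + D, fun x => (abs_add_le _ _).trans (add_le_add (hC x) (hD x))⟩

theorem mul (hf : BddMeas f) (hg : BddMeas g) : BddMeas (fun x => f x * g x) := by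
  obtain ⟨C, hC⟩ := hf.bdd
  obtain ⟨D, hD⟩ := hg.bdd
  refine ⟨hf.meas.mul hg.meas, C * D, fun x => ?_⟩
  rw [abs_mul]
  exact mul_le_mul (hC x) (hD x) (abs_nonneg _) ((abs_nonneg _).trans (hC x))

theorem neg (hf : BddMeas f) : BddMeas (fun x => - f x) := by
  obtain ⟨C, hC⟩ := hf.bdd
  exact ⟨hf.meas.neg, C, fun x => by simpa using hC x⟩

theorem sub (hf : BddMeas f) (hg : BddMeas g) : BddMeas (fun x => f x - g x) := by
  simpa [sub_eq_add_neg] using hf.add hg.neg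

theorem abs (hf : BddMeas f) : BddMeas (fun x => |f x|) := by
  obtain ⟨C, hC⟩ := hf.bdd
  exact ⟨hf.meas.norm, C, fun x => by simpa using hC x⟩

theorem const_mul (c : ℝ) (hf : BddMeas f) : BddMeas (fun x => c * f x) := (const c).mul hf

theorem pow (hf : BddMeas f) (n : ℕ) : BddMeas (fun x => f x ^ n) := by
  induction n with
  | zero => simpa using const 1
  | succ n ih => simpa [pow_succ] using ih.mul hf

theorem sum {ι : Type*} (s : Finset ι) {F : ι → α → ℝ} (h : ∀ i ∈ s, BddMeas (F i)) :
    BddMeas (fun x => ∑ i ∈ s, F i x) := by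
  classical
  induction s using Finset.induction_on with
  | empty => simpa using const 0
  | insert a s ha ih =>
    simp only [Finset.sum_insert ha]
    exact (h a (Finset.mem_insert_self a s)).add
      (ih fun i hi => h i (Finset.mem_insert_of_mem hi))

theorem comp (hf : BddMeas f) {φ : β → α} (hφ : Measurable φ) : BddMeas (fun x => f (φ x)) := by
  obtain ⟨C, hC⟩ := hf.bdd
  exact ⟨hf.meas.comp hφ, C, fun x => hC _⟩

theorem of_mem_Icc {a b : ℝ} (hf : Measurable f) (h : ∀ x, f x ∈ Icc a b) : BddMeas f :=
  ⟨hf, max (-a) b, fun x => abs_le'.2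
    ⟨(h x).2.trans (le_max_right _ _), (neg_le_neg (h x).1).trans (le_max_left _ _)⟩⟩

theorem cos (c : ℝ) : BddMeas (fun x : ℝ => Real.cos (c * x)) :=
  ⟨by fun_prop, 1, fun _ => Real.abs_cos_le_one _⟩

theorem sin (c : ℝ) : BddMeas (fun x : ℝ => Real.sin (c * x)) :=
  ⟨by fun_prop, 1, fun _ => Real.abs_sin_le_one _⟩

theorem integrable {μ : Measure α} [IsFiniteMeasure μ] (hf : BddMeas f) : Integrable f μ := by
  obtain ⟨C, hC⟩ := hf.bdd
  exact Integrable.of_bound hf.meas.aestronglyMeasurable C (Eventually.of_forall hC)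

theorem intervalIntegrable {f : ℝ → ℝ} (hf : BddMeas f) (a b : ℝ) :
    IntervalIntegrable f volume a b := by
  rw [intervalIntegrable_iff]
  have : IsFiniteMeasure (volume.restrict (uIoc a b)) :=
    ⟨by simp [uIoc]⟩
  exact hf.integrable

theorem integral {f : α → ℝ → ℝ} (hf : BddMeas (fun z : α × ℝ => f z.1 z.2)) (a b : ℝ) :
    BddMeas (fun x => ∫ y in a..b, f x y) := by
  obtain ⟨C, hC⟩ := hf.bdd
  refine ⟨?_, C * |b - a|, fun x => ?_⟩
  · simp only [intervalIntegral]
    exact (hf.meas.stronglyMeasurable.integral_prod_right.measurable).sub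
      (hf.meas.stronglyMeasurable.integral_prod_right.measurable)
  · exact intervalIntegral.norm_integral_le_of_norm_le_const (f := f x) fun y _ => hC (x, y)

theorem prodMk_left {f : α × β → ℝ} (hf : BddMeas f) (x : α) : BddMeas (fun y => f (x, y)) :=
  hf.comp measurable_prodMk_left

theorem fst (hf : BddMeas f) : BddMeas (fun z : α × β => f z.1) := hf.comp measurable_fst

theorem snd (hf : BddMeas f) : BddMeas (fun z : β × α => f z.2) := hf.comp measurable_snd

end BddMeas

/-! ### Trigonometric coefficients on the unit interval -/

/-- The cosine coefficient `∫₀¹ f(x) cos(nπx) dx`. -/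
noncomputable def cosC (f : ℝ → ℝ) (n : ℤ) : ℝ := ∫ x in (0 : ℝ)..1, f x * Real.cos (n * Real.pi * x)

/-- The sine coefficient `∫₀¹ f(x) sin(nπx) dx`. -/
noncomputable def sinC (f : ℝ → ℝ) (n : ℤ) : ℝ := ∫ x in (0 : ℝ)..1, f x * Real.sin (n * Real.pi * x)

/-- The half (-1,0) of the integral is folded onto (0,1) by the parity of F. With ε = 1 the even
extension yields cosine coefficients, with ε = -1 the odd extension yields sine coefficients, so
both Parseval identities come from the complex one. -/
theorem fourierCoeffOn_symm_interval {F : ℝ → ℝ} {ε : ℝ} (hF : BddMeas F)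
    (hε : ∀ x ∈ Ioc (0 : ℝ) 1, F (-x) = ε * F x) (n : ℤ) :
    fourierCoeffOn (show (-1 : ℝ) < 1 by norm_num) (fun x => (F x : ℂ)) n =
      (1 / 2 : ℂ) * ∫ x in (0 : ℝ)..1,
        (Complex.exp (-(n * Real.pi * x * Complex.I)) + ε * Complex.exp (n * Real.pi * x * Complex.I))
          * (F x : ℂ) := by
  have hk (k : ℤ) (x : ℝ) : fourier k (x : AddCircle ((1 : ℝ) - (-1))) =
      Complex.exp (k * Real.pi * x * Complex.I) := by
    rw [fourier_coe_apply]
    congr 1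
    push_cast
    ring
  have hbi (k : ℤ) (a b : ℝ) : IntervalIntegrable
      (fun x : ℝ => Complex.exp (k * Real.pi * x * Complex.I) * (F x : ℂ)) volume a b := by
    obtain ⟨C, hC⟩ := hF.bdd
    rw [intervalIntegrable_iff]
    have : IsFiniteMeasure (volume.restrict (uIoc a b)) := ⟨by simp [uIoc]⟩
    refine Integrable.of_bound (C := C) ?_ (Eventually.of_forall fun x => ?_)
    · exact (Measurable.mul (by fun_prop) (Complex.measurable_ofReal.comp hF.meas)).aestronglyMeasurable
    · have : (k * Real.pi * x * Complex.I : ℂ) = ((k * Real.pi * x : ℝ) : ℂ) * Complex.I := by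
        push_cast; ring
      rw [norm_mul, this, Complex.norm_exp_ofReal_mul_I, one_mul]
      simpa using hC x
  rw [fourierCoeffOn_eq_integral]
  simp only [hk, smul_eq_mul]
  have h2 : (1 / (1 - -1 : ℝ)) = 1 / 2 := by norm_num
  rw [h2, ← intervalIntegral.integral_add_adjacent_intervals (b := 0)
    (hbi (-n) _ _) (hbi (-n) _ _)]
  have h3 := intervalIntegral.integral_comp_neg (a := 0) (b := 1)
    (fun x : ℝ => Complex.exp ((-n : ℤ) * Real.pi * x * Complex.I) * (F x : ℂ))
  rw [neg_zero] at h3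
  rw [← h3, ← intervalIntegral.integral_add]
  · rw [Complex.real_smul]
    push_cast
    congr 1
    apply intervalIntegral.integral_congr_ae
    refine Eventually.of_forall fun x hx => ?_
    rw [uIoc_of_le zero_le_one] at hx
    rw [hε x hx]
    have e1 : (-(n : ℂ) * Real.pi * -x * Complex.I) = n * Real.pi * x * Complex.I := by ring
    have e2 : (-(n : ℂ) * Real.pi * x * Complex.I) = -(n * Real.pi * x * Complex.I) := by ring
    rw [e1, e2]
    push_cast
    ring
  · have := (hbi (-n) (-1) 0).comp_mul_left (c := -1)
    rw [intervalIntegrable_iff] at this ⊢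
    simp only [neg_mul, one_mul] at this
    rw [uIoc_comm] at this
    norm_num at this
    simpa using this
  · exact hbi _ _ _

theorem measurable_ofReal_bdd {f : ℝ → ℝ} (hf : BddMeas f) :
    MemLp (fun x => (f x : ℂ)) 2 (volume.restrict (Ioc (-1 : ℝ) 1)) := by
  obtain ⟨C, hC⟩ := hf.bdd
  refine MemLp.of_bound (Complex.measurable_ofReal.comp hf.meas).aestronglyMeasurable C
    (Eventually.of_forall fun x => ?_)
  simpa using hC x

theorem integral_symm_interval_sq {F f : ℝ → ℝ} (hF : BddMeas F)
    (h1 : ∀ x ∈ Ioc (0 : ℝ) 1, F x ^ 2 = f x ^ 2) (h2 : ∀ x ∈ Ioc (0 : ℝ) 1, F (-x) ^ 2 = f x ^ 2) :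
    ∫ x in (-1 : ℝ)..1, F x ^ 2 = 2 * ∫ x in (0 : ℝ)..1, f x ^ 2 := by
  rw [← intervalIntegral.integral_add_adjacent_intervals (b := 0)
    ((hF.pow 2).intervalIntegrable _ _) ((hF.pow 2).intervalIntegrable _ _)]
  have h3 := intervalIntegral.integral_comp_neg (a := 0) (b := 1) (fun x : ℝ => F x ^ 2)
  rw [neg_zero] at h3
  rw [← h3, two_mul]
  congr 1 <;>
  · apply intervalIntegral.integral_congr_ae
    refine Eventually.of_forall fun x hx => ?_
    rw [uIoc_of_le zero_le_one] at hx
    first | exact h1 x hx | exact h2 x hx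

/-- Parseval's identity for cosine series. -/
theorem hasSum_cosC_sq {f : ℝ → ℝ} (hf : BddMeas f) :
    HasSum (fun n => cosC f n ^ 2) (∫ x in (0 : ℝ)..1, f x ^ 2) := by
  have hF : BddMeas fun x : ℝ => f |x| := hf.comp measurable_norm
  have hP := hasSum_sq_fourierCoeffOn (show (-1 : ℝ) < 1 by norm_num) (measurable_ofReal_bdd hF)
  convert hP using 1
  · funext n
    rw [fourierCoeffOn_symm_interval (ε := 1) hF (by simp)]
    have : (1 / 2 : ℂ) * ∫ x in (0 : ℝ)..1, (Complex.exp (-(n * Real.pi * x * Complex.I)) +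
        ((1 : ℝ) : ℂ) * Complex.exp (n * Real.pi * x * Complex.I)) * ((f |x| : ℝ) : ℂ) = (cosC f n : ℂ) := by
      rw [cosC, ← intervalIntegral.integral_const_mul, ← intervalIntegral.integral_ofReal]
      apply intervalIntegral.integral_congr_ae
      refine Eventually.of_forall fun x hx => ?_
      rw [uIoc_of_le zero_le_one] at hx
      rw [abs_of_pos hx.1]
      push_cast
      rw [Complex.cos]
      ring_nf
    rw [this]
    simp
  · have := integral_symm_interval_sq (f := f) hF (fun x hx => by rw [abs_of_pos hx.1])
      (fun x hx => by rw [abs_neg, abs_of_pos hx.1])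
    simp only [Complex.norm_real, Real.norm_eq_abs, sq_abs]
    rw [this, smul_eq_mul]
    ring

/-- Parseval's identity for sine series. -/
theorem hasSum_sinC_sq {f : ℝ → ℝ} (hf : BddMeas f) :
    HasSum (fun n => sinC f n ^ 2) (∫ x in (0 : ℝ)..1, f x ^ 2) := by
  have hF : BddMeas fun x : ℝ => if 0 < x then f x else - f (-x) := by
    obtain ⟨C, hC⟩ := hf.bdd
    refine ⟨Measurable.ite measurableSet_Ioi hf.meas (hf.meas.comp measurable_neg).neg, C,
      fun x => ?_⟩
    split_ifs
    · exact hC x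
    · simpa using hC (-x)
  have hn : ∀ x ∈ Ioc (0 : ℝ) 1, (if 0 < -x then f (-x) else - f (- -x)) = - f x := fun x hx => by
    rw [if_neg (by linarith [hx.1]), neg_neg]
  have hP := hasSum_sq_fourierCoeffOn (show (-1 : ℝ) < 1 by norm_num) (measurable_ofReal_bdd hF)
  convert hP using 1
  · funext n
    rw [fourierCoeffOn_symm_interval (ε := -1) hF
      (fun x hx => by rw [hn x hx, if_pos hx.1, neg_one_mul])]
    have : (1 / 2 : ℂ) * ∫ x in (0 : ℝ)..1, (Complex.exp (-(n * Real.pi * x * Complex.I)) +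
        ((-1 : ℝ) : ℂ) * Complex.exp (n * Real.pi * x * Complex.I)) *
          ((if 0 < x then f x else - f (-x) : ℝ) : ℂ) = (sinC f n : ℂ) * (-Complex.I) := by
      rw [sinC, ← intervalIntegral.integral_const_mul, ← intervalIntegral.integral_ofReal,
        ← intervalIntegral.integral_mul_const]
      apply intervalIntegral.integral_congr_ae
      refine Eventually.of_forall fun x hx => ?_
      rw [uIoc_of_le zero_le_one] at hx
      rw [if_pos hx.1]
      push_cast
      rw [Complex.sin]
      ring_nf
      rw [Complex.I_sq]
      ring
    rw [this]
    simp
  · have := integral_symm_interval_sq (f := f) hF (fun x hx => by rw [if_pos hx.1])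
      (fun x hx => by rw [hn x hx]; ring)
    simp only [Complex.norm_real, Real.norm_eq_abs, sq_abs]
    rw [this, smul_eq_mul]
    ring

/-! ### Fejér means -/

theorem cosC_neg (f : ℝ → ℝ) (n : ℤ) : cosC f (-n) = cosC f n := by
  simp only [cosC, Int.cast_neg, neg_mul, Real.cos_neg]

theorem sinC_neg (f : ℝ → ℝ) (n : ℤ) : sinC f (-n) = - sinC f n := by
  simp only [sinC, Int.cast_neg, neg_mul, Real.sin_neg, mul_neg, intervalIntegral.integral_neg]

theorem integral_cos_int (k : ℤ) :
    ∫ x in (0 : ℝ)..1, Real.cos (k * Real.pi * x) = if k = 0 then 1 else 0 := by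
  split_ifs with h
  · simp [h]
  · have hk : (k : ℝ) * Real.pi ≠ 0 := mul_ne_zero (by exact_mod_cast h) Real.pi_ne_zero
    rw [intervalIntegral.integral_comp_mul_left (fun x => Real.cos x) hk]
    simp [Real.sin_int_mul_pi]

theorem cosC_cos (m n : ℤ) : cosC (fun x => Real.cos (m * Real.pi * x)) n =
    1 / 2 * ((if m = n then 1 else 0) + (if m = -n then 1 else 0)) := by
  have h1 := integral_cos_int (m - n)
  have h2 := integral_cos_int (m + n)
  simp only [sub_eq_zero, add_eq_zero_iff_eq_neg] at h1 h2
  rw [← h1, ← h2, ← intervalIntegral.integral_add ((BddMeas.cos _).intervalIntegrable _ _)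
    ((BddMeas.cos _).intervalIntegrable _ _), ← intervalIntegral.integral_const_mul, cosC]
  congr 1
  funext x
  push_cast
  rw [show (m - n : ℝ) * Real.pi * x = m * Real.pi * x - n * Real.pi * x by ring,
    show (m + n : ℝ) * Real.pi * x = m * Real.pi * x + n * Real.pi * x by ring,
    Real.cos_add, Real.cos_sub]
  ring

theorem sinC_sin (m n : ℤ) : sinC (fun x => Real.sin (m * Real.pi * x)) n =
    1 / 2 * ((if m = n then 1 else 0) - (if m = -n then 1 else 0)) := by
  have h1 := integral_cos_int (m - n)
  have h2 := integral_cos_int (m + n)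
  simp only [sub_eq_zero, add_eq_zero_iff_eq_neg] at h1 h2
  rw [← h1, ← h2, ← intervalIntegral.integral_sub ((BddMeas.cos _).intervalIntegrable _ _)
    ((BddMeas.cos _).intervalIntegrable _ _), ← intervalIntegral.integral_const_mul, sinC]
  congr 1
  funext x
  push_cast
  rw [show (m - n : ℝ) * Real.pi * x = m * Real.pi * x - n * Real.pi * x by ring,
    show (m + n : ℝ) * Real.pi * x = m * Real.pi * x + n * Real.pi * x by ring,
    Real.cos_add, Real.cos_sub]
  ring

/-- The arithmetic mean of the values `c (j - k)`, `0 ≤ j, k < N`, multiplied by `N`. -/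
noncomputable def fejerSum (N : ℕ) (c : ℤ → ℝ) : ℝ :=
  1 / N * ∑ j ∈ Finset.range N, ∑ k ∈ Finset.range N, c ((j : ℤ) - k)

theorem fejerSum_add (N : ℕ) (c d : ℤ → ℝ) :
    fejerSum N (fun n => c n + d n) = fejerSum N c + fejerSum N d := by
  simp only [fejerSum, Finset.sum_add_distrib, mul_add]

theorem fejerSum_const_mul (N : ℕ) (a : ℝ) (c : ℤ → ℝ) :
    fejerSum N (fun n => a * c n) = a * fejerSum N c := by
  simp only [fejerSum, ← Finset.mul_sum]
  ring

theorem fejerSum_sub (N : ℕ) (c d : ℤ → ℝ) :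
    fejerSum N (fun n => c n - d n) = fejerSum N c - fejerSum N d := by
  simp only [fejerSum, Finset.sum_sub_distrib, mul_sub]

theorem fejerSum_mul_const (N : ℕ) (a : ℝ) (c : ℤ → ℝ) :
    fejerSum N (fun n => c n * a) = fejerSum N c * a := by
  simp only [mul_comm _ a, fejerSum_const_mul]

theorem fejerSum_comp_neg (N : ℕ) (c : ℤ → ℝ) : fejerSum N (fun n => c (-n)) = fejerSum N c := by
  simp only [fejerSum, neg_sub]
  rw [Finset.sum_comm]

theorem BddMeas.fejerSum {α : Type*} [MeasurableSpace α] (N : ℕ) {c : ℤ → α → ℝ}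
    (h : ∀ n, BddMeas (c n)) : BddMeas (fun x => fejerSum N (fun n => c n x)) :=
  (BddMeas.sum _ fun _ _ => BddMeas.sum _ fun _ _ => h _).const_mul _

theorem fejerSum_integral (N : ℕ) {c : ℤ → ℝ → ℝ} {a b : ℝ}
    (h : ∀ n, IntervalIntegrable (c n) volume a b) :
    ∫ x in a..b, fejerSum N (fun n => c n x) = fejerSum N (fun n => ∫ x in a..b, c n x) := by
  simp only [fejerSum]
  rw [intervalIntegral.integral_const_mul, intervalIntegral.integral_finsetSum]
  · congr 1
    refine Finset.sum_congr rfl fun j _ => ?_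
    rw [intervalIntegral.integral_finsetSum]
    exact fun k _ => h _
  · intro j _
    have := IntervalIntegrable.sum (μ := volume) (a := a) (b := b) (Finset.range N)
      (f := fun k : ℕ => c ((j : ℤ) - k)) fun k _ => h _
    simpa only [Finset.sum_fn] using this

theorem hasDerivAt_fejerSum (N : ℕ) {c c' : ℤ → ℝ → ℝ} {x : ℝ}
    (h : ∀ n, HasDerivAt (c n) (c' n x) x) :
    HasDerivAt (fun y => fejerSum N (fun n => c n y)) (fejerSum N (fun n => c' n x)) x :=
  (HasDerivAt.fun_sum fun _ _ => HasDerivAt.fun_sum fun _ _ => h _).const_mul _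

theorem continuous_fejerSum {α : Type*} [TopologicalSpace α] (N : ℕ) {c : ℤ → α → ℝ}
    (h : ∀ n, Continuous (c n)) : Continuous (fun x => fejerSum N (fun n => c n x)) :=
  (continuous_finsetSum _ fun _ _ => continuous_finsetSum _ fun _ _ => h _).const_mul _

/-- The Fejér weights. -/
noncomputable def fejerWeight (N : ℕ) (n : ℤ) : ℝ := fejerSum N (fun k => if k = n then 1 else 0)

theorem fejerWeight_neg (N : ℕ) (n : ℤ) : fejerWeight N (-n) = fejerWeight N n := by
  rw [fejerWeight, ← fejerSum_comp_neg, fejerWeight]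
  simp only [neg_inj]

theorem fejerWeight_nonneg (N : ℕ) (n : ℤ) : 0 ≤ fejerWeight N n :=
  mul_nonneg (by positivity) (Finset.sum_nonneg fun _ _ => Finset.sum_nonneg fun _ _ => by
    beta_reduce; split_ifs <;> simp)

/-- For each j at most one k satisfies j - k = n. -/
theorem fejerWeight_le_one (N : ℕ) (n : ℤ) : fejerWeight N n ≤ 1 := by
  rcases Nat.eq_zero_or_pos N with rfl | hN
  · simp [fejerWeight, fejerSum]
  have hN' : (0 : ℝ) < N := by exact_mod_cast hN
  have h : ∑ j ∈ Finset.range N, ∑ k ∈ Finset.range N,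
      (if (j : ℤ) - k = n then (1 : ℝ) else 0) ≤ ∑ j ∈ Finset.range N, 1 := by
    refine Finset.sum_le_sum fun j _ => ?_
    rw [Finset.sum_boole, Nat.cast_le_one, Finset.card_le_one]
    intro a ha b hb
    have h1 : (j : ℤ) - a = n := by simpa using (Finset.mem_filter.1 ha).2
    have h2 : (j : ℤ) - b = n := by simpa using (Finset.mem_filter.1 hb).2
    omega
  rw [Finset.sum_const, Finset.card_range, nsmul_eq_mul, mul_one] at h
  calc fejerWeight N n ≤ 1 / N * N := mul_le_mul_of_nonneg_left h (by positivity)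
    _ = 1 := by field_simp

/-- For a = |n| < N, every j in [a, N) has the partner k = j - a, which bounds the weight below by 1
- a/N. -/
theorem tendsto_fejerWeight (n : ℤ) : Tendsto (fun N => fejerWeight N n) atTop (𝓝 1) := by
  wlog hn : 0 ≤ n generalizing n
  · simpa only [fejerWeight_neg] using this (-n) (by omega)
  obtain ⟨a, rfl⟩ := Int.eq_ofNat_of_zero_le hn
  have hlim : Tendsto (fun N : ℕ => 1 - (a : ℝ) / N) atTop (𝓝 1) := by
    simpa using (tendsto_const_div_atTop_nhds_zero_nat (a : ℝ)).const_sub 1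
  refine tendsto_of_tendsto_of_tendsto_of_le_of_le' hlim tendsto_const_nhds ?_
    (Eventually.of_forall fun N => fejerWeight_le_one N a)
  filter_upwards [eventually_gt_atTop a] with N hN
  have hN' : (0 : ℝ) < N := by exact_mod_cast (Nat.zero_le a).trans_lt hN
  have h : ∑ j ∈ Finset.Ico a N, (1 : ℝ) ≤ ∑ j ∈ Finset.range N, ∑ k ∈ Finset.range N,
      (if (j : ℤ) - k = (a : ℤ) then (1 : ℝ) else 0) := by
    refine (Finset.sum_le_sum fun j hj => ?_).trans
      (Finset.sum_le_sum_of_subset_of_nonneg (f := fun j : ℕ => ∑ k ∈ Finset.range N,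
        (if (j : ℤ) - k = (a : ℤ) then (1 : ℝ) else 0)) (s := Finset.Ico a N) ?_ ?_)
    · rw [Finset.mem_Ico] at hj
      have hmem : j - a ∈ Finset.range N := Finset.mem_range.2 (by omega)
      refine le_trans ?_ (Finset.single_le_sum (f := fun k : ℕ =>
        (if (j : ℤ) - k = (a : ℤ) then (1 : ℝ) else 0)) (fun k _ => by split_ifs <;> simp) hmem)
      rw [if_pos (by push_cast [hj.1]; ring)]
    · intro j hj
      exact Finset.mem_range.2 (Finset.mem_Ico.1 hj).2
    · exact fun j _ _ => Finset.sum_nonneg fun k _ => by split_ifs <;> simp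
  rw [Finset.sum_const, Nat.card_Ico, nsmul_eq_mul, mul_one, Nat.cast_sub hN.le] at h
  calc 1 - (a : ℝ) / N = 1 / N * (N - a) := by field_simp
    _ ≤ _ := mul_le_mul_of_nonneg_left h (by positivity)

/-- Fejér mean of a cosine series. -/
noncomputable def fejerCos (N : ℕ) (c : ℤ → ℝ) (v : ℝ) : ℝ :=
  fejerSum N (fun n => c n * Real.cos (n * Real.pi * v))

/-- Fejér mean of a sine series. -/
noncomputable def fejerSin (N : ℕ) (c : ℤ → ℝ) (v : ℝ) : ℝ :=
  fejerSum N (fun n => c n * Real.sin (n * Real.pi * v))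

theorem bddMeas_fejerCos (N : ℕ) (c : ℤ → ℝ) : BddMeas (fejerCos N c) :=
  BddMeas.fejerSum N fun _ => (BddMeas.cos _).const_mul _

theorem bddMeas_fejerSin (N : ℕ) (c : ℤ → ℝ) : BddMeas (fejerSin N c) :=
  BddMeas.fejerSum N fun _ => (BddMeas.sin _).const_mul _

/-- Orthogonality of cosines: the modes n and -n are the same function and contribute one half each,
which is why the coefficients have to be even. -/
theorem cosC_fejerCos (N : ℕ) {c : ℤ → ℝ} (hc : ∀ n, c (-n) = c n) (n : ℤ) :
    cosC (fejerCos N c) n = fejerWeight N n * c n := by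
  have h1 : cosC (fejerCos N c) n =
      fejerSum N (fun m => c m * cosC (fun x => Real.cos (m * Real.pi * x)) n) := by
    simp only [cosC, fejerCos, ← intervalIntegral.integral_const_mul]
    rw [← fejerSum_integral]
    · congr 1
      funext x
      rw [← fejerSum_mul_const]
      congr 1
      funext m
      ring
    · exact fun m => (((BddMeas.cos _).mul (BddMeas.cos _)).const_mul _).intervalIntegrable _ _
  have h2 : (fun m => c m * cosC (fun x => Real.cos (m * Real.pi * x)) n) =
      fun m => (c n * (1 / 2)) * (if m = n then 1 else 0) +
        (c n * (1 / 2)) * (if m = -n then 1 else 0) := by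
    funext m
    rw [cosC_cos]
    split_ifs with h h' h'
    · rw [h]; ring
    · rw [h]; ring
    · rw [h', hc]; ring
    · ring
  rw [h1, h2, fejerSum_add, fejerSum_const_mul, fejerSum_const_mul]
  change c n * (1 / 2) * fejerWeight N n + c n * (1 / 2) * fejerWeight N (-n) = _
  rw [fejerWeight_neg]
  ring

theorem sinC_fejerSin (N : ℕ) {c : ℤ → ℝ} (hc : ∀ n, c (-n) = - c n) (n : ℤ) :
    sinC (fejerSin N c) n = fejerWeight N n * c n := by
  have h1 : sinC (fejerSin N c) n =
      fejerSum N (fun m => c m * sinC (fun x => Real.sin (m * Real.pi * x)) n) := by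
    simp only [sinC, fejerSin, ← intervalIntegral.integral_const_mul]
    rw [← fejerSum_integral]
    · congr 1
      funext x
      rw [← fejerSum_mul_const]
      congr 1
      funext m
      ring
    · exact fun m => (((BddMeas.sin _).mul (BddMeas.sin _)).const_mul _).intervalIntegrable _ _
  have h2 : (fun m => c m * sinC (fun x => Real.sin (m * Real.pi * x)) n) =
      fun m => (c n * (1 / 2)) * (if m = n then 1 else 0) +
        (c n * (1 / 2)) * (if m = -n then 1 else 0) := by
    funext m
    rw [sinC_sin]
    split_ifs with h h' h'
    -- Here n = m = -n, so n = 0, where an odd sequence vanishes.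
    · have : c n = 0 := by
        have h0 : n = 0 := by omega
        have := hc 0
        rw [h0]
        simp at this
        linarith
      rw [h, this]; ring
    · rw [h]; ring
    · rw [h', hc]; ring
    · ring
  rw [h1, h2, fejerSum_add, fejerSum_const_mul, fejerSum_const_mul]
  change c n * (1 / 2) * fejerWeight N n + c n * (1 / 2) * fejerWeight N (-n) = _
  rw [fejerWeight_neg]
  ring

/-- Through Parseval, the L² error of a Fejér mean is the sum of (1 - weight)² c_n². Each term tends
to zero and is dominated by c_n². -/
theorem tendsto_of_hasSum_weights {c : ℤ → ℝ} {A : ℝ} (hc : HasSum (fun n => c n ^ 2) A)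
    {E : ℕ → ℝ} (hE : ∀ N, HasSum (fun n => (fejerWeight N n * c n - c n) ^ 2) (E N)) :
    Tendsto E atTop (𝓝 0) := by
  have h := tendsto_tsum_of_dominated_convergence (𝓕 := atTop)
    (f := fun N n => (fejerWeight N n * c n - c n) ^ 2) (g := fun _ => (0 : ℝ))
    (bound := fun n => c n ^ 2) hc.summable ?_ ?_
  · simp only [tsum_zero] at h
    exact h.congr fun N => (hE N).tsum_eq
  · intro n
    have := (((tendsto_fejerWeight n).mul_const (c n)).sub_const (c n)).pow 2
    simpa using this
  · refine Eventually.of_forall fun N n => ?_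
    rw [Real.norm_eq_abs, abs_of_nonneg (sq_nonneg _),
      show (fejerWeight N n * c n - c n) ^ 2 = (1 - fejerWeight N n) ^ 2 * c n ^ 2 by ring]
    have h0 := fejerWeight_nonneg N n
    have h1 := fejerWeight_le_one N n
    exact mul_le_of_le_one_left (sq_nonneg _) (by nlinarith)

theorem cosC_sub {f g : ℝ → ℝ} (hf : BddMeas f) (hg : BddMeas g) (n : ℤ) :
    cosC (fun x => f x - g x) n = cosC f n - cosC g n := by
  simp only [cosC, sub_mul]
  exact intervalIntegral.integral_sub ((hf.mul (BddMeas.cos _)).intervalIntegrable _ _)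
    ((hg.mul (BddMeas.cos _)).intervalIntegrable _ _)

theorem sinC_sub {f g : ℝ → ℝ} (hf : BddMeas f) (hg : BddMeas g) (n : ℤ) :
    sinC (fun x => f x - g x) n = sinC f n - sinC g n := by
  simp only [sinC, sub_mul]
  exact intervalIntegral.integral_sub ((hf.mul (BddMeas.sin _)).intervalIntegrable _ _)
    ((hg.mul (BddMeas.sin _)).intervalIntegrable _ _)

theorem tendsto_fejerCos_L2 {f : ℝ → ℝ} (hf : BddMeas f) :
    Tendsto (fun N => ∫ v in (0 : ℝ)..1, (fejerCos N (cosC f) v - f v) ^ 2) atTop (𝓝 0) := by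
  refine tendsto_of_hasSum_weights (hasSum_cosC_sq hf) fun N => ?_
  have := hasSum_cosC_sq ((bddMeas_fejerCos N (cosC f)).sub hf)
  simpa only [cosC_sub (bddMeas_fejerCos N (cosC f)) hf, cosC_fejerCos N (cosC_neg f)] using this

theorem tendsto_fejerSin_L2 {f : ℝ → ℝ} (hf : BddMeas f) :
    Tendsto (fun N => ∫ v in (0 : ℝ)..1, (fejerSin N (sinC f) v - f v) ^ 2) atTop (𝓝 0) := by
  refine tendsto_of_hasSum_weights (hasSum_sinC_sq hf) fun N => ?_
  have := hasSum_sinC_sq ((bddMeas_fejerSin N (sinC f)).sub hf)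
  simpa only [sinC_sub (bddMeas_fejerSin N (sinC f)) hf, sinC_fejerSin N (sinC_neg f)] using this

/-- The variance of |f| over the unit interval is nonnegative. -/
theorem sq_integral_abs_le {f : ℝ → ℝ} (hf : BddMeas f) :
    (∫ v in (0 : ℝ)..1, |f v|) ^ 2 ≤ ∫ v in (0 : ℝ)..1, f v ^ 2 := by
  set A := ∫ v in (0 : ℝ)..1, |f v| with hA
  have h : 0 ≤ ∫ v in (0 : ℝ)..1, (|f v| - A) ^ 2 :=
    intervalIntegral.integral_nonneg zero_le_one fun _ _ => sq_nonneg _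
  have h2 : ∫ v in (0 : ℝ)..1, (|f v| - A) ^ 2 = (∫ v in (0 : ℝ)..1, f v ^ 2) - A ^ 2 := by
    have : (fun v => (|f v| - A) ^ 2) = fun v => f v ^ 2 - (2 * A * |f v| - A ^ 2) := by
      funext v
      rw [sub_sq, sq_abs]
      ring
    rw [this, intervalIntegral.integral_sub ((hf.pow 2).intervalIntegrable _ _)
      (((hf.abs.const_mul (2 * A)).sub (BddMeas.const (A ^ 2))).intervalIntegrable _ _),
      intervalIntegral.integral_sub ((hf.abs.const_mul (2 * A)).intervalIntegrable _ _)
      ((BddMeas.const (A ^ 2)).intervalIntegrable _ _), intervalIntegral.integral_const_mul, ← hA,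
      intervalIntegral.integral_const]
    simp only [smul_eq_mul]
    ring
  linarith

theorem tendsto_integral_abs_of_sq {f : ℕ → ℝ → ℝ} (hf : ∀ N, BddMeas (f N))
    (h : Tendsto (fun N => ∫ v in (0 : ℝ)..1, f N v ^ 2) atTop (𝓝 0)) :
    Tendsto (fun N => ∫ v in (0 : ℝ)..1, |f N v|) atTop (𝓝 0) := by
  have h2 := h.sqrt
  rw [Real.sqrt_zero] at h2
  refine squeeze_zero (fun N => intervalIntegral.integral_nonneg zero_le_one
    fun _ _ => abs_nonneg _) (fun N => ?_) h2
  exact Real.le_sqrt_of_sq_le (sq_integral_abs_le (hf N))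

theorem tendsto_fejerCos_L1 {f : ℝ → ℝ} (hf : BddMeas f) :
    Tendsto (fun N => ∫ v in (0 : ℝ)..1, |fejerCos N (cosC f) v - f v|) atTop (𝓝 0) :=
  tendsto_integral_abs_of_sq (fun N => (bddMeas_fejerCos N _).sub hf) (tendsto_fejerCos_L2 hf)

theorem tendsto_fejerSin_L1 {f : ℝ → ℝ} (hf : BddMeas f) :
    Tendsto (fun N => ∫ v in (0 : ℝ)..1, |fejerSin N (sinC f) v - f v|) atTop (𝓝 0) :=
  tendsto_integral_abs_of_sq (fun N => (bddMeas_fejerSin N _).sub hf) (tendsto_fejerSin_L2 hf)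

theorem integral_fejerSin_sq_le {f : ℝ → ℝ} (hf : BddMeas f) (N : ℕ) :
    ∫ v in (0 : ℝ)..1, fejerSin N (sinC f) v ^ 2 ≤ ∫ v in (0 : ℝ)..1, f v ^ 2 := by
  have h := hasSum_sinC_sq (bddMeas_fejerSin N (sinC f))
  simp only [sinC_fejerSin N (sinC_neg f)] at h
  refine hasSum_le (fun n => ?_) h (hasSum_sinC_sq hf)
  rw [mul_pow]
  have h0 := fejerWeight_nonneg N n
  have h1 := fejerWeight_le_one N n
  exact mul_le_of_le_one_left (sq_nonneg _) (by nlinarith)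

theorem integral_abs_fejerSin_le {f : ℝ → ℝ} (hf : BddMeas f) (N : ℕ) {C : ℝ} (hC : 0 ≤ C)
    (hfC : ∀ x, |f x| ≤ C) : ∫ v in (0 : ℝ)..1, |fejerSin N (sinC f) v| ≤ C := by
  refine abs_le_of_sq_le_sq' ?_ hC |>.2
  refine (sq_integral_abs_le (bddMeas_fejerSin N _)).trans ((integral_fejerSin_sq_le hf N).trans ?_)
  have : ∫ v in (0 : ℝ)..1, f v ^ 2 ≤ ∫ _ in (0 : ℝ)..1, C ^ 2 :=
    intervalIntegral.integral_mono_on zero_le_one ((hf.pow 2).intervalIntegrable _ _)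
      ((BddMeas.const _).intervalIntegrable _ _)
      fun x _ => sq_le_sq' (neg_le_of_abs_le (hfC x)) (le_of_abs_le (hfC x))
  simpa using this

/-- The Fejér kernel is nonnegative. -/
theorem fejerSum_cos_nonneg (N : ℕ) (θ : ℝ) : 0 ≤ fejerSum N (fun n => Real.cos (n * θ)) := by
  refine mul_nonneg (by positivity) ?_
  have : ∑ j ∈ Finset.range N, ∑ k ∈ Finset.range N, Real.cos (((j : ℤ) - k : ℤ) * θ) =
      (∑ j ∈ Finset.range N, Real.cos (j * θ)) ^ 2 + (∑ j ∈ Finset.range N, Real.sin (j * θ)) ^ 2 := by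
    rw [sq, sq, Finset.sum_mul_sum, Finset.sum_mul_sum, ← Finset.sum_add_distrib]
    refine Finset.sum_congr rfl fun j _ => ?_
    rw [← Finset.sum_add_distrib]
    refine Finset.sum_congr rfl fun k _ => ?_
    push_cast
    rw [sub_mul, Real.cos_sub]
  rw [this]
  positivity

/-- By the product formula this is half the sum of the Fejér kernels at w - v and at its reflection
w + v. -/
theorem fejerSum_cos_mul_cos_nonneg (N : ℕ) (v w : ℝ) :
    0 ≤ fejerSum N (fun n => Real.cos (n * Real.pi * w) * Real.cos (n * Real.pi * v)) := by
  have : (fun n : ℤ => Real.cos (n * Real.pi * w) * Real.cos (n * Real.pi * v)) = fun n : ℤ =>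
      1 / 2 * (Real.cos (n * (Real.pi * (w - v))) + Real.cos (n * (Real.pi * (w + v)))) := by
    funext n
    rw [show n * (Real.pi * (w - v)) = n * Real.pi * w - n * Real.pi * v by ring,
      show n * (Real.pi * (w + v)) = n * Real.pi * w + n * Real.pi * v by ring,
      Real.cos_add, Real.cos_sub]
    ring
  rw [this, fejerSum_const_mul, fejerSum_add]
  exact mul_nonneg (by norm_num) (add_nonneg (fejerSum_cos_nonneg N _) (fejerSum_cos_nonneg N _))

theorem fejerCos_eq_integral {f : ℝ → ℝ} (hf : BddMeas f) (N : ℕ) (v : ℝ) :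
    fejerCos N (cosC f) v = ∫ w in (0 : ℝ)..1,
      fejerSum N (fun n => Real.cos (n * Real.pi * w) * Real.cos (n * Real.pi * v)) * f w := by
  simp only [← fejerSum_mul_const]
  rw [fejerSum_integral]
  · simp only [fejerCos, cosC, ← intervalIntegral.integral_mul_const]
    congr 1
    funext n
    congr 1
    funext x
    ring
  · exact fun n => ((((BddMeas.cos _).mul (BddMeas.const _))).mul hf).intervalIntegrable _ _

theorem fejerCos_nonneg {f : ℝ → ℝ} (hf : BddMeas f) (h0 : ∀ x, 0 ≤ f x) (N : ℕ) (v : ℝ) :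
    0 ≤ fejerCos N (cosC f) v := by
  rw [fejerCos_eq_integral hf]
  exact intervalIntegral.integral_nonneg zero_le_one fun w _ =>
    mul_nonneg (fejerSum_cos_mul_cos_nonneg N v w) (h0 w)

theorem fejerWeight_zero {N : ℕ} (hN : 0 < N) : fejerWeight N 0 = 1 := by
  have : (N : ℝ) ≠ 0 := by positivity
  have h : ∀ j ∈ Finset.range N, ∑ k ∈ Finset.range N,
      (if (j : ℤ) - k = 0 then (1 : ℝ) else 0) = 1 := by
    intro j hj
    rw [Finset.sum_eq_single j]
    · simp
    · intro k _ hk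
      rw [if_neg (by omega)]
    · exact fun h => absurd hj h
  rw [fejerWeight, fejerSum, Finset.sum_congr rfl h]
  simp [this]

theorem fejerSum_of_ne_zero {N : ℕ} (hN : 0 < N) {c : ℤ → ℝ} (hc : ∀ n ≠ 0, c n = 0) :
    fejerSum N c = c 0 := by
  have : c = fun n => c 0 * (if n = 0 then 1 else 0) := by
    funext n
    split_ifs with h
    · simp [h]
    · simp [hc n h]
  rw [this, fejerSum_const_mul]
  change _ * fejerWeight N 0 = _
  simp [fejerWeight_zero hN]

/-- Positivity of the mean applied to 1 - f, since Fejér means reproduce constants once N > 0. -/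
theorem fejerCos_le_one {f : ℝ → ℝ} (hf : BddMeas f) (h1 : ∀ x, f x ≤ 1) {N : ℕ} (hN : 0 < N)
    (v : ℝ) : fejerCos N (cosC f) v ≤ 1 := by
  have h := fejerCos_nonneg ((BddMeas.const 1).sub hf) (fun x => sub_nonneg.2 (h1 x)) N v
  have h2 : fejerCos N (cosC fun x => 1 - f x) v = 1 - fejerCos N (cosC f) v := by
    have hc1 : ∀ n, cosC (fun _ => 1) n = if n = 0 then 1 else 0 := fun n => by
      simp only [cosC, one_mul]
      exact integral_cos_int n
    have : fejerSum N (fun n => (if n = 0 then (1 : ℝ) else 0) * Real.cos (n * Real.pi * v)) = 1 := by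
      rw [fejerSum_of_ne_zero hN (fun n hn => by simp [hn])]
      simp
    simp only [fejerCos, cosC_sub (BddMeas.const 1) hf, sub_mul, fejerSum_sub, hc1]
    rw [this]
  linarith

/-! ### Change of variables along a bi-Lipschitz primitive -/

/-- A measurable probability density on `[0,1]` (defined on the line) which is bounded, and bounded
away from zero. -/
structure IsDensity (g : ℝ → ℝ) : Prop where
  bddMeas : BddMeas g
  lower : ∃ c : ℝ, 0 < c ∧ ∀ x, c ≤ g x
  mass : ∫ x in (0 : ℝ)..1, g x = 1

namespace IsDensity

variable {g : ℝ → ℝ} (hg : IsDensity g)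
include hg

theorem primitive_sub (x y : ℝ) :
    (∫ z in (0 : ℝ)..y, g z) - ∫ z in (0 : ℝ)..x, g z = ∫ z in x..y, g z :=
  intervalIntegral.integral_interval_sub_left (hg.bddMeas.intervalIntegrable _ _)
    (hg.bddMeas.intervalIntegrable _ _)

theorem le_primitive_sub {c : ℝ} (hc : ∀ x, c ≤ g x) {x y : ℝ} (hxy : x ≤ y) :
    c * (y - x) ≤ (∫ z in (0 : ℝ)..y, g z) - ∫ z in (0 : ℝ)..x, g z := by
  rw [hg.primitive_sub]
  have := intervalIntegral.integral_mono_on hxy ((BddMeas.const c).intervalIntegrable x y)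
    (hg.bddMeas.intervalIntegrable x y) fun z _ => hc z
  simpa [mul_comm] using this

theorem strictMono : StrictMono fun x => ∫ z in (0 : ℝ)..x, g z := by
  intro x y hxy
  obtain ⟨c, hc, hcg⟩ := hg.lower
  have := hg.le_primitive_sub hcg hxy.le
  have := mul_pos hc (sub_pos.2 hxy)
  simp only
  linarith

theorem continuous : Continuous fun x => ∫ z in (0 : ℝ)..x, g z :=
  intervalIntegral.continuous_primitive hg.bddMeas.intervalIntegrable 0

theorem surjective : Function.Surjective fun x => ∫ z in (0 : ℝ)..x, g z := by
  obtain ⟨c, hc, hcg⟩ := hg.lower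
  refine hg.continuous.surjective ?_ ?_
  · refine tendsto_atTop_mono' atTop ?_ (tendsto_id.const_mul_atTop hc)
    filter_upwards [eventually_ge_atTop 0] with x hx
    simpa using hg.le_primitive_sub hcg hx
  · refine tendsto_atBot_mono' atBot ?_ (tendsto_id.const_mul_atBot hc)
    filter_upwards [eventually_le_atBot 0] with x hx
    have := hg.le_primitive_sub hcg hx
    simp only [intervalIntegral.integral_same] at this
    simp only [id]
    linarith

/-- The primitive of a density, as an order isomorphism of the line. -/
noncomputable def iso : ℝ ≃o ℝ := hg.strictMono.orderIsoOfSurjective _ hg.surjective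

theorem iso_apply (x : ℝ) : hg.iso x = ∫ z in (0 : ℝ)..x, g z := rfl

theorem iso_zero : hg.iso 0 = 0 := by simp [iso_apply]

theorem iso_one : hg.iso 1 = 1 := by rw [iso_apply, hg.mass]

theorem iso_symm_zero : hg.iso.symm 0 = 0 := by rw [OrderIso.symm_apply_eq, iso_zero]

theorem iso_symm_one : hg.iso.symm 1 = 1 := by rw [OrderIso.symm_apply_eq, iso_one]

theorem iso_mem {x : ℝ} (hx : x ∈ Icc (0 : ℝ) 1) : hg.iso x ∈ Icc (0 : ℝ) 1 := by
  rw [← hg.iso_zero, ← hg.iso_one]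
  exact ⟨hg.iso.monotone (by simpa [hg.iso_zero] using hx.1),
    hg.iso.monotone (by simpa [hg.iso_one] using hx.2)⟩

theorem iso_symm_mem {x : ℝ} (hx : x ∈ Icc (0 : ℝ) 1) : hg.iso.symm x ∈ Icc (0 : ℝ) 1 := by
  rw [← hg.iso_symm_zero, ← hg.iso_symm_one]
  exact ⟨hg.iso.symm.monotone (by simpa [hg.iso_symm_zero] using hx.1),
    hg.iso.symm.monotone (by simpa [hg.iso_symm_one] using hx.2)⟩

/-- Both measures give the interval (a, b) the mass b - a: the integral of g between the preimages
of a and b is the difference of the primitive there. Intervals with rational endpoints suffice. -/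
theorem map_withDensity :
    (volume.withDensity fun x => ENNReal.ofReal (g x)).map hg.iso = volume := by
  symm
  have hm : Measurable hg.iso := hg.iso.continuous.measurable
  obtain ⟨c, hc, hcg⟩ := hg.lower
  refine Real.measure_ext_Ioo_rat fun a b => ?_
  rw [Measure.map_apply hm measurableSet_Ioo, OrderIso.preimage_Ioo,
    withDensity_apply _ measurableSet_Ioo, Real.volume_Ioo]
  rcases le_total (b : ℝ) a with hab | hab
  · rw [Ioo_eq_empty (not_lt.2 (hg.iso.symm.monotone hab)), ENNReal.ofReal_of_nonpos (by linarith)]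
    simp
  · have hab' := hg.iso.symm.monotone hab
    rw [← ofReal_integral_eq_lintegral_ofReal, ← integral_Ioc_eq_integral_Ioo,
      ← intervalIntegral.integral_of_le hab', ← hg.primitive_sub, ← hg.iso_apply, ← hg.iso_apply,
      OrderIso.apply_symm_apply, OrderIso.apply_symm_apply]
    · exact (hg.bddMeas.intervalIntegrable _ _).1.mono_set Ioo_subset_Ioc_self
    · exact Eventually.of_forall fun x => hc.le.trans (hcg x)

/-- The primitive is a homeomorphism, hence a measurable embedding, so the substitution rule holds
for arbitrary f without any measurability assumption. -/
theorem integral_comp (f : ℝ → ℝ) {x y : ℝ} (hxy : x ≤ y) :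
    ∫ v in hg.iso x..hg.iso y, f v = ∫ u in x..y, f (hg.iso u) * g u := by
  obtain ⟨c, hc, hcg⟩ := hg.lower
  have he : MeasurableEmbedding hg.iso := hg.iso.toHomeomorph.measurableEmbedding
  rw [intervalIntegral.integral_of_le (hg.iso.monotone hxy), intervalIntegral.integral_of_le hxy]
  conv_lhs => rw [← hg.map_withDensity]
  rw [he.setIntegral_map]
  have : hg.iso ⁻¹' Ioc (hg.iso x) (hg.iso y) = Ioc x y := by
    rw [OrderIso.preimage_Ioc]
    simp
  rw [this, setIntegral_withDensity_eq_setIntegral_toReal_smul]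
  · refine setIntegral_congr_fun measurableSet_Ioc fun u _ => ?_
    simp only [smul_eq_mul]
    rw [ENNReal.toReal_ofReal (hc.le.trans (hcg u)), mul_comm]
  · exact hg.bddMeas.meas.ennreal_ofReal
  · exact Eventually.of_forall fun _ => ENNReal.ofReal_lt_top
  · exact measurableSet_Ioc

theorem integral_comp_zero (f : ℝ → ℝ) {u : ℝ} (hu : 0 ≤ u) :
    ∫ v in (0 : ℝ)..hg.iso u, f v = ∫ x in (0 : ℝ)..u, f (hg.iso x) * g x := by
  conv_lhs => rw [← hg.iso_zero]
  exact hg.integral_comp f hu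

theorem integral_comp_zero_one (f : ℝ → ℝ) :
    ∫ v in (0 : ℝ)..1, f v = ∫ x in (0 : ℝ)..1, f (hg.iso x) * g x := by
  conv_lhs => rw [← hg.iso_one]
  exact hg.integral_comp_zero f zero_le_one

/-- This turns the chosen inverse on [0,1] in the definitions of Φ and Φ⁻¹ into a genuine order
isomorphism of the line. -/
theorem invFunOn_iso {F : ℝ → ℝ} (hF : EqOn F hg.iso (Icc 0 1)) {u : ℝ} (hu : u ∈ Icc (0 : ℝ) 1) :
    Function.invFunOn F (Icc 0 1) u = hg.iso.symm u := by
  have h1 : ∃ x ∈ Icc (0 : ℝ) 1, F x = u :=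
    ⟨hg.iso.symm u, hg.iso_symm_mem hu, by rw [hF (hg.iso_symm_mem hu), OrderIso.apply_symm_apply]⟩
  have h2 := Function.invFunOn_eq h1
  rw [hF (Function.invFunOn_mem h1)] at h2
  rw [eq_comm, OrderIso.symm_apply_eq, h2]

theorem invFunOn_iso_symm {F : ℝ → ℝ} (hF : EqOn F hg.iso.symm (Icc 0 1)) {u : ℝ}
    (hu : u ∈ Icc (0 : ℝ) 1) : Function.invFunOn F (Icc 0 1) u = hg.iso u := by
  have h1 : ∃ x ∈ Icc (0 : ℝ) 1, F x = u :=
    ⟨hg.iso u, hg.iso_mem hu, by rw [hF (hg.iso_mem hu), OrderIso.symm_apply_apply]⟩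
  have h2 := Function.invFunOn_eq h1
  rw [hF (Function.invFunOn_mem h1), OrderIso.symm_apply_eq] at h2
  exact h2

end IsDensity

/-! ### Profiles -/

theorem intervalIntegral_congr_Icc {f g : ℝ → ℝ} {u : ℝ} (h : EqOn f g (Icc 0 1))
    (hu : u ∈ Icc (0 : ℝ) 1) : ∫ x in (0 : ℝ)..u, f x = ∫ x in (0 : ℝ)..u, g x := by
  refine intervalIntegral.integral_congr fun x hx => h ?_
  rw [uIcc_of_le hu.1] at hx
  exact ⟨hx.1, hx.2.trans hu.2⟩

/-- Only the values on [0,1] of a profile are controlled. Precomposing with the projection onto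
[0,1] gives a function measurable and K-valued on the whole line. -/
theorem exists_extension {K : Set ℝ} {f : ℝ → ℝ} (hf : IsProfile K f) :
    ∃ f' : ℝ → ℝ, Measurable f' ∧ (∀ x, f' x ∈ K) ∧ EqOn f f' (Icc 0 1) :=
  ⟨fun x => f (projIcc 0 1 zero_le_one x), hf.1.comp (continuous_projIcc (h := zero_le_one)).measurable,
    fun x => hf.2 _ (projIcc 0 1 zero_le_one x).2,
    fun x hx => by simp only; rw [projIcc_of_mem zero_le_one hx]⟩

theorem frakA_mem {r : ℝ} (hr : r ∈ Icc (1 / 2 : ℝ) 1) : frakA r ∈ Icc (0 : ℝ) 1 := by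
  have h0 : 0 < r := by linarith [hr.1]
  refine ⟨div_nonneg (by linarith [hr.1]) h0.le, ?_⟩
  rw [frakA, div_le_one h0]
  linarith [hr.2]

theorem one_div_two_sub_mem {w : ℝ} (hw : w ∈ Icc (0 : ℝ) 1) :
    1 / (2 - w) ∈ Icc (1 / 2 : ℝ) 1 := by
  have h0 : 0 < 2 - w := by linarith [hw.2]
  refine ⟨one_div_le_one_div_of_le h0 (by linarith [hw.1]), ?_⟩
  rw [div_le_one h0]
  linarith [hw.2]

theorem two_sub_frakA {r : ℝ} (hr : r ≠ 0) : 2 - frakA r = 1 / r := by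
  rw [frakA]
  field_simp
  ring

theorem frakA_one_div {w : ℝ} (hw : 2 - w ≠ 0) : frakA (1 / (2 - w)) = w := by
  rw [frakA]
  field_simp
  ring

theorem totalMass_congr {r r' : ℝ → ℝ} (h : EqOn r r' (Icc 0 1)) : totalMass r = totalMass r' :=
  intervalIntegral_congr_Icc h (right_mem_Icc.2 zero_le_one)

theorem totalMass_mem {r : ℝ → ℝ} (hr : IsProfile (Icc (1 / 2) 1) r) :
    totalMass r ∈ Icc (1 / 2 : ℝ) 1 := by
  obtain ⟨r', hm, hK, he⟩ := exists_extension hr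
  have hb : BddMeas r' := BddMeas.of_mem_Icc hm hK
  rw [totalMass_congr he]
  constructor
  · have := intervalIntegral.integral_mono_on zero_le_one
      ((BddMeas.const (1 / 2)).intervalIntegrable 0 1) (hb.intervalIntegrable 0 1)
      fun x _ => (hK x).1
    simpa [totalMass] using this
  · have := intervalIntegral.integral_mono_on zero_le_one (hb.intervalIntegrable 0 1)
      ((BddMeas.const 1).intervalIntegrable 0 1)
      fun x _ => (hK x).2
    simpa [totalMass] using this

theorem isDensity_of_density {r : ℝ → ℝ} (hm : Measurable r) (hK : ∀ x, r x ∈ Icc (1 / 2 : ℝ) 1) :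
    IsDensity fun x => 1 / totalMass r * r x := by
  have hM := totalMass_mem (r := r) ⟨hm.comp measurable_subtype_coe, fun x _ => hK x⟩
  have hM0 : 0 < totalMass r := by linarith [hM.1]
  refine ⟨(BddMeas.of_mem_Icc hm hK).const_mul _, ⟨1 / totalMass r * (1 / 2), by positivity,
    fun x => mul_le_mul_of_nonneg_left (hK x).1 (by positivity)⟩, ?_⟩
  rw [intervalIntegral.integral_const_mul]
  change 1 / totalMass r * totalMass r = 1
  field_simp

theorem integral_two_sub_mem {w : ℝ → ℝ} (hm : Measurable w) (hK : ∀ x, w x ∈ Icc (0 : ℝ) 1) :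
    ∫ v in (0 : ℝ)..1, (2 - w v) ∈ Icc (1 : ℝ) 2 := by
  have hb : BddMeas fun v => 2 - w v := (BddMeas.const 2).sub (BddMeas.of_mem_Icc hm hK)
  constructor
  · have := intervalIntegral.integral_mono_on zero_le_one
      ((BddMeas.const 1).intervalIntegrable 0 1) (hb.intervalIntegrable 0 1)
      fun x _ => show (1 : ℝ) ≤ 2 - w x by linarith [(hK x).2]
    simpa using this
  · have := intervalIntegral.integral_mono_on zero_le_one (hb.intervalIntegrable 0 1)
      ((BddMeas.const 2).intervalIntegrable 0 1)
      fun x _ => show 2 - w x ≤ 2 by linarith [(hK x).1]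
    simpa using this

theorem isDensity_two_sub {w : ℝ → ℝ} (hm : Measurable w) (hK : ∀ x, w x ∈ Icc (0 : ℝ) 1) :
    IsDensity fun x => (1 / ∫ v in (0 : ℝ)..1, (2 - w v)) * (2 - w x) := by
  have hM := integral_two_sub_mem hm hK
  have hM0 : 0 < ∫ v in (0 : ℝ)..1, (2 - w v) := by linarith [hM.1]
  have hb : BddMeas fun v => 2 - w v := (BddMeas.const 2).sub (BddMeas.of_mem_Icc hm hK)
  refine ⟨hb.const_mul _, ⟨1 / ∫ v in (0 : ℝ)..1, (2 - w v), by positivity,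
    fun x => le_mul_of_one_le_right (by positivity) (by linarith [(hK x).2])⟩, ?_⟩
  rw [intervalIntegral.integral_const_mul]
  field_simp

theorem uOf_eqOn_iso {w w' : ℝ → ℝ} (hm : Measurable w') (hK : ∀ x, w' x ∈ Icc (0 : ℝ) 1)
    (he : EqOn w w' (Icc 0 1)) : EqOn (uOf w) (isDensity_two_sub hm hK).iso (Icc 0 1) := by
  intro v hv
  have he' : EqOn (fun v => 2 - w v) (fun v => 2 - w' v) (Icc 0 1) := fun x hx => by
    simp only [he hx]
  rw [uOf, IsDensity.iso_apply, intervalIntegral.integral_const_mul,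
    intervalIntegral_congr_Icc he' hv, intervalIntegral_congr_Icc he' (right_mem_Icc.2 zero_le_one)]

theorem PhiInv_eq {w w' : ℝ → ℝ} (hm : Measurable w') (hK : ∀ x, w' x ∈ Icc (0 : ℝ) 1)
    (he : EqOn w w' (Icc 0 1)) {u : ℝ} (hu : u ∈ Icc (0 : ℝ) 1) :
    PhiInv w u = 1 / (2 - w' ((isDensity_two_sub hm hK).iso.symm u)) := by
  rw [PhiInv, (isDensity_two_sub hm hK).invFunOn_iso (uOf_eqOn_iso hm hK he) hu,
    he ((isDensity_two_sub hm hK).iso_symm_mem hu)]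

theorem vMap_eqOn_iso {r r' : ℝ → ℝ} (hm : Measurable r') (hK : ∀ x, r' x ∈ Icc (1 / 2 : ℝ) 1)
    (he : EqOn r r' (Icc 0 1)) : EqOn (vMap r) (isDensity_of_density hm hK).iso (Icc 0 1) := by
  intro v hv
  rw [vMap, IsDensity.iso_apply, intervalIntegral.integral_const_mul, totalMass_congr he,
    intervalIntegral_congr_Icc he hv]

theorem Phi_eq {r r' : ℝ → ℝ} (hm : Measurable r') (hK : ∀ x, r' x ∈ Icc (1 / 2 : ℝ) 1)
    (he : EqOn r r' (Icc 0 1)) {v : ℝ} (hv : v ∈ Icc (0 : ℝ) 1) :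
    Phi r v = frakA (r' ((isDensity_of_density hm hK).iso.symm v)) := by
  rw [Phi, uMap, (isDensity_of_density hm hK).invFunOn_iso (vMap_eqOn_iso hm hK he) hv,
    he ((isDensity_of_density hm hK).iso_symm_mem hv), frakA]

theorem isProfile_Phi {r : ℝ → ℝ} (hr : IsProfile (Icc (1 / 2) 1) r) :
    IsProfile (Icc 0 1) (Phi r) := by
  obtain ⟨r', hm, hK, he⟩ := exists_extension hr
  refine ⟨?_, fun v hv => by rw [Phi_eq hm hK he hv]; exact frakA_mem (hK _)⟩
  have : (fun v : Icc (0 : ℝ) 1 => Phi r v) =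
      fun v : Icc (0 : ℝ) 1 => frakA (r' ((isDensity_of_density hm hK).iso.symm v)) :=
    funext fun v => Phi_eq hm hK he v.2
  rw [this]
  have h2 : Measurable fun v : Icc (0 : ℝ) 1 => r' ((isDensity_of_density hm hK).iso.symm v) :=
    hm.comp ((isDensity_of_density hm hK).iso.symm.continuous.measurable.comp measurable_subtype_coe)
  exact ((h2.const_mul 2).sub_const 1).div h2

theorem isProfile_PhiInv {w : ℝ → ℝ} (hw : IsProfile (Icc 0 1) w) :
    IsProfile (Icc (1 / 2) 1) (PhiInv w) := by
  obtain ⟨w', hm, hK, he⟩ := exists_extension hw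
  refine ⟨?_, fun v hv => by rw [PhiInv_eq hm hK he hv]; exact one_div_two_sub_mem (hK _)⟩
  have : (fun v : Icc (0 : ℝ) 1 => PhiInv w v) =
      fun v : Icc (0 : ℝ) 1 => 1 / (2 - w' ((isDensity_two_sub hm hK).iso.symm v)) :=
    funext fun v => PhiInv_eq hm hK he v.2
  rw [this]
  have h2 : Measurable fun v : Icc (0 : ℝ) 1 => w' ((isDensity_two_sub hm hK).iso.symm v) :=
    hm.comp ((isDensity_two_sub hm hK).iso.symm.continuous.measurable.comp measurable_subtype_coe)
  exact (h2.const_sub 2).const_div 1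

/-- After the substitution v = v_ρ(x), the factor 2 - Φ(ρ) becomes 1/ρ(x) and dv = ρ(x)/m dx, so the
integrand is the constant 1/m. Up to normalization, the primitive of 2 - Φ(ρ) is therefore the
inverse of v_ρ. -/
theorem integral_two_sub_Phi {r r' : ℝ → ℝ} (hm : Measurable r')
    (hK : ∀ x, r' x ∈ Icc (1 / 2 : ℝ) 1) (he : EqOn r r' (Icc 0 1)) {u : ℝ}
    (hu : u ∈ Icc (0 : ℝ) 1) :
    ∫ v in (0 : ℝ)..(isDensity_of_density hm hK).iso u, (2 - Phi r v) = 1 / totalMass r * u := by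
  set hg := isDensity_of_density hm hK
  rw [hg.integral_comp_zero _ hu.1]
  have : EqOn (fun x => (2 - Phi r (hg.iso x)) * (1 / totalMass r' * r' x))
      (fun _ => 1 / totalMass r) (Icc 0 1) := by
    intro x hx
    have hr0 : r' x ≠ 0 := by linarith [(hK x).1]
    simp only
    rw [Phi_eq hm hK he (hg.iso_mem hx), OrderIso.symm_apply_apply, two_sub_frakA hr0,
      totalMass_congr he]
    field_simp
  rw [intervalIntegral_congr_Icc this hu, intervalIntegral.integral_const, smul_eq_mul, sub_zero,
    mul_comm]

theorem integral_Phi {r : ℝ → ℝ} (hr : IsProfile (Icc (1 / 2) 1) r) :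
    ∫ v in (0 : ℝ)..1, (2 - Phi r v) = 1 / totalMass r := by
  obtain ⟨r', hm, hK, he⟩ := exists_extension hr
  have h := integral_two_sub_Phi hm hK he (right_mem_Icc.2 zero_le_one)
  rwa [IsDensity.iso_one, mul_one] at h

theorem PhiInv_Phi {r : ℝ → ℝ} (hr : IsProfile (Icc (1 / 2) 1) r) :
    EqOn (PhiInv (Phi r)) r (Icc 0 1) := by
  have hM := totalMass_mem hr
  have hM0 : totalMass r ≠ 0 := by linarith [hM.1]
  have hI := integral_Phi hr
  obtain ⟨r', hm, hK, he⟩ := exists_extension hr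
  set hg := isDensity_of_density hm hK with hg_def
  intro u hu
  have h1 : EqOn (uOf (Phi r)) hg.iso.symm (Icc 0 1) := by
    intro v hv
    have := integral_two_sub_Phi hm hK he (hg.iso_symm_mem hv)
    rw [← hg_def, OrderIso.apply_symm_apply] at this
    rw [uOf, hI, this]
    field_simp
  rw [PhiInv, hg.invFunOn_iso_symm h1 hu, Phi_eq hm hK he (hg.iso_mem hu), ← hg_def,
    OrderIso.symm_apply_apply, two_sub_frakA (by linarith [(hK u).1]), one_div_one_div, he hu]

theorem Phi_PhiInv {w : ℝ → ℝ} (hw : IsProfile (Icc 0 1) w) :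
    EqOn (Phi (PhiInv w)) w (Icc 0 1) := by
  obtain ⟨w', hm, hK, he⟩ := exists_extension hw
  have hI := integral_two_sub_mem hm hK
  have hI0 : ∫ v in (0 : ℝ)..1, (2 - w' v) ≠ 0 := by linarith [hI.1]
  set hg := isDensity_two_sub hm hK with hg_def
  -- The mirror image of `integral_two_sub_Phi`: along the substitution, Φ⁻¹(ω) cancels the Jacobian
  -- 2 - ω and leaves the constant μ.
  have h0 : ∀ v ∈ Icc (0 : ℝ) 1, ∫ u in (0 : ℝ)..hg.iso v, PhiInv w u =
      (1 / ∫ v in (0 : ℝ)..1, (2 - w' v)) * v := by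
    intro v hv
    rw [hg.integral_comp_zero _ hv.1]
    have : EqOn (fun x => PhiInv w (hg.iso x) * ((1 / ∫ v in (0 : ℝ)..1, (2 - w' v)) * (2 - w' x)))
        (fun _ => 1 / ∫ v in (0 : ℝ)..1, (2 - w' v)) (Icc 0 1) := by
      intro x hx
      have hr0 : 2 - w' x ≠ 0 := by linarith [(hK x).2]
      simp only
      rw [PhiInv_eq hm hK he (hg.iso_mem hx), OrderIso.symm_apply_apply]
      field_simp
    rw [intervalIntegral_congr_Icc this hv, intervalIntegral.integral_const, smul_eq_mul, sub_zero,
      mul_comm]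
  have hT : totalMass (PhiInv w) = 1 / ∫ v in (0 : ℝ)..1, (2 - w' v) := by
    have := h0 1 (right_mem_Icc.2 zero_le_one)
    rwa [hg.iso_one, mul_one] at this
  intro v hv
  have h1 : EqOn (vMap (PhiInv w)) hg.iso.symm (Icc 0 1) := by
    intro u hu
    have := h0 _ (hg.iso_symm_mem hu)
    rw [OrderIso.apply_symm_apply] at this
    rw [vMap, hT, this]
    field_simp
  rw [Phi, uMap, hg.invFunOn_iso_symm h1 hv, PhiInv_eq hm hK he (hg.iso_mem hv), ← hg_def,
    OrderIso.symm_apply_apply, ← frakA, frakA_one_div (by linarith [(hK v).2]), he hv]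

/-! ### Weak solutions: normalization and cosine coefficients -/

theorem integral_integral_congr {T t : ℝ} (ht : t ∈ Icc 0 T) {f g : ℝ → ℝ → ℝ}
    (h : ∀ s ∈ Icc 0 T, ∀ u ∈ Icc (0 : ℝ) 1, f s u = g s u) :
    ∫ s in (0 : ℝ)..t, ∫ u in (0 : ℝ)..1, f s u = ∫ s in (0 : ℝ)..t, ∫ u in (0 : ℝ)..1, g s u := by
  refine intervalIntegral.integral_congr fun s hs => ?_
  rw [uIcc_of_le ht.1] at hs
  exact intervalIntegral_congr_Icc (fun u hu => h s ⟨hs.1, hs.2.trans ht.2⟩ u hu)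
    (right_mem_Icc.2 zero_le_one)

theorem IsWeakSolutionRobin.congr {K : Set ℝ} {σ p T : ℝ} {a h ρini ρini' : ℝ → ℝ}
    {ρ ρ' : ℝ → ℝ → ℝ} (hρ : IsWeakSolutionRobin K σ p a h T ρini ρ)
    (he : ∀ t ∈ Icc 0 T, EqOn (ρ t) (ρ' t) (Icc 0 1)) (hi : EqOn ρini ρini' (Icc 0 1)) :
    IsWeakSolutionRobin K σ p a h T ρini' ρ' := by
  refine ⟨?_, fun t ht u hu => by rw [← he t ht hu]; exact hρ.mem t ht u hu, ?_⟩
  · have : (fun z : Icc (0 : ℝ) T × Icc (0 : ℝ) 1 => ρ' z.1 z.2) = fun z => ρ z.1 z.2 :=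
      funext fun z => (he z.1 z.1.2 z.2.2).symm
    rw [this]
    exact hρ.measurable
  · intro G Gt Gu Guu hG t ht
    have h01 : (1 : ℝ) ∈ Icc (0 : ℝ) 1 := right_mem_Icc.2 zero_le_one
    have h00 : (0 : ℝ) ∈ Icc (0 : ℝ) 1 := left_mem_Icc.2 zero_le_one
    have := hρ.weak G Gt Gu Guu hG t ht
    have e1 : ∫ u in (0 : ℝ)..1, ρ t u * G t u = ∫ u in (0 : ℝ)..1, ρ' t u * G t u :=
      intervalIntegral_congr_Icc (fun u hu => by simp only [he t ht hu]) h01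
    have e2 : ∫ u in (0 : ℝ)..1, ρini u * G 0 u = ∫ u in (0 : ℝ)..1, ρini' u * G 0 u :=
      intervalIntegral_congr_Icc (fun u hu => by simp only [hi hu]) h01
    have e3 := integral_integral_congr ht (f := fun s u => ρ s u * Gt s u)
      (g := fun s u => ρ' s u * Gt s u) fun s hs u hu => by simp only [he s hs hu]
    have e4 := integral_integral_congr ht (f := fun s u => a (ρ s u) * Guu s u)
      (g := fun s u => a (ρ' s u) * Guu s u) fun s hs u hu => by simp only [he s hs hu]
    have e5 := integral_integral_congr ht (f := fun s u => h (ρ s u) * Gu s u)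
      (g := fun s u => h (ρ' s u) * Gu s u) fun s hs u hu => by simp only [he s hs hu]
    have e6 : ∫ s in (0 : ℝ)..t, (a (ρ s 1) * Gu s 1 - a (ρ s 0) * Gu s 0) =
        ∫ s in (0 : ℝ)..t, (a (ρ' s 1) * Gu s 1 - a (ρ' s 0) * Gu s 0) := by
      refine intervalIntegral.integral_congr fun s hs => ?_
      rw [uIcc_of_le ht.1] at hs
      have hs' : s ∈ Icc 0 T := ⟨hs.1, hs.2.trans ht.2⟩
      simp only [he s hs' h01, he s hs' h00]
    rw [← e1, ← e2, ← e3, ← e4, ← e5, ← e6]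
    exact this

theorem IsWeakSolutionRobin.exists_extension {K : Set ℝ} {σ p T : ℝ} {a h ρini : ℝ → ℝ}
    {ρ : ℝ → ℝ → ℝ} (hT : 0 ≤ T) (hρ : IsWeakSolutionRobin K σ p a h T ρini ρ) :
    ∃ ρ' : ℝ → ℝ → ℝ, Measurable (fun z : ℝ × ℝ => ρ' z.1 z.2) ∧ (∀ t u, ρ' t u ∈ K) ∧
      ∀ t ∈ Icc 0 T, EqOn (ρ t) (ρ' t) (Icc 0 1) := by
  refine ⟨fun t u => ρ (projIcc 0 T hT t) (projIcc 0 1 zero_le_one u), ?_,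
    fun t u => hρ.mem _ (projIcc 0 T hT t).2 _ (projIcc 0 1 zero_le_one u).2, fun t ht u hu => ?_⟩
  · exact hρ.measurable.comp (((continuous_projIcc (h := hT)).measurable.comp measurable_fst).prodMk
      ((continuous_projIcc (h := zero_le_one)).measurable.comp measurable_snd))
  · simp only
    rw [projIcc_of_mem hT ht, projIcc_of_mem zero_le_one hu]

theorem isTestFunction_cos (T : ℝ) (n : ℤ) :
    IsTestFunction T (fun _ x => Real.cos (n * Real.pi * x)) (fun _ _ => 0)
      (fun _ x => -(n * Real.pi) * Real.sin (n * Real.pi * x))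
      (fun _ x => -(n * Real.pi) ^ 2 * Real.cos (n * Real.pi * x)) where
  continuousOn := by fun_prop
  continuousOn_t := by fun_prop
  continuousOn_u := by fun_prop
  continuousOn_uu := by fun_prop
  deriv_t _ _ _ _ := hasDerivWithinAt_const _ _ _
  deriv_u t _ u _ := by
    have := (((hasDerivAt_id' u).const_mul (n * Real.pi : ℝ)).cos).hasDerivWithinAt (s := Icc 0 1)
    exact this.congr_deriv (by ring)
  deriv_uu t _ u _ := by
    have := (((hasDerivAt_id' u).const_mul (n * Real.pi : ℝ)).sin.const_mul
      (-(n * Real.pi) : ℝ)).hasDerivWithinAt (s := Icc 0 1)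
    exact this.congr_deriv (by ring)

/-- The time derivative of the `n`-th cosine coefficient of a weak solution. -/
noncomputable def coeffRate (σ p : ℝ) (A H : ℝ → ℝ → ℝ) (n : ℤ) (s : ℝ) : ℝ :=
  -σ * (n * Real.pi) ^ 2 * cosC (A s) n - p * (n * Real.pi) * sinC (H s) n

theorem BddMeas.cosC {f : ℝ → ℝ → ℝ} (hf : BddMeas fun z : ℝ × ℝ => f z.1 z.2) (n : ℤ) :
    BddMeas fun t => cosC (f t) n :=
  BddMeas.integral (f := fun t x => f t x * Real.cos (n * Real.pi * x))
    (hf.mul (BddMeas.cos (n * Real.pi)).snd) 0 1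

theorem BddMeas.sinC {f : ℝ → ℝ → ℝ} (hf : BddMeas fun z : ℝ × ℝ => f z.1 z.2) (n : ℤ) :
    BddMeas fun t => sinC (f t) n :=
  BddMeas.integral (f := fun t x => f t x * Real.sin (n * Real.pi * x))
    (hf.mul (BddMeas.sin (n * Real.pi)).snd) 0 1

theorem bddMeas_coeffRate (σ p : ℝ) {A H : ℝ → ℝ → ℝ} (hA : BddMeas fun z : ℝ × ℝ => A z.1 z.2)
    (hH : BddMeas fun z : ℝ × ℝ => H z.1 z.2) (n : ℤ) : BddMeas (coeffRate σ p A H n) :=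
  ((hA.cosC n).const_mul _).sub ((hH.sinC n).const_mul _)

/-- The test function cos(nπx) does not depend on time and its derivative vanishes at 0 and 1, so
the boundary terms drop out. -/
theorem IsWeakSolutionRobin.cosC_sub {K : Set ℝ} {σ p T : ℝ} {a h ρini : ℝ → ℝ} {ρ : ℝ → ℝ → ℝ}
    (hρ : IsWeakSolutionRobin K σ p a h T ρini ρ)
    (hA : BddMeas fun z : ℝ × ℝ => a (ρ z.1 z.2)) (hH : BddMeas fun z : ℝ × ℝ => h (ρ z.1 z.2))
    (n : ℤ) {t : ℝ} (ht : t ∈ Icc 0 T) :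
    cosC (ρ t) n - cosC ρini n =
      ∫ s in (0 : ℝ)..t, coeffRate σ p (fun s u => a (ρ s u)) (fun s u => h (ρ s u)) n s := by
  have h1 := hρ.weak _ _ _ _ (isTestFunction_cos T n) t ht
  have hc := hA.cosC (f := fun s u => a (ρ s u)) n
  have hs := hH.sinC (f := fun s u => h (ρ s u)) n
  have hs1 : Real.sin (n * Real.pi * 1) = 0 := by rw [mul_one, Real.sin_int_mul_pi]
  simp only [mul_zero, Real.sin_zero, hs1, intervalIntegral.integral_zero, sub_zero] at h1
  simp only [coeffRate]
  rw [intervalIntegral.integral_sub ((hc.const_mul _).intervalIntegrable _ _)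
    ((hs.const_mul _).intervalIntegrable _ _), intervalIntegral.integral_const_mul,
    intervalIntegral.integral_const_mul]
  change cosC (ρ t) n - cosC ρini n = _ at h1
  rw [h1]
  have e1 : ∀ s, ∫ u in (0 : ℝ)..1, a (ρ s u) * (-(n * Real.pi) ^ 2 * Real.cos (n * Real.pi * u)) =
      -(n * Real.pi) ^ 2 * cosC (fun u => a (ρ s u)) n := fun s => by
    rw [cosC, ← intervalIntegral.integral_const_mul]
    congr 1
    funext u
    ring
  have e2 : ∀ s, ∫ u in (0 : ℝ)..1, h (ρ s u) * (-(n * Real.pi) * Real.sin (n * Real.pi * u)) =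
      -(n * Real.pi) * sinC (fun u => h (ρ s u)) n := fun s => by
    rw [sinC, ← intervalIntegral.integral_const_mul]
    congr 1
    funext u
    ring
  simp only [e1, e2, intervalIntegral.integral_const_mul]
  ring

/-! ### Uniqueness of weak solutions -/

/-- The rate is merely bounded and measurable, so the square is differentiated as a product of
absolutely continuous functions. -/
theorem sq_primitive {γ : ℝ → ℝ} (hγ : BddMeas γ) (t : ℝ) :
    (∫ s in (0 : ℝ)..t, γ s) ^ 2 = ∫ s in (0 : ℝ)..t, 2 * (∫ r in (0 : ℝ)..s, γ r) * γ s := by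
  have hI := hγ.intervalIntegrable 0 t
  have hAC := hI.absolutelyContinuousOnInterval_intervalIntegral (c := 0) (by simp)
  have h := hAC.integral_deriv_mul_eq_sub hAC
  simp only [intervalIntegral.integral_same, mul_zero, sub_zero] at h
  rw [sq, ← h]
  refine intervalIntegral.integral_congr_ae ?_
  filter_upwards [hI.ae_hasDerivAt_integral] with x hx hx'
  rw [(hx (uIoc_subset_uIcc hx') 0 (by simp)).deriv]
  ring

/-- Grönwall's inequality in integral form: e^{-kx}(ε + k ∫₀ˣ Y) is nonincreasing. -/
theorem le_exp_of_le_integral {Y : ℝ → ℝ} (hY : Continuous Y) {k ε T : ℝ} (hk : 0 ≤ k)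
    (h : ∀ t ∈ Icc 0 T, Y t ≤ ε + k * ∫ s in (0 : ℝ)..t, Y s) :
    ∀ t ∈ Icc 0 T, Y t ≤ ε * Real.exp (k * t) := by
  intro t ht
  have hd : ∀ x, HasDerivAt (fun x => Real.exp (-k * x) * (ε + k * ∫ s in (0 : ℝ)..x, Y s))
      (Real.exp (-k * x) * -k * (ε + k * ∫ s in (0 : ℝ)..x, Y s) +
        Real.exp (-k * x) * (k * Y x)) x := by
    intro x
    have h1 : HasDerivAt (fun x => Real.exp (-k * x)) (Real.exp (-k * x) * -k) x := by
      simpa using ((hasDerivAt_id x).const_mul (-k)).exp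
    exact h1.mul (((hY.integral_hasStrictDerivAt 0 x).hasDerivAt.const_mul k).const_add ε)
  have hanti : AntitoneOn (fun x => Real.exp (-k * x) * (ε + k * ∫ s in (0 : ℝ)..x, Y s))
      (Icc 0 T) := by
    refine antitoneOn_of_deriv_nonpos (convex_Icc 0 T)
      (fun x _ => (hd x).continuousAt.continuousWithinAt)
      (fun x _ => (hd x).differentiableAt.differentiableWithinAt) fun x hx => ?_
    rw [(hd x).deriv]
    rw [interior_Icc] at hx
    have h1 := h x ⟨hx.1.le, hx.2.le⟩
    have h2 := mul_nonneg (mul_nonneg (Real.exp_pos (-k * x)).le hk) (sub_nonneg.2 h1)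
    linarith
  have h1 := hanti (left_mem_Icc.2 (ht.1.trans ht.2)) ht ht.1
  simp only [mul_zero, Real.exp_zero, intervalIntegral.integral_same, add_zero, one_mul] at h1
  have h2 : Real.exp (-k * t) * Real.exp (k * t) = 1 := by
    rw [← Real.exp_add]
    simp
  calc Y t ≤ ε + k * ∫ s in (0 : ℝ)..t, Y s := h t ht
    _ = Real.exp (-k * t) * (ε + k * ∫ s in (0 : ℝ)..t, Y s) * Real.exp (k * t) := by
      linear_combination -(ε + k * ∫ s in (0 : ℝ)..t, Y s) * h2
    _ ≤ ε * Real.exp (k * t) := mul_le_mul_of_nonneg_right h1 (Real.exp_pos _).le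

/-- Polarization of Parseval's identity. -/
theorem hasSum_cosC_mul {f g : ℝ → ℝ} (hf : BddMeas f) (hg : BddMeas g) :
    HasSum (fun n => cosC f n * cosC g n) (∫ x in (0 : ℝ)..1, f x * g x) := by
  have h1 := hasSum_cosC_sq hf
  have h2 := hasSum_cosC_sq hg
  have h3 := hasSum_cosC_sq (hf.sub hg)
  have h := ((h1.add h2).sub h3).mul_left (1 / 2)
  have e1 : (fun n => cosC f n * cosC g n) = fun n =>
      1 / 2 * (cosC f n ^ 2 + cosC g n ^ 2 - cosC (fun x => f x - g x) n ^ 2) := by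
    funext n
    rw [FacilitatedExclusion.cosC_sub hf hg]
    ring
  have e2 : ∫ x in (0 : ℝ)..1, f x * g x = 1 / 2 * ((∫ x in (0 : ℝ)..1, f x ^ 2) +
      (∫ x in (0 : ℝ)..1, g x ^ 2) - ∫ x in (0 : ℝ)..1, (f x - g x) ^ 2) := by
    rw [← intervalIntegral.integral_add ((hf.pow 2).intervalIntegrable _ _)
      ((hg.pow 2).intervalIntegrable _ _), ← intervalIntegral.integral_sub
      (((hf.pow 2).add (hg.pow 2)).intervalIntegrable _ _)
      (((hf.sub hg).pow 2).intervalIntegrable _ _), ← intervalIntegral.integral_const_mul]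
    congr 1
    funext x
    ring
  rw [e1, e2]
  exact h

theorem integral_sq_le {f : ℝ → ℝ} (hf : BddMeas f) {C : ℝ} (hC : ∀ x, |f x| ≤ C) :
    ∫ x in (0 : ℝ)..1, f x ^ 2 ≤ C ^ 2 := by
  have := intervalIntegral.integral_mono_on zero_le_one ((hf.pow 2).intervalIntegrable 0 1)
    ((BddMeas.const (C ^ 2)).intervalIntegrable 0 1) fun x _ => sq_le_sq' (neg_le_of_abs_le (hC x))
      (le_of_abs_le (hC x))
  simpa using this

theorem BddMeas.max_zero {α : Type*} [MeasurableSpace α] {f : α → ℝ} (hf : BddMeas f) :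
    BddMeas fun x => max (f x) 0 := by
  obtain ⟨C, hC⟩ := hf.bdd
  refine ⟨hf.meas.max measurable_const, C, fun x => ?_⟩
  rw [abs_of_nonneg (le_max_right _ _)]
  exact max_le ((le_abs_self _).trans (hC x)) ((abs_nonneg _).trans (hC x))

/-- An upper bound for the rate of change of the energy of the `n`-th mode. -/
noncomputable def energyRate (σ Λ : ℝ) (w A H : ℝ → ℝ → ℝ) (n : ℤ) (s : ℝ) : ℝ :=
  -2 * σ * (cosC (w s) n * cosC (A s) n) + 1 / Λ * sinC (H s) n ^ 2

/-- With q = nπ, the left side is the time derivative of (C/q)² for the mode n. Young's inequality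
with parameter Λ splits the cross term 2p(C/q)e coming from the flux. -/
theorem mode_energy_le {q C d e σ p Λ : ℝ} (hΛ : 0 < Λ) (hq : q = 0 → C = 0) :
    q⁻¹ ^ 2 * (2 * C * (-σ * q ^ 2 * d - p * q * e)) ≤
      (-2 * σ * (C * d) + 1 / Λ * e ^ 2) + Λ * p ^ 2 * (q⁻¹ * C) ^ 2 := by
  rcases eq_or_ne q 0 with h | h
  · rw [hq h]
    simp only [mul_zero, zero_mul, zero_add]
    positivity
  · have h1 : q⁻¹ ^ 2 * (2 * C * (-σ * q ^ 2 * d - p * q * e)) =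
        -2 * σ * (C * d) - 2 * p * (q⁻¹ * C) * e := by
      field_simp
    have h2 : 0 ≤ 1 / Λ * (Λ * p * (q⁻¹ * C) + e) ^ 2 := by positivity
    have h3 : 1 / Λ * (Λ * p * (q⁻¹ * C) + e) ^ 2 =
        Λ * p ^ 2 * (q⁻¹ * C) ^ 2 + 2 * p * (q⁻¹ * C) * e + 1 / Λ * e ^ 2 := by
      field_simp
      ring
    linarith

section Energy

variable {σ p κ L T : ℝ} {w A H : ℝ → ℝ → ℝ}

theorem bddMeas_energyRate (σ Λ : ℝ) (hw : BddMeas fun z : ℝ × ℝ => w z.1 z.2)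
    (hA : BddMeas fun z : ℝ × ℝ => A z.1 z.2) (hH : BddMeas fun z : ℝ × ℝ => H z.1 z.2) (n : ℤ) :
    BddMeas (energyRate σ Λ w A H n) :=
  (((hw.cosC n).mul (hA.cosC n)).const_mul _).add (((hH.sinC n).pow 2).const_mul _)

theorem hasSum_energyRate (σ Λ : ℝ) (hw : BddMeas fun z : ℝ × ℝ => w z.1 z.2)
    (hA : BddMeas fun z : ℝ × ℝ => A z.1 z.2) (hH : BddMeas fun z : ℝ × ℝ => H z.1 z.2) (s : ℝ) :
    HasSum (fun n => energyRate σ Λ w A H n s)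
      (-2 * σ * (∫ x in (0 : ℝ)..1, w s x * A s x) + 1 / Λ * ∫ x in (0 : ℝ)..1, H s x ^ 2) :=
  ((hasSum_cosC_mul (hw.prodMk_left s) (hA.prodMk_left s)).mul_left _).add
    ((hasSum_sinC_sq (hH.prodMk_left s)).mul_left _)

/-- Monotonicity makes the diffusion contribute at most -2σκ ∫w², while the flux contributes at most
L²/Λ ∫w². A large Λ lets the first absorb the second. -/
theorem hasSum_energyRate_nonpos (hσ : 0 < σ)
    (hw : BddMeas fun z : ℝ × ℝ => w z.1 z.2)
    (hA : BddMeas fun z : ℝ × ℝ => A z.1 z.2) (hH : BddMeas fun z : ℝ × ℝ => H z.1 z.2)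
    (hmono : ∀ t x, κ * w t x ^ 2 ≤ w t x * A t x)
    (hL : ∀ t x, H t x ^ 2 ≤ L ^ 2 * w t x ^ 2) {Λ : ℝ} (hΛ : 0 < Λ) (hΛ' : L ^ 2 ≤ 2 * σ * κ * Λ)
    (s : ℝ) :
    -2 * σ * (∫ x in (0 : ℝ)..1, w s x * A s x) + 1 / Λ * ∫ x in (0 : ℝ)..1, H s x ^ 2 ≤ 0 := by
  have hws : BddMeas (w s) := hw.prodMk_left s
  have hAs : BddMeas (A s) := hA.prodMk_left s
  have hHs : BddMeas (H s) := hH.prodMk_left s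
  have h1 := intervalIntegral.integral_mono_on zero_le_one
    (((hws.pow 2).const_mul κ).intervalIntegrable 0 1)
    ((hws.mul hAs).intervalIntegrable 0 1) fun x _ => hmono s x
  have h2 := intervalIntegral.integral_mono_on zero_le_one ((hHs.pow 2).intervalIntegrable 0 1)
    (((hws.pow 2).const_mul (L ^ 2)).intervalIntegrable 0 1) fun x _ => hL s x
  rw [intervalIntegral.integral_const_mul] at h1 h2
  have h0 : 0 ≤ ∫ x in (0 : ℝ)..1, w s x ^ 2 :=
    intervalIntegral.integral_nonneg zero_le_one fun _ _ => sq_nonneg _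
  have h3 : 1 / Λ * ∫ x in (0 : ℝ)..1, H s x ^ 2 ≤ 2 * σ * κ * ∫ x in (0 : ℝ)..1, w s x ^ 2 := by
    rw [one_div, inv_mul_le_iff₀ hΛ]
    calc ∫ x in (0 : ℝ)..1, H s x ^ 2 ≤ L ^ 2 * ∫ x in (0 : ℝ)..1, w s x ^ 2 := h2
      _ ≤ 2 * σ * κ * Λ * ∫ x in (0 : ℝ)..1, w s x ^ 2 := mul_le_mul_of_nonneg_right hΛ' h0
      _ = _ := by ring
  have h4 := mul_le_mul_of_nonneg_left h1 (show 0 ≤ 2 * σ by positivity)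
  linarith

/-- Only the full sum over modes is known to be nonpositive, by Parseval. For finite sets of modes
the positive part is an error, which tends to zero by dominated convergence. -/
theorem tendsto_integral_energyRate (hσ : 0 < σ)
    (hw : BddMeas fun z : ℝ × ℝ => w z.1 z.2)
    (hA : BddMeas fun z : ℝ × ℝ => A z.1 z.2) (hH : BddMeas fun z : ℝ × ℝ => H z.1 z.2)
    (hmono : ∀ t x, κ * w t x ^ 2 ≤ w t x * A t x)
    (hL : ∀ t x, H t x ^ 2 ≤ L ^ 2 * w t x ^ 2) {Λ : ℝ} (hΛ : 0 < Λ) (hΛ' : L ^ 2 ≤ 2 * σ * κ * Λ) :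
    Tendsto (fun F : Finset ℤ => ∫ s in (0 : ℝ)..T, max (∑ n ∈ F, energyRate σ Λ w A H n s) 0)
      atTop (𝓝 0) := by
  obtain ⟨C₁, hC₁⟩ := hw.bdd
  obtain ⟨C₂, hC₂⟩ := hA.bdd
  obtain ⟨C₃, hC₃⟩ := hH.bdd
  have hlim := intervalIntegral.tendsto_integral_filter_of_dominated_convergence
    (l := (atTop : Filter (Finset ℤ))) (μ := volume) (a := 0) (b := T)
    (F := fun F s => max (∑ n ∈ F, energyRate σ Λ w A H n s) 0) (f := fun _ => (0 : ℝ))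
    (fun _ => σ * (C₁ ^ 2 + C₂ ^ 2) + 1 / Λ * C₃ ^ 2) ?_ ?_ (BddMeas.const _ |>.intervalIntegrable _ _)
    ?_
  · simpa using hlim
  · refine Eventually.of_forall fun F => ?_
    exact (BddMeas.max_zero
      (BddMeas.sum F fun n _ => bddMeas_energyRate σ Λ hw hA hH n)).meas.aestronglyMeasurable
  · refine Eventually.of_forall fun F => Eventually.of_forall fun s _ => ?_
    rw [Real.norm_eq_abs, abs_of_nonneg (le_max_right _ _)]
    have hws : BddMeas (w s) := hw.prodMk_left s
    have hAs : BddMeas (A s) := hA.prodMk_left s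
    have hHs : BddMeas (H s) := hH.prodMk_left s
    have hsum : HasSum (fun n => σ * (cosC (w s) n ^ 2 + cosC (A s) n ^ 2) +
        1 / Λ * sinC (H s) n ^ 2) (σ * ((∫ x in (0 : ℝ)..1, w s x ^ 2) + ∫ x in (0 : ℝ)..1, A s x ^ 2) +
        1 / Λ * ∫ x in (0 : ℝ)..1, H s x ^ 2) :=
      (((hasSum_cosC_sq hws).add (hasSum_cosC_sq hAs)).mul_left _).add
        ((hasSum_sinC_sq hHs).mul_left _)
    -- From -2cd ≤ c² + d². The resulting terms are nonnegative, so Parseval bounds their sum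
    -- uniformly in F.
    have hle : ∑ n ∈ F, energyRate σ Λ w A H n s ≤
        ∑ n ∈ F, (σ * (cosC (w s) n ^ 2 + cosC (A s) n ^ 2) + 1 / Λ * sinC (H s) n ^ 2) := by
      refine Finset.sum_le_sum fun n _ => ?_
      have := mul_nonneg hσ.le (sq_nonneg (cosC (w s) n + cosC (A s) n))
      simp only [energyRate]
      nlinarith
    have hle2 := sum_le_hasSum F (fun n _ => by positivity) hsum
    have hb : σ * ((∫ x in (0 : ℝ)..1, w s x ^ 2) + ∫ x in (0 : ℝ)..1, A s x ^ 2) +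
        1 / Λ * (∫ x in (0 : ℝ)..1, H s x ^ 2) ≤ σ * (C₁ ^ 2 + C₂ ^ 2) + 1 / Λ * C₃ ^ 2 := by
      have h1 := integral_sq_le hws fun x => hC₁ (s, x)
      have h2 := integral_sq_le hAs fun x => hC₂ (s, x)
      have h3 := integral_sq_le hHs fun x => hC₃ (s, x)
      gcongr
    exact max_le (hle.trans (hle2.trans hb)) (by positivity)
  · refine Eventually.of_forall fun s _ => ?_
    have h1 := hasSum_energyRate σ Λ hw hA hH s
    have h2 := hasSum_energyRate_nonpos hσ hw hA hH hmono hL hΛ hΛ' s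
    have h3 := (h1 : Tendsto _ _ _).max (tendsto_const_nhds (x := (0 : ℝ)))
    rwa [max_eq_right h2] at h3

/-- The energy estimate in the dual of `H¹`: the difference of two weak solutions vanishes. -/
theorem integral_sq_eq_zero_of_energy (hσ : 0 < σ) (hκ : 0 < κ)
    (hw : BddMeas fun z : ℝ × ℝ => w z.1 z.2)
    (hA : BddMeas fun z : ℝ × ℝ => A z.1 z.2) (hH : BddMeas fun z : ℝ × ℝ => H z.1 z.2)
    (hmono : ∀ t x, κ * w t x ^ 2 ≤ w t x * A t x)
    (hL : ∀ t x, H t x ^ 2 ≤ L ^ 2 * w t x ^ 2)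
    (hev : ∀ n : ℤ, ∀ t ∈ Icc 0 T, cosC (w t) n = ∫ s in (0 : ℝ)..t, coeffRate σ p A H n s) :
    ∀ t ∈ Icc 0 T, ∫ x in (0 : ℝ)..1, w t x ^ 2 = 0 := by
  -- The summand 1 keeps Λ positive even when L = 0.
  set Λ : ℝ := (L ^ 2 + 1) / (2 * σ * κ) with hΛ_def
  have hΛ : 0 < Λ := by positivity
  have hΛ' : L ^ 2 ≤ 2 * σ * κ * Λ := by
    rw [hΛ_def]
    field_simp
    linarith
  have hγ := fun n => bddMeas_coeffRate σ p hA hH n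
  set C : ℤ → ℝ → ℝ := fun n t => ∫ s in (0 : ℝ)..t, coeffRate σ p A H n s with hC_def
  have hCc : ∀ n, Continuous (C n) := fun n =>
    intervalIntegral.continuous_primitive (hγ n).intervalIntegrable 0
  have hC0 : ∀ t, C 0 t = 0 := fun t => by simp [hC_def, coeffRate]
  -- The squared dual norm restricted to the modes in F. The term n = 0 vanishes because 0⁻¹ = 0;
  -- that mode is zero anyway by conservation of mass.
  set Y : Finset ℤ → ℝ → ℝ := fun F t => ∑ n ∈ F, ((n * Real.pi : ℝ)⁻¹ * C n t) ^ 2 with hY_def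
  have hYc : ∀ F, Continuous (Y F) := fun F =>
    continuous_finsetSum _ fun n _ => ((hCc n).const_mul _).pow 2
  have hYle : ∀ F, ∀ t ∈ Icc 0 T, Y F t ≤
      (∫ s in (0 : ℝ)..T, max (∑ n ∈ F, energyRate σ Λ w A H n s) 0) +
        Λ * p ^ 2 * ∫ s in (0 : ℝ)..t, Y F s := by
    intro F t ht
    have hE := BddMeas.sum F fun n _ => bddMeas_energyRate σ Λ hw hA hH n
    have hint : ∀ n ∈ F, IntervalIntegrable (fun s => (n * Real.pi : ℝ)⁻¹ ^ 2 *
        (2 * C n s * coeffRate σ p A H n s)) volume 0 t := fun n _ =>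
      (((hγ n).intervalIntegrable 0 t).continuousOn_mul
        ((hCc n).const_mul 2).continuousOn).const_mul _
    have h1 : Y F t = ∫ s in (0 : ℝ)..t, ∑ n ∈ F, (n * Real.pi : ℝ)⁻¹ ^ 2 *
        (2 * C n s * coeffRate σ p A H n s) := by
      rw [intervalIntegral.integral_finsetSum hint]
      refine Finset.sum_congr rfl fun n _ => ?_
      rw [intervalIntegral.integral_const_mul, ← sq_primitive (hγ n), mul_pow]
    have hYi : IntervalIntegrable (fun s => Λ * p ^ 2 * Y F s) volume 0 t :=
      ((hYc F).const_mul _).intervalIntegrable _ _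
    have h2 : ∫ s in (0 : ℝ)..t, ∑ n ∈ F, (n * Real.pi : ℝ)⁻¹ ^ 2 *
        (2 * C n s * coeffRate σ p A H n s) ≤
        ∫ s in (0 : ℝ)..t, (max (∑ n ∈ F, energyRate σ Λ w A H n s) 0 + Λ * p ^ 2 * Y F s) := by
      refine intervalIntegral.integral_mono_on ht.1 ?_
        ((hE.max_zero.intervalIntegrable _ _).add hYi) fun s hs => ?_
      · have := IntervalIntegrable.sum (μ := volume) F hint
        simpa only [Finset.sum_fn] using this
      · refine le_trans ?_ (add_le_add_left (le_max_left _ _) _)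
        rw [hY_def, Finset.mul_sum, ← Finset.sum_add_distrib]
        refine Finset.sum_le_sum fun n _ => ?_
        rw [energyRate, hev n s ⟨hs.1, hs.2.trans ht.2⟩]
        refine mode_energy_le hΛ fun hn => ?_
        have hn' : n = 0 := by
          rcases mul_eq_zero.1 hn with h | h
          · exact_mod_cast h
          · exact absurd h Real.pi_ne_zero
        rw [hn']
        exact hC0 s
    rw [intervalIntegral.integral_add (hE.max_zero.intervalIntegrable _ _) hYi,
      intervalIntegral.integral_const_mul] at h2
    have h3 : ∫ s in (0 : ℝ)..t, max (∑ n ∈ F, energyRate σ Λ w A H n s) 0 ≤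
        ∫ s in (0 : ℝ)..T, max (∑ n ∈ F, energyRate σ Λ w A H n s) 0 :=
      intervalIntegral.integral_mono_interval le_rfl ht.1 ht.2
        (Eventually.of_forall fun s => le_max_right _ _) (hE.max_zero.intervalIntegrable _ _)
    linarith
  intro t ht
  have hzero : ∀ n, cosC (w t) n = 0 := by
    intro n
    rw [hev n t ht]
    rcases eq_or_ne n 0 with rfl | hn
    · exact hC0 t
    have hlim := (tendsto_integral_energyRate (T := T) hσ hw hA hH hmono hL hΛ hΛ').mul_const
      (Real.exp (Λ * p ^ 2 * t))
    rw [zero_mul] at hlim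
    -- Grönwall bounds a single mode by the error of any F containing it, and that error tends to
    -- zero as F exhausts ℤ.
    have hle : ((n * Real.pi : ℝ)⁻¹ * C n t) ^ 2 ≤ 0 := by
      refine ge_of_tendsto hlim ?_
      filter_upwards [eventually_ge_atTop ({n} : Finset ℤ)] with F hF
      have hnF : n ∈ F := hF (Finset.mem_singleton_self n)
      refine le_trans ?_ (le_exp_of_le_integral (hYc F) (by positivity) (hYle F) t ht)
      exact Finset.single_le_sum (f := fun n : ℤ => ((n * Real.pi : ℝ)⁻¹ * C n t) ^ 2)
        (fun _ _ => sq_nonneg _) hnF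
    have h0 := pow_eq_zero_iff (two_ne_zero) |>.1 (le_antisymm hle (sq_nonneg _))
    rcases mul_eq_zero.1 h0 with h | h
    · have : (n * Real.pi : ℝ) ≠ 0 := mul_ne_zero (by exact_mod_cast hn) Real.pi_ne_zero
      exact absurd h (inv_ne_zero this)
    · exact h
  have h := hasSum_cosC_sq (hw.prodMk_left t)
  simp only [hzero] at h
  exact h.unique (by simp)

end Energy

theorem BddMeas.of_mem {α : Type*} [MeasurableSpace α] {f : α → ℝ} {b : ℝ → ℝ} {K : Set ℝ} {B : ℝ}
    (hb : Measurable b) (hB : ∀ x ∈ K, |b x| ≤ B) (hf : Measurable f) (hK : ∀ x, f x ∈ K) :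
    BddMeas fun x => b (f x) := ⟨hb.comp hf, B, fun x => hB _ (hK x)⟩

/-- Two weak solutions with the same initial profile agree, provided that the diffusion function
is strongly monotone and the flux function is Lipschitz. -/
theorem IsWeakSolutionRobin.ae_eq {K : Set ℝ} {σ p T κ L B : ℝ} {a h ρini : ℝ → ℝ}
    {ρ₁ ρ₂ : ℝ → ℝ → ℝ} (hT : 0 ≤ T) (hσ : 0 < σ) (hκ : 0 < κ) (ha : Measurable a)
    (hh : Measurable h) (hKB : ∀ x ∈ K, |x| ≤ B) (haB : ∀ x ∈ K, |a x| ≤ B)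
    (hhB : ∀ x ∈ K, |h x| ≤ B) (hmono : ∀ x ∈ K, ∀ y ∈ K, κ * (x - y) ^ 2 ≤ (x - y) * (a x - a y))
    (hL : ∀ x ∈ K, ∀ y ∈ K, |h x - h y| ≤ L * |x - y|)
    (h₁ : IsWeakSolutionRobin K σ p a h T ρini ρ₁)
    (h₂ : IsWeakSolutionRobin K σ p a h T ρini ρ₂) :
    ∀ t ∈ Icc 0 T, ∀ᵐ u ∂(volume.restrict (Icc (0 : ℝ) 1)), ρ₁ t u = ρ₂ t u := by
  obtain ⟨r₁, hm₁, hK₁, he₁⟩ := h₁.exists_extension hT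
  obtain ⟨r₂, hm₂, hK₂, he₂⟩ := h₂.exists_extension hT
  have h₁' := h₁.congr he₁ (fun _ _ => rfl : EqOn ρini ρini (Icc 0 1))
  have h₂' := h₂.congr he₂ (fun _ _ => rfl : EqOn ρini ρini (Icc 0 1))
  have hb₁ : BddMeas fun z : ℝ × ℝ => r₁ z.1 z.2 :=
    BddMeas.of_mem (b := id) measurable_id hKB hm₁ fun z => hK₁ z.1 z.2
  have hb₂ : BddMeas fun z : ℝ × ℝ => r₂ z.1 z.2 :=
    BddMeas.of_mem (b := id) measurable_id hKB hm₂ fun z => hK₂ z.1 z.2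
  have hA₁ : BddMeas fun z : ℝ × ℝ => a (r₁ z.1 z.2) :=
    BddMeas.of_mem ha haB hm₁ fun z => hK₁ z.1 z.2
  have hA₂ : BddMeas fun z : ℝ × ℝ => a (r₂ z.1 z.2) :=
    BddMeas.of_mem ha haB hm₂ fun z => hK₂ z.1 z.2
  have hH₁ : BddMeas fun z : ℝ × ℝ => h (r₁ z.1 z.2) :=
    BddMeas.of_mem hh hhB hm₁ fun z => hK₁ z.1 z.2
  have hH₂ : BddMeas fun z : ℝ × ℝ => h (r₂ z.1 z.2) :=
    BddMeas.of_mem hh hhB hm₂ fun z => hK₂ z.1 z.2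
  have hw := hb₁.sub hb₂
  have hA := hA₁.sub hA₂
  have hH := hH₁.sub hH₂
  have key := integral_sq_eq_zero_of_energy (w := fun t u => r₁ t u - r₂ t u)
    (A := fun t u => a (r₁ t u) - a (r₂ t u)) (H := fun t u => h (r₁ t u) - h (r₂ t u))
    (p := p) (L := L) (T := T) hσ hκ hw hA hH (fun t u => hmono _ (hK₁ t u) _ (hK₂ t u))
    (fun t u => by
      have := hL _ (hK₁ t u) _ (hK₂ t u)
      rw [← sq_abs (h _ - _), ← sq_abs (r₁ t u - _), ← mul_pow]
      exact pow_le_pow_left₀ (abs_nonneg _) this 2)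
    (fun n t ht => by
      have e₁ := h₁'.cosC_sub hA₁ hH₁ n ht
      have e₂ := h₂'.cosC_sub hA₂ hH₂ n ht
      rw [FacilitatedExclusion.cosC_sub (hb₁.prodMk_left t) (hb₂.prodMk_left t)]
      have e₃ : cosC (r₁ t) n - cosC (r₂ t) n =
          (cosC (r₁ t) n - cosC ρini n) - (cosC (r₂ t) n - cosC ρini n) := by ring
      change cosC (r₁ t) n - cosC (r₂ t) n = _
      rw [e₃, e₁, e₂, ← intervalIntegral.integral_sub
        ((bddMeas_coeffRate σ p hA₁ hH₁ n).intervalIntegrable _ _)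
        ((bddMeas_coeffRate σ p hA₂ hH₂ n).intervalIntegrable _ _)]
      congr 1
      funext s
      simp only [coeffRate]
      rw [FacilitatedExclusion.cosC_sub (hA₁.prodMk_left s) (hA₂.prodMk_left s),
        sinC_sub (hH₁.prodMk_left s) (hH₂.prodMk_left s)]
      ring)
  intro t ht
  have h0 := key t ht
  have hwt : BddMeas fun u => (r₁ t u - r₂ t u) ^ 2 := (hw.prodMk_left t).pow 2
  rw [intervalIntegral.integral_of_le zero_le_one, ← integral_Icc_eq_integral_Ioc,
    integral_eq_zero_iff_of_nonneg (fun _ => sq_nonneg _) hwt.integrable] at h0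
  filter_upwards [h0, ae_restrict_mem measurableSet_Icc] with u hu hu'
  rw [he₁ t ht hu', he₂ t ht hu']
  exact sub_eq_zero.1 (pow_eq_zero_iff two_ne_zero |>.1 hu)

/-! ### Test functions extended to the plane -/

/-- A test function whose partial derivatives are bounded and continuous on the whole plane. -/
structure IsGlobalTest (T : ℝ) (G Gt Gu Guu : ℝ → ℝ → ℝ) : Prop where
  test : IsTestFunction T G Gt Gu Guu
  cont : Continuous fun z : ℝ × ℝ => G z.1 z.2
  cont_t : Continuous fun z : ℝ × ℝ => Gt z.1 z.2
  cont_u : Continuous fun z : ℝ × ℝ => Gu z.1 z.2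
  cont_uu : Continuous fun z : ℝ × ℝ => Guu z.1 z.2
  bdd : BddMeas fun z : ℝ × ℝ => G z.1 z.2
  bdd_t : BddMeas fun z : ℝ × ℝ => Gt z.1 z.2
  bdd_u : BddMeas fun z : ℝ × ℝ => Gu z.1 z.2
  bdd_uu : BddMeas fun z : ℝ × ℝ => Guu z.1 z.2

/-- The extension of a function on the rectangle `[0,T] × [0,1]` which is constant outside along
the coordinate directions. -/
noncomputable def rectExtend {T : ℝ} (hT : 0 ≤ T) (G : ℝ → ℝ → ℝ) (t u : ℝ) : ℝ :=
  G (projIcc 0 T hT t) (projIcc 0 1 zero_le_one u)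

section rectExtend

variable {T : ℝ} (hT : 0 ≤ T) {G : ℝ → ℝ → ℝ}

theorem rectExtend_eq {t u : ℝ} (ht : t ∈ Icc 0 T) (hu : u ∈ Icc (0 : ℝ) 1) :
    rectExtend hT G t u = G t u := by
  rw [rectExtend, projIcc_of_mem hT ht, projIcc_of_mem zero_le_one hu]

theorem continuous_rectExtend
    (hG : ContinuousOn (fun z : ℝ × ℝ => G z.1 z.2) (Icc 0 T ×ˢ Icc 0 1)) :
    Continuous fun z : ℝ × ℝ => rectExtend hT G z.1 z.2 := by
  refine hG.comp_continuous (f := fun z : ℝ × ℝ =>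
    ((projIcc 0 T hT z.1 : ℝ), (projIcc 0 1 zero_le_one z.2 : ℝ))) ?_ fun z =>
    ⟨(projIcc 0 T hT z.1).2, (projIcc 0 1 zero_le_one z.2).2⟩
  exact (continuous_subtype_val.comp (continuous_projIcc.comp continuous_fst)).prodMk
    (continuous_subtype_val.comp (continuous_projIcc.comp continuous_snd))

theorem bddMeas_rectExtend
    (hG : ContinuousOn (fun z : ℝ × ℝ => G z.1 z.2) (Icc 0 T ×ˢ Icc 0 1)) :
    BddMeas fun z : ℝ × ℝ => rectExtend hT G z.1 z.2 := by
  refine ⟨(continuous_rectExtend hT hG).measurable, ?_⟩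
  obtain ⟨C, hC⟩ := (isCompact_Icc.prod isCompact_Icc).exists_bound_of_continuousOn hG
  exact ⟨C, fun z => hC ((projIcc 0 T hT z.1 : ℝ), (projIcc 0 1 zero_le_one z.2 : ℝ))
    ⟨(projIcc 0 T hT z.1).2, (projIcc 0 1 zero_le_one z.2).2⟩⟩

theorem IsTestFunction.rectExtend {Gt Gu Guu : ℝ → ℝ → ℝ} (hG : IsTestFunction T G Gt Gu Guu) :
    IsGlobalTest T (rectExtend hT G) (rectExtend hT Gt) (rectExtend hT Gu) (rectExtend hT Guu) where
  test :=
    { continuousOn := (continuous_rectExtend hT hG.continuousOn).continuousOn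
      continuousOn_t := (continuous_rectExtend hT hG.continuousOn_t).continuousOn
      continuousOn_u := (continuous_rectExtend hT hG.continuousOn_u).continuousOn
      continuousOn_uu := (continuous_rectExtend hT hG.continuousOn_uu).continuousOn
      deriv_t := fun t ht u hu => by
        rw [rectExtend_eq hT ht hu]
        exact (hG.deriv_t t ht u hu).congr (fun s hs => rectExtend_eq hT hs hu)
          (rectExtend_eq hT ht hu)
      deriv_u := fun t ht u hu => by
        rw [rectExtend_eq hT ht hu]
        exact (hG.deriv_u t ht u hu).congr (fun x hx => rectExtend_eq hT ht hx)
          (rectExtend_eq hT ht hu)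
      deriv_uu := fun t ht u hu => by
        rw [rectExtend_eq hT ht hu]
        exact (hG.deriv_uu t ht u hu).congr (fun x hx => rectExtend_eq hT ht hx)
          (rectExtend_eq hT ht hu) }
  cont := continuous_rectExtend hT hG.continuousOn
  cont_t := continuous_rectExtend hT hG.continuousOn_t
  cont_u := continuous_rectExtend hT hG.continuousOn_u
  cont_uu := continuous_rectExtend hT hG.continuousOn_uu
  bdd := bddMeas_rectExtend hT hG.continuousOn
  bdd_t := bddMeas_rectExtend hT hG.continuousOn_t
  bdd_u := bddMeas_rectExtend hT hG.continuousOn_u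
  bdd_uu := bddMeas_rectExtend hT hG.continuousOn_uu

end rectExtend

/-! ### The chain rule along absolutely continuous paths -/

namespace IsGlobalTest

variable {T : ℝ} {G Gt Gu Guu : ℝ → ℝ → ℝ} (hG : IsGlobalTest T G Gt Gu Guu)
include hG

/-- Only partial derivatives of G are given. The increment splits into a change of y at the frozen
time s and a change of time at the moved point y(r). The second part is handled by the mean value
inequality and the joint continuity of ∂ₜG. -/
theorem hasDerivAt_comp {y : ℝ → ℝ} {g s : ℝ} (hy : HasDerivAt y g s) (hs : s ∈ Ioo 0 T)
    (hmem : ∀ r ∈ Icc 0 T, y r ∈ Icc (0 : ℝ) 1) :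
    HasDerivAt (fun r => G r (y r)) (Gt s (y s) + Gu s (y s) * g) s := by
  have hsI : s ∈ Icc 0 T := Ioo_subset_Icc_self hs
  have hnhds : Icc 0 T ∈ 𝓝 s := Icc_mem_nhds hs.1 hs.2
  have h2 : HasDerivAt (fun r => G s (y r)) (Gu s (y s) * g) s :=
    ((hG.test.deriv_u s hsI (y s) (hmem s hsI)).comp s (hy.hasDerivWithinAt (s := Icc 0 T))
      hmem).hasDerivAt hnhds
  have h1 : HasDerivAt (fun r => G r (y r) - G s (y r)) (Gt s (y s)) s := by
    rw [hasDerivAt_iff_isLittleO, Asymptotics.isLittleO_iff]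
    intro ε hε
    have hc := (hG.cont_t.continuousAt (x := (s, y s)))
    have hc' := Metric.continuousAt_iff.1 hc ε hε
    obtain ⟨δ, hδ, hδ'⟩ := hc'
    have hyc : ∀ᶠ r in 𝓝 s, dist (y r) (y s) < δ := Metric.continuousAt_iff'.1 hy.continuousAt δ hδ
    filter_upwards [hyc, hnhds, Metric.ball_mem_nhds s hδ] with r hr1 hr2 hr3
    have hsub : uIcc s r ⊆ Icc 0 T := uIcc_subset_Icc hsI hr2
    have hmv := Convex.norm_image_sub_le_of_norm_hasDerivWithin_le (s := uIcc s r)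
      (f := fun x => G x (y r) - x * Gt s (y s)) (f' := fun x => Gt x (y r) - Gt s (y s)) (C := ε)
      (fun x hx => by
        have := ((hG.test.deriv_t x (hsub hx) (y r) (hmem r hr2)).mono hsub).sub
          ((hasDerivWithinAt_id x (uIcc s r)).mul_const (Gt s (y s)))
        exact this.congr_deriv (by ring)) (fun x hx => by
        have hxs : dist x s < δ := by
          refine lt_of_le_of_lt ?_ (Metric.mem_ball.1 hr3)
          rw [Real.dist_eq, Real.dist_eq]
          exact abs_sub_left_of_mem_uIcc hx
        have := hδ' (x := (x, y r)) (by
          rw [Prod.dist_eq]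
          exact max_lt hxs hr1)
        rw [Real.dist_eq] at this
        exact this.le) (convex_uIcc s r) left_mem_uIcc right_mem_uIcc
    convert hmv using 2
    simp only [smul_eq_mul, sub_self, sub_zero]
    ring
  have := h1.add h2
  refine this.congr_of_eventuallyEq (Eventually.of_forall fun r => ?_)
  simp only [Pi.add_apply]
  ring

theorem lipschitz_comp {y : ℝ → ℝ} {D : ℝ} (hmem : ∀ r ∈ Icc 0 T, y r ∈ Icc (0 : ℝ) 1)
    (hy : ∀ r ∈ Icc 0 T, ∀ s ∈ Icc 0 T, |y r - y s| ≤ D * |r - s|) :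
    ∃ K : NNReal, LipschitzOnWith K (fun r => G r (y r)) (Icc 0 T) := by
  obtain ⟨C₁, hC₁⟩ := hG.bdd_t.bdd
  obtain ⟨C₂, hC₂⟩ := hG.bdd_u.bdd
  have hC₂0 : 0 ≤ C₂ := (abs_nonneg _).trans (hC₂ (0, 0))
  refine ⟨Real.toNNReal (C₁ + C₂ * D), LipschitzOnWith.of_dist_le_mul fun r hr s hs => ?_⟩
  have h1 := Convex.norm_image_sub_le_of_norm_hasDerivWithin_le (s := Icc 0 T)
    (f := fun x => G x (y r)) (f' := fun x => Gt x (y r)) (C := C₁)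
    (fun x hx => hG.test.deriv_t x hx (y r) (hmem r hr)) (fun x _ => hC₁ (x, y r)) (convex_Icc 0 T) hs hr
  have h2 := Convex.norm_image_sub_le_of_norm_hasDerivWithin_le (s := Icc (0 : ℝ) 1)
    (f := fun x => G s x) (f' := fun x => Gu s x) (C := C₂)
    (fun x hx => hG.test.deriv_u s hs x hx) (fun x _ => hC₂ (s, x)) (convex_Icc 0 1) (hmem s hs) (hmem r hr)
  simp only [Real.norm_eq_abs] at h1 h2
  rw [Real.dist_eq, Real.dist_eq]
  calc |G r (y r) - G s (y s)| = |(G r (y r) - G s (y r)) + (G s (y r) - G s (y s))| := by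
        congr 1; ring
    _ ≤ C₁ * |r - s| + C₂ * |y r - y s| := (abs_add_le _ _).trans (add_le_add h1 h2)
    _ ≤ C₁ * |r - s| + C₂ * (D * |r - s|) := by gcongr; exact hy r hr s hs
    _ = (C₁ + C₂ * D) * |r - s| := by ring
    _ ≤ _ := mul_le_mul_of_nonneg_right (Real.le_coe_toNNReal _) (abs_nonneg _)

/-- The path y is Lipschitz, hence so is its composition with G, which is then the integral of its
derivative. The chain rule identifies that derivative almost everywhere, by Lebesgue differentiation
of the primitive of g. -/
theorem sub_eq_integral {y g : ℝ → ℝ} (hg : BddMeas g)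
    (hy : ∀ t ∈ Icc 0 T, y t = y 0 + ∫ s in (0 : ℝ)..t, g s)
    (hmem : ∀ r ∈ Icc 0 T, y r ∈ Icc (0 : ℝ) 1) {t : ℝ} (ht : t ∈ Icc 0 T) :
    G t (y t) - G 0 (y 0) = ∫ s in (0 : ℝ)..t, (Gt s (y s) + Gu s (y s) * g s) := by
  obtain ⟨D, hD⟩ := hg.bdd
  have hlip : ∀ r ∈ Icc 0 T, ∀ s ∈ Icc 0 T, |y r - y s| ≤ D * |r - s| := by
    intro r hr s hs
    rw [hy r hr, hy s hs, add_sub_add_left_eq_sub, intervalIntegral.integral_interval_sub_left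
      (hg.intervalIntegrable _ _) (hg.intervalIntegrable _ _)]
    exact intervalIntegral.norm_integral_le_of_norm_le_const (f := g) fun x _ => hD x
  obtain ⟨K, hK⟩ := hG.lipschitz_comp hmem hlip
  have hsub : uIcc 0 t ⊆ Icc 0 T := by
    rw [uIcc_of_le ht.1]
    exact Icc_subset_Icc_right ht.2
  have hAC : AbsolutelyContinuousOnInterval (fun r => G r (y r)) 0 t :=
    (hK.mono hsub).absolutelyContinuousOnInterval
  rw [← hAC.integral_deriv_eq_sub]
  refine intervalIntegral.integral_congr_ae ?_
  -- Discarding x = t keeps x inside (0, T), where a two-sided derivative is available even if t =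
  -- T.
  have ht' : ∀ᵐ x : ℝ, x ≠ t := by simp [ae_iff, measure_singleton]
  filter_upwards [(hg.intervalIntegrable 0 t).ae_hasDerivAt_integral, ht'] with x hx hxt hx'
  have hx0 := hx (uIoc_subset_uIcc hx') 0 (by simp)
  rw [uIoc_of_le ht.1] at hx'
  have hxI : x ∈ Ioo 0 T := ⟨hx'.1, (lt_of_le_of_ne hx'.2 hxt).trans_le ht.2⟩
  refine (hG.hasDerivAt_comp ?_ hxI hmem).deriv
  refine (hx0.const_add (y 0)).congr_of_eventuallyEq ?_
  filter_upwards [Icc_mem_nhds hxI.1 hxI.2] with r hr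
  exact hy r hr

end IsGlobalTest

/-! ### Recovering the boundary values of a weak solution -/

/-- The function `v ↦ 1 - b - v` on `[0,1]`, constant outside. -/
noncomputable def bdryLin (b x : ℝ) : ℝ := (1 - b) - (projIcc (0 : ℝ) 1 zero_le_one x : ℝ)

theorem bddMeas_bdryLin (b : ℝ) : BddMeas (bdryLin b) :=
  (BddMeas.const _).sub (BddMeas.of_mem_Icc
    (measurable_subtype_coe.comp (continuous_projIcc (h := zero_le_one)).measurable)
    fun x => (projIcc (0 : ℝ) 1 zero_le_one x).2)

/-- Integration by parts; the zeros of 1 - b - x are such that only the endpoint b contributes.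
Hence the derivative of the Fejér sine mean of this function is the Fejér kernel at b minus 1. -/
theorem sinC_bdryLin {b : ℝ} (hb : b = 0 ∨ b = 1) (n : ℤ) :
    sinC (bdryLin b) n * (n * Real.pi) =
      Real.cos (n * Real.pi * b) - if n = 0 then 1 else 0 := by
  have h1 : sinC (bdryLin b) n * (n * Real.pi) =
      ∫ x in (0 : ℝ)..1, (((1 - b) - x) * (Real.sin (n * Real.pi * x) * (n * Real.pi)) +
        1 * Real.cos (n * Real.pi * x) - Real.cos (n * Real.pi * x)) := by
    rw [sinC, ← intervalIntegral.integral_mul_const]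
    apply intervalIntegral_congr_Icc (hu := right_mem_Icc.2 zero_le_one)
    intro x hx
    simp only [bdryLin]
    rw [projIcc_of_mem zero_le_one hx]
    ring
  have hd : ∀ x : ℝ, HasDerivAt (fun x => -(((1 - b) - x) * Real.cos (n * Real.pi * x)))
      (((1 - b) - x) * (Real.sin (n * Real.pi * x) * (n * Real.pi)) +
        1 * Real.cos (n * Real.pi * x)) x := by
    intro x
    have h := (((hasDerivAt_id' x).const_sub (1 - b)).mul
      ((hasDerivAt_id' x).const_mul (n * Real.pi : ℝ)).cos).neg
    exact h.congr_deriv (by ring)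
  rw [h1, intervalIntegral.integral_sub, integral_cos_int,
    intervalIntegral.integral_eq_sub_of_hasDerivAt (fun x _ => hd x)]
  · rcases hb with rfl | rfl <;> simp
  · exact Continuous.intervalIntegrable (by fun_prop) _ _
  · exact Continuous.intervalIntegrable (by fun_prop) _ _
  · exact Continuous.intervalIntegrable (by fun_prop) _ _

/-- The Fejér kernel at the boundary point `b`. -/
noncomputable def bdryKernel (N : ℕ) (b v : ℝ) : ℝ :=
  fejerSum N (fun n => Real.cos (n * Real.pi * v) * Real.cos (n * Real.pi * b))

/-- A primitive of the Fejér kernel at the boundary point `b`. -/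
noncomputable def bdryGrad (N : ℕ) (b v : ℝ) : ℝ :=
  (v - (1 - b)) + fejerSin N (sinC (bdryLin b)) v

/-- A second primitive of the Fejér kernel at the boundary point `b`. -/
noncomputable def bdryPot (N : ℕ) (b v : ℝ) : ℝ := ∫ x in (0 : ℝ)..v, bdryGrad N b x

theorem hasDerivAt_fejerSin (N : ℕ) (c : ℤ → ℝ) (v : ℝ) :
    HasDerivAt (fejerSin N c)
      (fejerSum N (fun n => c n * (Real.cos (n * Real.pi * v) * (n * Real.pi)))) v :=
  hasDerivAt_fejerSum N (c' := fun n v => c n * (Real.cos (n * Real.pi * v) * (n * Real.pi)))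
    fun n => by
      have := (((hasDerivAt_id' v).const_mul (n * Real.pi : ℝ)).sin.const_mul (c n))
      exact this.congr_deriv (by ring)

theorem continuous_fejerSin (N : ℕ) (c : ℤ → ℝ) : Continuous (fejerSin N c) :=
  continuous_fejerSum N fun _ => by fun_prop

theorem continuous_fejerCos (N : ℕ) (c : ℤ → ℝ) : Continuous (fejerCos N c) :=
  continuous_fejerSum N fun _ => by fun_prop

theorem continuous_bdryKernel (N : ℕ) (b : ℝ) : Continuous (bdryKernel N b) :=
  continuous_fejerSum N fun _ => by fun_prop

theorem continuous_bdryGrad (N : ℕ) (b : ℝ) : Continuous (bdryGrad N b) :=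
  (continuous_id.sub continuous_const).add (continuous_fejerSin N _)

theorem hasDerivAt_bdryPot (N : ℕ) (b v : ℝ) : HasDerivAt (bdryPot N b) (bdryGrad N b v) v :=
  ((continuous_bdryGrad N b).integral_hasStrictDerivAt 0 v).hasDerivAt

theorem hasDerivAt_bdryGrad {N : ℕ} (hN : 0 < N) {b : ℝ} (hb : b = 0 ∨ b = 1) (v : ℝ) :
    HasDerivAt (bdryGrad N b) (bdryKernel N b v) v := by
  have h := ((hasDerivAt_id' v).sub_const (1 - b)).add
    (hasDerivAt_fejerSin N (sinC (bdryLin b)) v)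
  refine h.congr_deriv ?_
  have h1 : (fun n : ℤ => sinC (bdryLin b) n * (Real.cos (n * Real.pi * v) * (n * Real.pi))) =
      fun n : ℤ => Real.cos (n * Real.pi * v) * Real.cos (n * Real.pi * b) -
        Real.cos (n * Real.pi * v) * if n = 0 then 1 else 0 := by
    funext n
    have := sinC_bdryLin hb n
    linear_combination Real.cos (n * Real.pi * v) * this
  rw [h1, fejerSum_sub, fejerSum_of_ne_zero hN (c := fun n : ℤ =>
    Real.cos (n * Real.pi * v) * if n = 0 then 1 else 0) (fun n hn => by simp [hn])]
  simp [bdryKernel]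

theorem fejerSin_one (N : ℕ) (c : ℤ → ℝ) : fejerSin N c 1 = 0 := by
  have h : ∀ n : ℤ, c n * Real.sin (n * Real.pi * 1) = 0 := fun n => by
    rw [mul_one, Real.sin_int_mul_pi, mul_zero]
  simp only [fejerSin, h]
  simp [fejerSum]

theorem fejerSin_zero (N : ℕ) (c : ℤ → ℝ) : fejerSin N c 0 = 0 := by
  simp [fejerSin, fejerSum]

/-- On [0,1] the gradient is the Fejér sine mean of v ↦ 1 - b - v minus that function itself. -/
theorem tendsto_bdryGrad (b : ℝ) :
    Tendsto (fun N => ∫ v in (0 : ℝ)..1, |bdryGrad N b v|) atTop (𝓝 0) := by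
  refine (tendsto_fejerSin_L1 (bddMeas_bdryLin b)).congr fun N => ?_
  apply intervalIntegral_congr_Icc (hu := right_mem_Icc.2 zero_le_one)
  intro x hx
  simp only [bdryLin, bdryGrad]
  rw [projIcc_of_mem zero_le_one hx]
  congr 1
  ring

theorem abs_bdryPot_le (N : ℕ) (b : ℝ) {v : ℝ} (hv : v ∈ Icc (0 : ℝ) 1) :
    |bdryPot N b v| ≤ ∫ v in (0 : ℝ)..1, |bdryGrad N b v| :=
  (intervalIntegral.abs_integral_le_integral_abs hv.1).trans
    (intervalIntegral.integral_mono_interval le_rfl hv.1 hv.2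
      (Eventually.of_forall fun _ => abs_nonneg _)
      ((continuous_bdryGrad N b).abs.intervalIntegrable _ _))

theorem isTestFunction_mul (T : ℝ) {φ φ' χ χ' χ'' : ℝ → ℝ} (hφ : ∀ t, HasDerivAt φ (φ' t) t)
    (hφ' : Continuous φ') (hχ : ∀ v, HasDerivAt χ (χ' v) v) (hχ' : ∀ v, HasDerivAt χ' (χ'' v) v)
    (hχ'' : Continuous χ'') :
    IsTestFunction T (fun t v => φ t * χ v) (fun t v => φ' t * χ v) (fun t v => φ t * χ' v)
      (fun t v => φ t * χ'' v) := by
  have c1 : Continuous φ := continuous_iff_continuousAt.2 fun t => (hφ t).continuousAt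
  have c2 : Continuous χ := continuous_iff_continuousAt.2 fun t => (hχ t).continuousAt
  have c3 : Continuous χ' := continuous_iff_continuousAt.2 fun t => (hχ' t).continuousAt
  exact
  { continuousOn := ((c1.comp continuous_fst).mul (c2.comp continuous_snd)).continuousOn
    continuousOn_t := ((hφ'.comp continuous_fst).mul (c2.comp continuous_snd)).continuousOn
    continuousOn_u := ((c1.comp continuous_fst).mul (c3.comp continuous_snd)).continuousOn
    continuousOn_uu := ((c1.comp continuous_fst).mul (hχ''.comp continuous_snd)).continuousOn
    deriv_t := fun t _ v _ => ((hφ t).mul_const (χ v)).hasDerivWithinAt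
    deriv_u := fun t _ v _ => ((hχ v).const_mul (φ t)).hasDerivWithinAt
    deriv_uu := fun t _ v _ => ((hχ' v).const_mul (φ t)).hasDerivWithinAt }

section Boundary

variable {s q T : ℝ} {h ωini : ℝ → ℝ} {ω : ℝ → ℝ → ℝ}

theorem bddMeas_uncurry (hm : Measurable fun z : ℝ × ℝ => ω z.1 z.2)
    (hK : ∀ t u, ω t u ∈ Icc (0 : ℝ) 1) : BddMeas fun z : ℝ × ℝ => ω z.1 z.2 :=
  BddMeas.of_mem_Icc hm fun z => hK z.1 z.2

theorem abs_le_one_of_mem {x : ℝ} (hx : x ∈ Icc (0 : ℝ) 1) : |x| ≤ 1 :=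
  abs_le.2 ⟨by linarith [hx.1], hx.2⟩

theorem bddMeas_fejerCos_time (hm : Measurable fun z : ℝ × ℝ => ω z.1 z.2)
    (hK : ∀ t u, ω t u ∈ Icc (0 : ℝ) 1) (N : ℕ) :
    BddMeas fun z : ℝ × ℝ => fejerCos N (cosC (ω z.1)) z.2 :=
  BddMeas.fejerSum N fun n => ((bddMeas_uncurry hm hK).cosC n).fst.mul (BddMeas.cos _).snd

theorem bddMeas_fejerCos_left (hm : Measurable fun z : ℝ × ℝ => ω z.1 z.2)
    (hK : ∀ t u, ω t u ∈ Icc (0 : ℝ) 1) (N : ℕ) (v : ℝ) :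
    BddMeas fun t => fejerCos N (cosC (ω t)) v :=
  BddMeas.fejerSum N fun n => ((bddMeas_uncurry hm hK).cosC n).mul (BddMeas.const _)

theorem fejerCos_mem (hm : Measurable fun z : ℝ × ℝ => ω z.1 z.2)
    (hK : ∀ t u, ω t u ∈ Icc (0 : ℝ) 1) {N : ℕ} (hN : 0 < N) (t v : ℝ) :
    fejerCos N (cosC (ω t)) v ∈ Icc (0 : ℝ) 1 :=
  ⟨fejerCos_nonneg ((bddMeas_uncurry hm hK).prodMk_left t) (fun x => (hK t x).1) N v,
    fejerCos_le_one ((bddMeas_uncurry hm hK).prodMk_left t) (fun x => (hK t x).2) hN v⟩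

/-- The difference between the Fejér mean of a weak solution at the boundary and its boundary value
tends to zero when tested against a polynomial in time. -/
theorem tendsto_boundary_of_hasDerivAt (hT : 0 ≤ T) (hs : 0 < s)
    (hω : IsWeakSolutionRobin (Icc 0 1) s q (fun r => r) h T ωini ω)
    (hm : Measurable fun z : ℝ × ℝ => ω z.1 z.2) (hK : ∀ t u, ω t u ∈ Icc (0 : ℝ) 1)
    (hKi : ∀ u, ωini u ∈ Icc (0 : ℝ) 1) (hh1 : ∀ t u, |h (ω t u)| ≤ 1)
    {b : ℝ} (hb : b = 0 ∨ b = 1) {φ φ' : ℝ → ℝ} (hφ : ∀ t, HasDerivAt φ (φ' t) t)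
    (hφ' : Continuous φ') {t : ℝ} (ht : t ∈ Icc 0 T) :
    Tendsto (fun N => ∫ τ in (0 : ℝ)..t, φ τ * (fejerCos N (cosC (ω τ)) b - ω τ b))
      atTop (𝓝 0) := by
  have hωb := bddMeas_uncurry hm hK
  have hφc : Continuous φ := continuous_iff_continuousAt.2 fun t => (hφ t).continuousAt
  obtain ⟨M₁, hM₁⟩ := isCompact_Icc.exists_bound_of_continuousOn (hφc.continuousOn (s := Icc 0 T))
  obtain ⟨M₂, hM₂⟩ := isCompact_Icc.exists_bound_of_continuousOn (hφ'.continuousOn (s := Icc 0 T))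
  have h0T : (0 : ℝ) ∈ Icc 0 T := left_mem_Icc.2 hT
  have hM₁0 : 0 ≤ M₁ := (norm_nonneg _).trans (hM₁ 0 h0T)
  have hM₂0 : 0 ≤ M₂ := (norm_nonneg _).trans (hM₂ 0 h0T)
  -- The four summands bound the terms at time t, at time 0, with the time derivative, and with the
  -- flux; each carries the L¹ norm of `bdryGrad`.
  have hlim := (tendsto_bdryGrad b).const_mul ((M₁ + M₁ + M₂ * T + |q| * (M₁ * T)) / s)
  rw [mul_zero] at hlim
  refine squeeze_zero_norm' ?_ hlim
  filter_upwards [eventually_gt_atTop 0] with N hN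
  set X := ∫ v in (0 : ℝ)..1, |bdryGrad N b v| with hX
  have hX0 : 0 ≤ X := intervalIntegral.integral_nonneg zero_le_one fun _ _ => abs_nonneg _
  -- The second space derivative of this test function is φ times the Fejér kernel at b, which
  -- reproduces the Fejér mean of ω at b. Its first derivative at the endpoints is φ·b at 1 and φ·(b
  -- - 1) at 0, so the boundary bracket is exactly φ·ω(b). All other terms are small.
  have hw := hω.weak _ _ _ _ (isTestFunction_mul T hφ hφ' (hasDerivAt_bdryPot N b)
    (hasDerivAt_bdryGrad hN hb) (continuous_bdryKernel N b)) t ht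
  have e1 : ∀ τ, ∫ u in (0 : ℝ)..1, ω τ u * (φ τ * bdryKernel N b u) =
      φ τ * fejerCos N (cosC (ω τ)) b := by
    intro τ
    rw [fejerCos_eq_integral (hωb.prodMk_left τ), ← intervalIntegral.integral_const_mul]
    congr 1
    funext u
    rw [bdryKernel]
    ring
  have e2 : ∀ τ, ω τ 1 * (φ τ * bdryGrad N b 1) - ω τ 0 * (φ τ * bdryGrad N b 0) =
      φ τ * ω τ b := by
    intro τ
    rw [bdryGrad, bdryGrad, fejerSin_one, fejerSin_zero]
    rcases hb with rfl | rfl <;> ring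
  simp only [e1, e2] at hw
  have hb1 : BddMeas fun τ => fejerCos N (cosC (ω τ)) b :=
    bddMeas_fejerCos_left hm hK N b
  have hb2 : BddMeas fun τ => ω τ b := hωb.comp (measurable_id.prodMk measurable_const)
  have e3 : ∫ τ in (0 : ℝ)..t, φ τ * (fejerCos N (cosC (ω τ)) b - ω τ b) =
      (∫ τ in (0 : ℝ)..t, φ τ * fejerCos N (cosC (ω τ)) b) - ∫ τ in (0 : ℝ)..t, φ τ * ω τ b := by
    simp only [mul_sub]
    exact intervalIntegral.integral_sub
      ((hb1.intervalIntegrable 0 t).continuousOn_mul hφc.continuousOn)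
      ((hb2.intervalIntegrable 0 t).continuousOn_mul hφc.continuousOn)
  have b1 : |∫ u in (0 : ℝ)..1, ω t u * (φ t * bdryPot N b u)| ≤ M₁ * X := by
    have := intervalIntegral.norm_integral_le_of_norm_le_const (a := (0 : ℝ)) (b := 1)
      (f := fun u => ω t u * (φ t * bdryPot N b u)) (C := M₁ * X) fun u hu => by
        rw [uIoc_of_le zero_le_one] at hu
        rw [norm_mul, norm_mul]
        calc _ ≤ 1 * (M₁ * X) := by
              gcongr
              · exact abs_le_one_of_mem (hK t u)
              · exact hM₁ t ht
              · exact abs_bdryPot_le N b (Ioc_subset_Icc_self hu)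
          _ = _ := one_mul _
    simpa using this
  have b2 : |∫ u in (0 : ℝ)..1, ωini u * (φ 0 * bdryPot N b u)| ≤ M₁ * X := by
    have := intervalIntegral.norm_integral_le_of_norm_le_const (a := (0 : ℝ)) (b := 1)
      (f := fun u => ωini u * (φ 0 * bdryPot N b u)) (C := M₁ * X) fun u hu => by
        rw [uIoc_of_le zero_le_one] at hu
        rw [norm_mul, norm_mul]
        calc _ ≤ 1 * (M₁ * X) := by
              gcongr
              · exact abs_le_one_of_mem (hKi u)
              · exact hM₁ 0 h0T
              · exact abs_bdryPot_le N b (Ioc_subset_Icc_self hu)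
          _ = _ := one_mul _
    simpa using this
  have htT : |t - 0| ≤ T := by
    rw [sub_zero, abs_of_nonneg ht.1]
    exact ht.2
  have b3 : |∫ τ in (0 : ℝ)..t, ∫ u in (0 : ℝ)..1, ω τ u * (φ' τ * bdryPot N b u)| ≤
      M₂ * T * X := by
    have := intervalIntegral.norm_integral_le_of_norm_le_const (a := (0 : ℝ)) (b := t)
      (f := fun τ => ∫ u in (0 : ℝ)..1, ω τ u * (φ' τ * bdryPot N b u)) (C := M₂ * X) fun τ hτ => by
        rw [uIoc_of_le ht.1] at hτ
        have := intervalIntegral.norm_integral_le_of_norm_le_const (a := (0 : ℝ)) (b := 1)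
          (f := fun u => ω τ u * (φ' τ * bdryPot N b u)) (C := M₂ * X) fun u hu => by
            rw [uIoc_of_le zero_le_one] at hu
            rw [norm_mul, norm_mul]
            calc _ ≤ 1 * (M₂ * X) := by
                  gcongr
                  · exact abs_le_one_of_mem (hK τ u)
                  · exact hM₂ τ ⟨hτ.1.le, hτ.2.trans ht.2⟩
                  · exact abs_bdryPot_le N b (Ioc_subset_Icc_self hu)
              _ = _ := one_mul _
        simpa using this
    calc _ ≤ M₂ * X * |t - 0| := this
      _ ≤ M₂ * X * T := by gcongr
      _ = _ := by ring
  have b4 : |∫ τ in (0 : ℝ)..t, ∫ u in (0 : ℝ)..1, h (ω τ u) * (φ τ * bdryGrad N b u)| ≤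
      M₁ * T * X := by
    have := intervalIntegral.norm_integral_le_of_norm_le_const (a := (0 : ℝ)) (b := t)
      (f := fun τ => ∫ u in (0 : ℝ)..1, h (ω τ u) * (φ τ * bdryGrad N b u)) (C := M₁ * X)
      fun τ hτ => by
        rw [uIoc_of_le ht.1] at hτ
        have := intervalIntegral.norm_integral_le_of_norm_le (a := (0 : ℝ)) (b := 1) (μ := volume)
          (f := fun u => h (ω τ u) * (φ τ * bdryGrad N b u)) (g := fun u => M₁ * |bdryGrad N b u|)
          zero_le_one (Eventually.of_forall fun u hu => by
            rw [norm_mul, norm_mul]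
            calc _ ≤ 1 * (M₁ * |bdryGrad N b u|) := by
                  gcongr
                  · exact hh1 τ u
                  · exact hM₁ τ ⟨hτ.1.le, hτ.2.trans ht.2⟩
                  · exact le_rfl
              _ = _ := one_mul _)
          (((continuous_bdryGrad N b).abs.const_mul M₁).intervalIntegrable _ _)
        rwa [intervalIntegral.integral_const_mul] at this
    calc _ ≤ M₁ * X * |t - 0| := this
      _ ≤ M₁ * X * T := by gcongr
      _ = _ := by ring
  have b4' : |q * ∫ τ in (0 : ℝ)..t, ∫ u in (0 : ℝ)..1, h (ω τ u) * (φ τ * bdryGrad N b u)| ≤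
      |q| * (M₁ * T) * X := by
    rw [abs_mul, mul_assoc]
    exact mul_le_mul_of_nonneg_left b4 (abs_nonneg q)
  rw [Real.norm_eq_abs, div_mul_eq_mul_div, le_div_iff₀ hs, ← abs_of_pos hs, ← abs_mul, e3]
  rw [abs_le] at b1 b2 b3 b4' ⊢
  constructor <;> linarith [b1.1, b1.2, b2.1, b2.2, b3.1, b3.2, b4'.1, b4'.2]

/-- Weierstrass approximation extends the convergence from polynomials to continuous φ, since the
Fejér means and ω all take values in [0,1]. -/
theorem tendsto_boundary (hT : 0 ≤ T) (hs : 0 < s)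
    (hω : IsWeakSolutionRobin (Icc 0 1) s q (fun r => r) h T ωini ω)
    (hm : Measurable fun z : ℝ × ℝ => ω z.1 z.2) (hK : ∀ t u, ω t u ∈ Icc (0 : ℝ) 1)
    (hKi : ∀ u, ωini u ∈ Icc (0 : ℝ) 1) (hh1 : ∀ t u, |h (ω t u)| ≤ 1)
    {b : ℝ} (hb : b = 0 ∨ b = 1) {φ : ℝ → ℝ} (hφ : Continuous φ) {t : ℝ} (ht : t ∈ Icc 0 T) :
    Tendsto (fun N => ∫ τ in (0 : ℝ)..t, φ τ * (fejerCos N (cosC (ω τ)) b - ω τ b))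
      atTop (𝓝 0) := by
  rw [Metric.tendsto_atTop]
  intro ε hε
  obtain ⟨P, hP⟩ := exists_polynomial_near_of_continuousOn 0 T φ hφ.continuousOn
    (ε / (2 * (T + 1))) (by positivity)
  have hlim := tendsto_boundary_of_hasDerivAt hT hs hω hm hK hKi hh1 hb (fun t => P.hasDerivAt t)
    P.derivative.continuous ht
  obtain ⟨N₀, hN₀⟩ := Metric.tendsto_atTop.1 hlim (ε / 2) (by positivity)
  -- The shift guarantees N > 0, without which `fejerCos_mem` does not apply.
  refine ⟨N₀ + 1, fun N hN => ?_⟩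
  have h1 := hN₀ N (by omega)
  rw [Real.dist_eq, sub_zero] at h1 ⊢
  have hb1 : BddMeas fun τ => fejerCos N (cosC (ω τ)) b :=
    bddMeas_fejerCos_left hm hK N b
  have hb2 : BddMeas fun τ => ω τ b :=
    (bddMeas_uncurry hm hK).comp (measurable_id.prodMk measurable_const)
  have hi := (hb1.sub hb2).intervalIntegrable 0 t
  have e : ∫ τ in (0 : ℝ)..t, φ τ * (fejerCos N (cosC (ω τ)) b - ω τ b) =
      (∫ τ in (0 : ℝ)..t, P.eval τ * (fejerCos N (cosC (ω τ)) b - ω τ b)) -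
      ∫ τ in (0 : ℝ)..t, (P.eval τ - φ τ) * (fejerCos N (cosC (ω τ)) b - ω τ b) := by
    rw [← intervalIntegral.integral_sub (hi.continuousOn_mul P.continuous.continuousOn)
      (hi.continuousOn_mul (show Continuous fun τ => P.eval τ - φ τ from P.continuous.sub hφ).continuousOn)]
    congr 1
    funext τ
    ring
  have h2 : |∫ τ in (0 : ℝ)..t, (P.eval τ - φ τ) * (fejerCos N (cosC (ω τ)) b - ω τ b)| ≤
      ε / (2 * (T + 1)) * |t - 0| :=
    intervalIntegral.norm_integral_le_of_norm_le_const
      (f := fun τ => (P.eval τ - φ τ) * (fejerCos N (cosC (ω τ)) b - ω τ b)) fun τ hτ => by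
      rw [uIoc_of_le ht.1] at hτ
      rw [norm_mul]
      have h3 := fejerCos_mem hm hK (show 0 < N by omega) τ b
      have h4 := hK τ b
      calc _ ≤ ε / (2 * (T + 1)) * 1 := by
            gcongr
            · exact (hP τ ⟨hτ.1.le, hτ.2.trans ht.2⟩).le
            · exact abs_le.2 ⟨by linarith [h3.1, h4.2], by linarith [h3.2, h4.1]⟩
        _ = _ := mul_one _
  have h5 : ε / (2 * (T + 1)) * |t - 0| ≤ ε / 2 := by
    rw [sub_zero, abs_of_nonneg ht.1]
    calc ε / (2 * (T + 1)) * t ≤ ε / (2 * (T + 1)) * (T + 1) := by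
          gcongr
          linarith [ht.2]
      _ = ε / 2 := by field_simp
  rw [e]
  calc _ ≤ _ := abs_sub _ _
    _ < ε / 2 + ε / 2 := add_lt_add_of_lt_of_le h1 (h2.trans h5)
    _ = ε := by ring

end Boundary

/-! ### Smooth approximation of the change of variables -/

theorem BddMeas.integral_swap {F : ℝ → ℝ → ℝ} (hF : BddMeas fun z : ℝ × ℝ => F z.1 z.2)
    (a b c d : ℝ) :
    ∫ x in a..b, ∫ y in c..d, F x y = ∫ y in c..d, ∫ x in a..b, F x y := by
  refine intervalIntegral_intervalIntegral_swap ?_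
  have : IsFiniteMeasure ((volume : Measure (ℝ × ℝ)).restrict (uIoc a b ×ˢ uIoc c d)) := by
    refine ⟨?_⟩
    rw [Measure.restrict_apply_univ, Measure.volume_eq_prod, Measure.prod_prod]
    exact ENNReal.mul_lt_top (by simp [uIoc]) (by simp [uIoc])
  exact BddMeas.integrable hF

theorem measurable_fejerSum {α : Type*} [MeasurableSpace α] (N : ℕ) {c : ℤ → α → ℝ}
    (h : ∀ n, Measurable (c n)) : Measurable (fun x => fejerSum N (fun n => c n x)) :=
  (Finset.measurable_sum _ fun _ _ => Finset.measurable_sum _ fun _ _ => h _).const_mul _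

/-- The primitive of `cos(nπ·)`. -/
noncomputable def sinPrim (n : ℤ) (v : ℝ) : ℝ := ∫ x in (0 : ℝ)..v, Real.cos (n * Real.pi * x)

theorem hasDerivAt_sinPrim (n : ℤ) (v : ℝ) :
    HasDerivAt (sinPrim n) (Real.cos (n * Real.pi * v)) v :=
  ((show Continuous fun x : ℝ => Real.cos (n * Real.pi * x) by
    fun_prop).integral_hasStrictDerivAt 0 v).hasDerivAt

theorem continuous_sinPrim (n : ℤ) : Continuous (sinPrim n) :=
  continuous_iff_continuousAt.2 fun v => (hasDerivAt_sinPrim n v).continuousAt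

/-- Stated as a product rather than a quotient, so that the mode n = 0, whose primitive is v, needs
no separate case. -/
theorem mul_sinPrim (n : ℤ) (v : ℝ) : n * Real.pi * sinPrim n v = Real.sin (n * Real.pi * v) := by
  have hd : ∀ x : ℝ, HasDerivAt (fun x => Real.sin (n * Real.pi * x))
      (n * Real.pi * Real.cos (n * Real.pi * x)) x := fun x =>
    (((hasDerivAt_id' x).const_mul (n * Real.pi : ℝ)).sin).congr_deriv (by ring)
  rw [sinPrim, ← intervalIntegral.integral_const_mul,
    intervalIntegral.integral_eq_sub_of_hasDerivAt (fun x _ => hd x)]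
  · simp
  · exact Continuous.intervalIntegrable (by fun_prop) _ _

/-- An approximation of `v ↦ m ∫₀ᵛ (2 - f)` in terms of the cosine coefficients of `f`. -/
noncomputable def approxU (m : ℝ) (N : ℕ) (c : ℤ → ℝ) (v : ℝ) : ℝ :=
  m * (2 * v - fejerSum N (fun n => c n * sinPrim n v))

/-- The second derivative of `approxU`. -/
noncomputable def approxUxx (m : ℝ) (N : ℕ) (c : ℤ → ℝ) (v : ℝ) : ℝ :=
  m * fejerSum N (fun n => c n * (Real.sin (n * Real.pi * v) * (n * Real.pi)))

theorem hasDerivAt_approxU (m : ℝ) (N : ℕ) (c : ℤ → ℝ) (v : ℝ) :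
    HasDerivAt (approxU m N c) (m * (2 - fejerCos N c v)) v := by
  have h1 : HasDerivAt (fun v => fejerSum N (fun n => c n * sinPrim n v)) (fejerCos N c v) v :=
    hasDerivAt_fejerSum N (c' := fun n v => c n * Real.cos (n * Real.pi * v))
      fun n => (hasDerivAt_sinPrim n v).const_mul (c n)
  exact ((((hasDerivAt_id' v).const_mul 2).sub h1).const_mul m).congr_deriv (by ring)

theorem hasDerivAt_approxUx (m : ℝ) (N : ℕ) (c : ℤ → ℝ) (v : ℝ) :
    HasDerivAt (fun v => m * (2 - fejerCos N c v)) (approxUxx m N c v) v := by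
  have h1 : HasDerivAt (fejerCos N c)
      (fejerSum N (fun n => -(c n * (Real.sin (n * Real.pi * v) * (n * Real.pi))))) v :=
    hasDerivAt_fejerSum N
      (c' := fun n v => -(c n * (Real.sin (n * Real.pi * v) * (n * Real.pi)))) fun n => by
      have := (((hasDerivAt_id' v).const_mul (n * Real.pi : ℝ)).cos.const_mul (c n))
      exact this.congr_deriv (by ring)
  refine ((h1.const_sub 2).const_mul m).congr_deriv ?_
  have h2 : (fun n : ℤ => -(c n * (Real.sin (n * Real.pi * v) * (n * Real.pi)))) = fun n : ℤ =>
      (-1) * (c n * (Real.sin (n * Real.pi * v) * (n * Real.pi))) := by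
    funext n
    ring
  rw [h2, fejerSum_const_mul, approxUxx]
  ring

theorem continuous_approxUxx (m : ℝ) (N : ℕ) (c : ℤ → ℝ) : Continuous (approxUxx m N c) :=
  (continuous_fejerSum N fun _ => by fun_prop).const_mul m

theorem continuous_approxU (m : ℝ) (N : ℕ) (c : ℤ → ℝ) : Continuous (approxU m N c) :=
  continuous_iff_continuousAt.2 fun v => (hasDerivAt_approxU m N c v).continuousAt

theorem approxU_zero (m : ℝ) (N : ℕ) (c : ℤ → ℝ) : approxU m N c 0 = 0 := by
  simp [approxU, sinPrim, fejerSum]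

theorem approxU_eq_integral (m : ℝ) (N : ℕ) (c : ℤ → ℝ) (v : ℝ) :
    approxU m N c v = ∫ x in (0 : ℝ)..v, m * (2 - fejerCos N c x) := by
  rw [intervalIntegral.integral_eq_sub_of_hasDerivAt (fun x _ => hasDerivAt_approxU m N c x),
    approxU_zero, sub_zero]
  exact ((continuous_const.sub (continuous_fejerCos N c)).const_mul m).intervalIntegrable _ _

/-- Only the mode 0, that is the mass, survives at v = 1. With the normalization of m the endpoint
is fixed exactly for every N, as the integration by parts requires. -/
theorem approxU_one (m : ℝ) {N : ℕ} (hN : 0 < N) (c : ℤ → ℝ) : approxU m N c 1 = m * (2 - c 0) := by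
  have h : ∀ n : ℤ, sinPrim n 1 = if n = 0 then 1 else 0 := fun n => integral_cos_int n
  rw [approxU, fejerSum_of_ne_zero hN (fun n hn => by rw [h, if_neg hn, mul_zero]), h, if_pos rfl]
  ring

section Range

variable {m : ℝ} {f : ℝ → ℝ} {N : ℕ}

/-- The Fejér mean is at most 1, so the approximation is nondecreasing, with endpoint values 0 and
1. This is what allows test functions on [0,1] to be evaluated along it. -/
theorem approxU_mem (hm : 0 ≤ m) (hf : BddMeas f) (hK : ∀ x, f x ∈ Icc (0 : ℝ) 1)
    (hmass : m * (2 - cosC f 0) = 1) (hN : 0 < N) {v : ℝ} (hv : v ∈ Icc (0 : ℝ) 1) :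
    approxU m N (cosC f) v ∈ Icc (0 : ℝ) 1 := by
  have hmono : Monotone (approxU m N (cosC f)) := by
    refine monotone_of_deriv_nonneg
      (fun v => (hasDerivAt_approxU m N (cosC f) v).differentiableAt) fun v => ?_
    rw [(hasDerivAt_approxU m N (cosC f) v).deriv]
    exact mul_nonneg hm (by linarith [fejerCos_le_one hf (fun x => (hK x).2) hN v])
  constructor
  · rw [← approxU_zero m N (cosC f)]
    exact hmono hv.1
  · rw [← hmass, ← approxU_one m hN]
    exact hmono hv.2

theorem abs_approxU_sub_le (hm : 0 ≤ m) (hf : BddMeas f) {v : ℝ} (hv : v ∈ Icc (0 : ℝ) 1) :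
    |approxU m N (cosC f) v - ∫ x in (0 : ℝ)..v, m * (2 - f x)| ≤
      m * ∫ x in (0 : ℝ)..1, |fejerCos N (cosC f) x - f x| := by
  have hP := bddMeas_fejerCos N (cosC f)
  have h2 := BddMeas.const (α := ℝ) 2
  rw [approxU_eq_integral, ← intervalIntegral.integral_sub
    (((h2.sub hP).const_mul m).intervalIntegrable _ _)
    (((h2.sub hf).const_mul m).intervalIntegrable _ _), ← intervalIntegral.integral_const_mul]
  have e : ∀ x, |m * (2 - fejerCos N (cosC f) x) - m * (2 - f x)| =
      m * |fejerCos N (cosC f) x - f x| := fun x => by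
    rw [← abs_of_nonneg hm, ← abs_mul, abs_of_nonneg hm, ← abs_neg]
    congr 1
    ring
  refine (intervalIntegral.abs_integral_le_integral_abs hv.1).trans ?_
  simp only [e]
  exact intervalIntegral.integral_mono_interval le_rfl hv.1 hv.2
    (Eventually.of_forall fun _ => mul_nonneg hm (abs_nonneg _))
    (((hP.sub hf).abs.const_mul m).intervalIntegrable _ _)

end Range

/-- Integration by parts in space. -/
theorem IsGlobalTest.integral_parts {T : ℝ} {G Gt Gu Guu : ℝ → ℝ → ℝ}
    (hG : IsGlobalTest T G Gt Gu Guu) {U U' U'' : ℝ → ℝ} (hU : ∀ v, HasDerivAt U (U' v) v)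
    (hU' : ∀ v, HasDerivAt U' (U'' v) v) (hU'' : Continuous U'')
    (hmem : ∀ v ∈ Icc (0 : ℝ) 1, U v ∈ Icc (0 : ℝ) 1) (h0 : U 0 = 0) (h1 : U 1 = 1) {τ : ℝ}
    (hτ : τ ∈ Icc 0 T) :
    ∫ v in (0 : ℝ)..1, Gu τ (U v) * U'' v =
      (Gu τ 1 * U' 1 - Gu τ 0 * U' 0) - ∫ v in (0 : ℝ)..1, Guu τ (U v) * U' v ^ 2 := by
  have cU : Continuous U := continuous_iff_continuousAt.2 fun v => (hU v).continuousAt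
  have cU' : Continuous U' := continuous_iff_continuousAt.2 fun v => (hU' v).continuousAt
  have cGu : Continuous fun v => Gu τ (U v) := hG.cont_u.comp (continuous_const.prodMk cU)
  have cGuu : Continuous fun v => Guu τ (U v) := hG.cont_uu.comp (continuous_const.prodMk cU)
  have hd : ∀ v ∈ Ioo (0 : ℝ) 1, HasDerivAt (fun v => Gu τ (U v) * U' v)
      (Guu τ (U v) * U' v ^ 2 + Gu τ (U v) * U'' v) v := by
    intro v hv
    have hI := Ioo_subset_Icc_self hv
    have h2 : HasDerivAt (fun r => Gu τ (U r)) (Guu τ (U v) * U' v) v :=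
      ((hG.test.deriv_uu τ hτ (U v) (hmem v hI)).comp v
        ((hU v).hasDerivWithinAt (s := Icc 0 1)) hmem).hasDerivAt (Icc_mem_nhds hv.1 hv.2)
    exact (h2.mul (hU' v)).congr_deriv (by ring)
  have i1 : IntervalIntegrable (fun v => Guu τ (U v) * U' v ^ 2) volume 0 1 :=
    (cGuu.mul (cU'.pow 2)).intervalIntegrable _ _
  have i2 : IntervalIntegrable (fun v => Gu τ (U v) * U'' v) volume 0 1 :=
    (cGu.mul hU'').intervalIntegrable _ _
  have : ∫ v in (0 : ℝ)..1, (Guu τ (U v) * U' v ^ 2 + Gu τ (U v) * U'' v) =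
      Gu τ (U 1) * U' 1 - Gu τ (U 0) * U' 0 :=
    intervalIntegral.integral_eq_sub_of_hasDerivAt_of_le zero_le_one
      (cGu.mul cU').continuousOn hd (i1.add i2)
  rw [intervalIntegral.integral_add i1 i2, h0, h1] at this
  linarith

section Evolution

variable {s q T m : ℝ} {h ωini : ℝ → ℝ} {ω : ℝ → ℝ → ℝ} {G Gt Gu Guu : ℝ → ℝ → ℝ}

/-- The time derivative of `approxU` along a weak solution. -/
noncomputable def approxRate (s q m : ℝ) (h : ℝ → ℝ) (ω : ℝ → ℝ → ℝ) (N : ℕ) (v τ : ℝ) : ℝ :=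
  s * approxUxx m N (cosC (ω τ)) v + m * q * fejerSin N (sinC fun u => h (ω τ u)) v

/-- The Fejér version of ∂_t u = s ∂_v²u + m q h(ω): one factor nπ of each coefficient rate turns
the primitive of the cosine into a sine. -/
theorem approxRate_eq (s q m : ℝ) (h : ℝ → ℝ) (ω : ℝ → ℝ → ℝ) (N : ℕ) (v τ : ℝ) :
    approxRate s q m h ω N v τ = -m * fejerSum N (fun n =>
      coeffRate s q (fun t u => ω t u) (fun t u => h (ω t u)) n τ * sinPrim n v) := by
  have : (fun n => coeffRate s q (fun t u => ω t u) (fun t u => h (ω t u)) n τ * sinPrim n v) =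
      fun n : ℤ => (-s) * (cosC (ω τ) n * (Real.sin (n * Real.pi * v) * (n * Real.pi))) -
        q * (sinC (fun u => h (ω τ u)) n * Real.sin (n * Real.pi * v)) := by
    funext n
    rw [← mul_sinPrim, coeffRate]
    ring
  rw [this, fejerSum_sub, fejerSum_const_mul, fejerSum_const_mul, approxRate, approxUxx, fejerSin]
  ring

theorem bddMeas_approxUxx (hω : BddMeas fun z : ℝ × ℝ => ω z.1 z.2) (N : ℕ) :
    BddMeas fun z : ℝ × ℝ => approxUxx m N (cosC (ω z.1)) z.2 :=
  (BddMeas.fejerSum N fun n => (hω.cosC n).fst.mul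
    ((BddMeas.sin _).snd.mul (BddMeas.const _))).const_mul m

theorem bddMeas_fejerSin_time {H : ℝ → ℝ → ℝ} (hH : BddMeas fun z : ℝ × ℝ => H z.1 z.2) (N : ℕ) :
    BddMeas fun z : ℝ × ℝ => fejerSin N (sinC (H z.1)) z.2 :=
  BddMeas.fejerSum N fun n => (hH.sinC n).fst.mul (BddMeas.sin _).snd

theorem bddMeas_approxRate (hω : BddMeas fun z : ℝ × ℝ => ω z.1 z.2)
    (hH : BddMeas fun z : ℝ × ℝ => h (ω z.1 z.2)) (N : ℕ) :
    BddMeas fun z : ℝ × ℝ => approxRate s q m h ω N z.2 z.1 :=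
  ((bddMeas_approxUxx hω N).const_mul s).add
    ((bddMeas_fejerSin_time (H := fun t u => h (ω t u)) hH N).const_mul (m * q))

theorem measurable_approxU (hω : BddMeas fun z : ℝ × ℝ => ω z.1 z.2) (N : ℕ) :
    Measurable fun z : ℝ × ℝ => approxU m N (cosC (ω z.1)) z.2 := by
  have h1 : Measurable fun z : ℝ × ℝ => fejerSum N (fun n => cosC (ω z.1) n * sinPrim n z.2) :=
    measurable_fejerSum N fun n => ((hω.cosC n).meas.comp measurable_fst).mul
      ((continuous_sinPrim n).measurable.comp measurable_snd)
  exact ((measurable_snd.const_mul 2).sub h1).const_mul m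

theorem approxU_eq_add_integral
    (hω : IsWeakSolutionRobin (Icc 0 1) s q (fun r => r) h T ωini ω)
    (hωb : BddMeas fun z : ℝ × ℝ => ω z.1 z.2) (hH : BddMeas fun z : ℝ × ℝ => h (ω z.1 z.2))
    (N : ℕ) (v : ℝ) {t : ℝ} (ht : t ∈ Icc 0 T) :
    approxU m N (cosC (ω t)) v = approxU m N (cosC ωini) v +
      ∫ τ in (0 : ℝ)..t, approxRate s q m h ω N v τ := by
  have hγ := fun n => bddMeas_coeffRate s q (A := fun t u => ω t u) (H := fun t u => h (ω t u))
    hωb hH n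
  simp only [approxRate_eq]
  rw [intervalIntegral.integral_const_mul, fejerSum_integral N
    (c := fun n τ => coeffRate s q (fun t u => ω t u) (fun t u => h (ω t u)) n τ * sinPrim n v)
    fun n => ((hγ n).mul (BddMeas.const _)).intervalIntegrable _ _]
  simp only [intervalIntegral.integral_mul_const]
  have h1 : ∀ n, ∫ τ in (0 : ℝ)..t, coeffRate s q (fun t u => ω t u) (fun t u => h (ω t u)) n τ =
      cosC (ω t) n - cosC ωini n := fun n => (hω.cosC_sub hωb hH n ht).symm
  simp only [h1, sub_mul, fejerSum_sub, approxU]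
  ring

/-- The weak formulation for the smooth approximation of the change of variables. -/
theorem IsGlobalTest.approx_identity (hG : IsGlobalTest T G Gt Gu Guu)
    (hω : IsWeakSolutionRobin (Icc 0 1) s q (fun r => r) h T ωini ω)
    (hm : Measurable fun z : ℝ × ℝ => ω z.1 z.2) (hK : ∀ t u, ω t u ∈ Icc (0 : ℝ) 1)
    (hH : BddMeas fun z : ℝ × ℝ => h (ω z.1 z.2)) (hm0 : 0 ≤ m)
    (hmass : ∀ t ∈ Icc 0 T, m * (2 - cosC (ω t) 0) = 1) {N : ℕ} (hN : 0 < N) {t : ℝ}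
    (ht : t ∈ Icc 0 T) :
    (∫ v in (0 : ℝ)..1, G t (approxU m N (cosC (ω t)) v)) -
        ∫ v in (0 : ℝ)..1, G 0 (approxU m N (cosC ωini) v) =
      ∫ τ in (0 : ℝ)..t, ((∫ v in (0 : ℝ)..1, Gt τ (approxU m N (cosC (ω τ)) v)) +
        s * ((Gu τ 1 * (m * (2 - fejerCos N (cosC (ω τ)) 1)) -
            Gu τ 0 * (m * (2 - fejerCos N (cosC (ω τ)) 0))) -
          ∫ v in (0 : ℝ)..1, Guu τ (approxU m N (cosC (ω τ)) v) *
            (m * (2 - fejerCos N (cosC (ω τ)) v)) ^ 2) +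
        m * q * ∫ v in (0 : ℝ)..1, Gu τ (approxU m N (cosC (ω τ)) v) *
          fejerSin N (sinC fun u => h (ω τ u)) v) := by
  have hωb := bddMeas_uncurry hm hK
  have hUm : Measurable fun z : ℝ × ℝ => (z.1, approxU m N (cosC (ω z.1)) z.2) :=
    measurable_fst.prodMk (measurable_approxU hωb N)
  have h0T : (0 : ℝ) ∈ Icc 0 T := left_mem_Icc.2 (ht.1.trans ht.2)
  have hini : ∀ v, approxU m N (cosC (ω 0)) v = approxU m N (cosC ωini) v := fun v => by
    rw [approxU_eq_add_integral hω hωb hH N v h0T, intervalIntegral.integral_same, add_zero]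
  have bG : ∀ r, BddMeas fun v => G r (approxU m N (cosC (ω r)) v) := fun r =>
    hG.bdd.comp (measurable_const.prodMk (continuous_approxU m N (cosC (ω r))).measurable)
  have bGt : BddMeas fun z : ℝ × ℝ => Gt z.1 (approxU m N (cosC (ω z.1)) z.2) :=
    hG.bdd_t.comp hUm
  have bGu : BddMeas fun z : ℝ × ℝ => Gu z.1 (approxU m N (cosC (ω z.1)) z.2) :=
    hG.bdd_u.comp hUm
  have bR := bddMeas_approxRate (s := s) (q := q) (m := m) hωb hH N
  have hmem : ∀ r ∈ Icc 0 T, ∀ v ∈ Icc (0 : ℝ) 1, approxU m N (cosC (ω r)) v ∈ Icc (0 : ℝ) 1 :=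
    fun r hr v hv => approxU_mem hm0 (hωb.prodMk_left r) (hK r) (hmass r hr) hN hv
  -- For fixed v the approximation is a primitive in time, so the chain rule along it applies;
  -- Fubini then brings the space integral inside.
  have h1 : (∫ v in (0 : ℝ)..1, G t (approxU m N (cosC (ω t)) v)) -
      ∫ v in (0 : ℝ)..1, G 0 (approxU m N (cosC ωini) v) =
      ∫ v in (0 : ℝ)..1, ∫ τ in (0 : ℝ)..t, (Gt τ (approxU m N (cosC (ω τ)) v) +
        Gu τ (approxU m N (cosC (ω τ)) v) * approxRate s q m h ω N v τ) := by
    simp only [← hini]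
    rw [← intervalIntegral.integral_sub ((bG t).intervalIntegrable _ _)
      ((bG 0).intervalIntegrable _ _)]
    apply intervalIntegral_congr_Icc (hu := right_mem_Icc.2 zero_le_one)
    intro v hv
    refine hG.sub_eq_integral (y := fun r => approxU m N (cosC (ω r)) v)
      (bR.comp (measurable_id.prodMk measurable_const)) (fun r hr => ?_)
      (fun r hr => hmem r hr v hv) ht
    simp only
    rw [hini, approxU_eq_add_integral hω hωb hH N v hr]
    rfl
  rw [h1, BddMeas.integral_swap (F := fun v τ => Gt τ (approxU m N (cosC (ω τ)) v) +
    Gu τ (approxU m N (cosC (ω τ)) v) * approxRate s q m h ω N v τ)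
    ((bGt.add (bGu.mul bR)).comp measurable_swap)]
  refine intervalIntegral.integral_congr fun τ hτ => ?_
  rw [uIcc_of_le ht.1] at hτ
  have hτT : τ ∈ Icc 0 T := ⟨hτ.1, hτ.2.trans ht.2⟩
  have hparts := hG.integral_parts (hasDerivAt_approxU m N (cosC (ω τ)))
    (hasDerivAt_approxUx m N (cosC (ω τ))) (continuous_approxUxx m N (cosC (ω τ))) (hmem τ hτT)
    (approxU_zero m N _) ((approxU_one m hN _).trans (hmass τ hτT)) hτT
  rw [← hparts]
  have b1 : BddMeas fun v => Gt τ (approxU m N (cosC (ω τ)) v) := bGt.prodMk_left τ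
  have b2 : BddMeas fun v => Gu τ (approxU m N (cosC (ω τ)) v) := bGu.prodMk_left τ
  have b3 : BddMeas fun v => approxUxx m N (cosC (ω τ)) v :=
    (bddMeas_approxUxx hωb N).prodMk_left τ
  have b4 : BddMeas fun v => fejerSin N (sinC fun u => h (ω τ u)) v := bddMeas_fejerSin N _
  rw [← intervalIntegral.integral_const_mul, ← intervalIntegral.integral_const_mul,
    ← intervalIntegral.integral_add (b1.intervalIntegrable _ _)
      (((b2.mul b3).const_mul s).intervalIntegrable _ _),
    ← intervalIntegral.integral_add ((b1.add ((b2.mul b3).const_mul s)).intervalIntegrable _ _)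
      (((b2.mul b4).const_mul (m * q)).intervalIntegrable _ _)]
  congr 1
  funext v
  rw [approxRate]
  ring

end Evolution

/-! ### Passage to the limit in the approximation -/

theorem tendsto_integral_of_bounded {A : ℕ → ℝ → ℝ} {A' : ℝ → ℝ} {C : ℝ}
    (hA : ∀ N, Measurable (A N)) (hC : ∀ᶠ N in atTop, ∀ v ∈ Icc (0 : ℝ) 1, |A N v| ≤ C)
    (h : ∀ v ∈ Icc (0 : ℝ) 1, Tendsto (fun N => A N v) atTop (𝓝 (A' v))) {t : ℝ}
    (ht : t ∈ Icc (0 : ℝ) 1) :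
    Tendsto (fun N => ∫ v in (0 : ℝ)..t, A N v) atTop (𝓝 (∫ v in (0 : ℝ)..t, A' v)) := by
  have hsub : ∀ v ∈ uIoc 0 t, v ∈ Icc (0 : ℝ) 1 := fun v hv => by
    rw [uIoc_of_le ht.1] at hv
    exact ⟨hv.1.le, hv.2.trans ht.2⟩
  refine intervalIntegral.tendsto_integral_filter_of_dominated_convergence (fun _ => C)
    (Eventually.of_forall fun N => (hA N).aestronglyMeasurable) ?_
    ((BddMeas.const C).intervalIntegrable _ _)
    (Eventually.of_forall fun v hv => h v (hsub v hv))
  filter_upwards [hC] with N hN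
  exact Eventually.of_forall fun v hv => hN v (hsub v hv)

/-- A bounded, pointwise convergent factor times an L¹ convergent one. It is used with a derivative
of G along the approximate map and a Fejér mean. -/
theorem tendsto_integral_mul {A B : ℕ → ℝ → ℝ} {A' B' : ℝ → ℝ} {C : ℝ}
    (hA : ∀ N, BddMeas (A N)) (hB : ∀ N, BddMeas (B N)) (hB' : BddMeas B')
    (hC : ∀ N, ∀ v, |A N v| ≤ C)
    (h : ∀ v ∈ Icc (0 : ℝ) 1, Tendsto (fun N => A N v) atTop (𝓝 (A' v)))
    (hL : Tendsto (fun N => ∫ v in (0 : ℝ)..1, |B N v - B' v|) atTop (𝓝 0)) :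
    Tendsto (fun N => ∫ v in (0 : ℝ)..1, A N v * B N v) atTop
      (𝓝 (∫ v in (0 : ℝ)..1, A' v * B' v)) := by
  obtain ⟨D, hD⟩ := hB'.bdd
  have hC0 : 0 ≤ C := (abs_nonneg _).trans (hC 0 0)
  have h1 : Tendsto (fun N => ∫ v in (0 : ℝ)..1, A N v * B' v) atTop
      (𝓝 (∫ v in (0 : ℝ)..1, A' v * B' v)) := by
    refine tendsto_integral_of_bounded (C := C * D) (fun N => ((hA N).mul hB').meas)
      (Eventually.of_forall fun N v _ => ?_) (fun v hv => (h v hv).mul_const _)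
      (right_mem_Icc.2 zero_le_one)
    rw [abs_mul]
    exact mul_le_mul (hC N v) (hD v) (abs_nonneg _) hC0
  have h2 : Tendsto (fun N => ∫ v in (0 : ℝ)..1, A N v * (B N v - B' v)) atTop (𝓝 0) := by
    have hL' := hL.const_mul C
    rw [mul_zero] at hL'
    refine squeeze_zero_norm (fun N => ?_) hL'
    have hb := (hB N).sub hB'
    rw [← intervalIntegral.integral_const_mul]
    refine (intervalIntegral.norm_integral_le_of_norm_le zero_le_one
      (Eventually.of_forall fun v _ => ?_) ((hb.abs.const_mul C).intervalIntegrable _ _))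
    rw [norm_mul]
    exact mul_le_mul_of_nonneg_right (hC N v) (abs_nonneg _)
  have h3 := h1.add h2
  rw [add_zero] at h3
  refine h3.congr fun N => ?_
  rw [← intervalIntegral.integral_add (((hA N).mul hB').intervalIntegrable _ _)
    (((hA N).mul ((hB N).sub hB')).intervalIntegrable _ _)]
  congr 1
  funext v
  ring

theorem tendsto_approxU {m : ℝ} (hm : 0 ≤ m) {f : ℝ → ℝ} (hf : BddMeas f) {v : ℝ}
    (hv : v ∈ Icc (0 : ℝ) 1) :
    Tendsto (fun N => approxU m N (cosC f) v) atTop (𝓝 (∫ x in (0 : ℝ)..v, m * (2 - f x))) := by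
  rw [tendsto_iff_norm_sub_tendsto_zero]
  have h := (tendsto_fejerCos_L1 hf).const_mul m
  rw [mul_zero] at h
  exact squeeze_zero (fun _ => norm_nonneg _) (fun N => abs_approxU_sub_le hm hf hv) h

theorem tendsto_integral_comp_approxU {m : ℝ} (hm : 0 ≤ m) {f : ℝ → ℝ} (hf : BddMeas f)
    {F : ℝ → ℝ} (hF : Continuous F) {C : ℝ} (hC : ∀ x, |F x| ≤ C) :
    Tendsto (fun N => ∫ v in (0 : ℝ)..1, F (approxU m N (cosC f) v)) atTop
      (𝓝 (∫ v in (0 : ℝ)..1, F (∫ x in (0 : ℝ)..v, m * (2 - f x)))) :=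
  tendsto_integral_of_bounded (C := C)
    (fun N => (hF.comp (continuous_approxU m N (cosC f))).measurable)
    (Eventually.of_forall fun _ _ _ => hC _)
    (fun _ hv => (hF.tendsto _).comp (tendsto_approxU hm hf hv)) (right_mem_Icc.2 zero_le_one)

theorem tendsto_fejerCos_sq {m : ℝ} {f : ℝ → ℝ} (hf : BddMeas f)
    (hK : ∀ x, f x ∈ Icc (0 : ℝ) 1) :
    Tendsto (fun N => ∫ v in (0 : ℝ)..1,
      |(m * (2 - fejerCos N (cosC f) v)) ^ 2 - (m * (2 - f v)) ^ 2|) atTop (𝓝 0) := by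
  have h := (tendsto_fejerCos_L1 hf).const_mul (4 * m ^ 2)
  rw [mul_zero] at h
  refine squeeze_zero' (Eventually.of_forall fun N =>
    intervalIntegral.integral_nonneg zero_le_one fun _ _ => abs_nonneg _) ?_ h
  filter_upwards [eventually_gt_atTop 0] with N hN
  have hP := bddMeas_fejerCos N (cosC f)
  have h2 := BddMeas.const (α := ℝ) 2
  rw [← intervalIntegral.integral_const_mul]
  refine intervalIntegral.integral_mono_on zero_le_one
    (((((h2.sub hP).const_mul m).pow 2).sub (((h2.sub hf).const_mul m).pow 2)).abs.intervalIntegrable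
      _ _) (((hP.sub hf).abs.const_mul (4 * m ^ 2)).intervalIntegrable _ _) fun v _ => ?_
  set P := fejerCos N (cosC f) v
  have hP1 : P ≤ 1 := fejerCos_le_one hf (fun x => (hK x).2) hN v
  have hP0 : 0 ≤ P := fejerCos_nonneg hf (fun x => (hK x).1) N v
  have hf1 := (hK v).2
  have hf0 := (hK v).1
  -- Since P and f take values in [0,1], the middle factor lies between 0 and 4, whence the constant
  -- 4m².
  have e : (m * (2 - P)) ^ 2 - (m * (2 - f v)) ^ 2 = -(m ^ 2 * (4 - P - f v) * (P - f v)) := by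
    ring
  rw [e, abs_neg, abs_mul, abs_of_nonneg (mul_nonneg (sq_nonneg m) (by linarith))]
  refine mul_le_mul_of_nonneg_right ?_ (abs_nonneg _)
  nlinarith [sq_nonneg m]

section Limit

variable {s q T m : ℝ} {h ωini : ℝ → ℝ} {ω : ℝ → ℝ → ℝ} {G Gt Gu Guu : ℝ → ℝ → ℝ}

/-- The bulk terms of the weak formulation for the approximation. -/
noncomputable def bulkTerm (s q m : ℝ) (Gt Gu Guu : ℝ → ℝ → ℝ) (τ : ℝ) (U P Q : ℝ → ℝ) : ℝ :=
  (∫ v in (0 : ℝ)..1, Gt τ (U v)) - s * (∫ v in (0 : ℝ)..1, Guu τ (U v) * (m * (2 - P v)) ^ 2) +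
    m * q * ∫ v in (0 : ℝ)..1, Gu τ (U v) * Q v

theorem IsGlobalTest.tendsto_bulkTerm (hG : IsGlobalTest T G Gt Gu Guu) (s q : ℝ) (hm0 : 0 ≤ m)
    {f g : ℝ → ℝ} (hf : BddMeas f) (hK : ∀ x, f x ∈ Icc (0 : ℝ) 1) (hg : BddMeas g) (τ : ℝ) :
    Tendsto (fun N => bulkTerm s q m Gt Gu Guu τ (approxU m N (cosC f)) (fejerCos N (cosC f))
      (fejerSin N (sinC g))) atTop
      (𝓝 (bulkTerm s q m Gt Gu Guu τ (fun v => ∫ x in (0 : ℝ)..v, m * (2 - f x)) f g)) := by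
  obtain ⟨C₁, hC₁⟩ := hG.bdd_t.bdd
  obtain ⟨C₂, hC₂⟩ := hG.bdd_u.bdd
  obtain ⟨C₃, hC₃⟩ := hG.bdd_uu.bdd
  have c₁ : Continuous (Gt τ) := hG.cont_t.comp (continuous_const.prodMk continuous_id)
  have c₂ : Continuous (Gu τ) := hG.cont_u.comp (continuous_const.prodMk continuous_id)
  have c₃ : Continuous (Guu τ) := hG.cont_uu.comp (continuous_const.prodMk continuous_id)
  have h2 := BddMeas.const (α := ℝ) 2
  have cU := fun N => continuous_approxU m N (cosC f)
  refine ((tendsto_integral_comp_approxU hm0 hf c₁ fun x => hC₁ (τ, x)).sub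
    (Tendsto.const_mul s ?_)).add (Tendsto.const_mul (m * q) ?_)
  · exact tendsto_integral_mul (A := fun N v => Guu τ (approxU m N (cosC f) v))
      (B := fun N v => (m * (2 - fejerCos N (cosC f) v)) ^ 2)
      (A' := fun v => Guu τ (∫ x in (0 : ℝ)..v, m * (2 - f x))) (B' := fun v => (m * (2 - f v)) ^ 2)
      (fun N => ⟨(c₃.comp (cU N)).measurable, C₃, fun v => hC₃ (τ, _)⟩)
      (fun N => ((h2.sub (bddMeas_fejerCos N _)).const_mul m).pow 2)
      (((h2.sub hf).const_mul m).pow 2) (fun N v => hC₃ (τ, _))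
      (fun v hv => (c₃.tendsto _).comp (tendsto_approxU hm0 hf hv)) (tendsto_fejerCos_sq hf hK)
  · exact tendsto_integral_mul (A := fun N v => Gu τ (approxU m N (cosC f) v))
      (B := fun N v => fejerSin N (sinC g) v)
      (A' := fun v => Gu τ (∫ x in (0 : ℝ)..v, m * (2 - f x))) (B' := g)
      (fun N => ⟨(c₂.comp (cU N)).measurable, C₂, fun v => hC₂ (τ, _)⟩)
      (fun N => bddMeas_fejerSin N _) hg (fun N v => hC₂ (τ, _))
      (fun v hv => (c₂.tendsto _).comp (tendsto_approxU hm0 hf hv)) (tendsto_fejerSin_L1 hg)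

theorem abs_integral_le_of_bdd {f : ℝ → ℝ} {C : ℝ} (h : ∀ v, |f v| ≤ C) :
    |∫ v in (0 : ℝ)..1, f v| ≤ C := by
  simpa using intervalIntegral.norm_integral_le_of_norm_le_const (a := (0 : ℝ)) (b := 1) (f := f)
    fun v _ => h v

/-- A bound uniform in N and τ, for dominated convergence in time. The sine means enter only through
their L¹ norm, which Parseval controls. -/
theorem IsGlobalTest.exists_bulkTerm_bound (hG : IsGlobalTest T G Gt Gu Guu) (s q : ℝ)
    (hm0 : 0 ≤ m) :
    ∃ C, ∀ f : ℝ → ℝ, BddMeas f → (∀ x, f x ∈ Icc (0 : ℝ) 1) → ∀ g : ℝ → ℝ, BddMeas g →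
      (∀ x, |g x| ≤ 1) → ∀ N, 0 < N → ∀ τ, |bulkTerm s q m Gt Gu Guu τ (approxU m N (cosC f))
        (fejerCos N (cosC f)) (fejerSin N (sinC g))| ≤ C := by
  obtain ⟨C₁, hC₁⟩ := hG.bdd_t.bdd
  obtain ⟨C₂, hC₂⟩ := hG.bdd_u.bdd
  obtain ⟨C₃, hC₃⟩ := hG.bdd_uu.bdd
  have hC₂0 : 0 ≤ C₂ := (abs_nonneg _).trans (hC₂ (0, 0))
  have hC₃0 : 0 ≤ C₃ := (abs_nonneg _).trans (hC₃ (0, 0))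
  refine ⟨C₁ + |s| * (C₃ * (m * 2) ^ 2) + |m * q| * C₂, fun f hf hK g hg hg1 N hN τ => ?_⟩
  have c₂ : Continuous (Gu τ) := hG.cont_u.comp (continuous_const.prodMk continuous_id)
  have h1 : |∫ v in (0 : ℝ)..1, Gt τ (approxU m N (cosC f) v)| ≤ C₁ :=
    abs_integral_le_of_bdd fun v => hC₁ (τ, _)
  have h2 : |∫ v in (0 : ℝ)..1, Guu τ (approxU m N (cosC f) v) *
      (m * (2 - fejerCos N (cosC f) v)) ^ 2| ≤ C₃ * (m * 2) ^ 2 := by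
    refine abs_integral_le_of_bdd fun v => ?_
    have hP1 := fejerCos_le_one hf (fun x => (hK x).2) hN v
    have hP0 := fejerCos_nonneg hf (fun x => (hK x).1) N v
    rw [abs_mul, abs_of_nonneg (sq_nonneg (m * _))]
    refine mul_le_mul (hC₃ (τ, _)) (pow_le_pow_left₀ (mul_nonneg hm0 (by linarith)) ?_ 2)
      (sq_nonneg _) hC₃0
    exact mul_le_mul_of_nonneg_left (by linarith) hm0
  have h3 : |∫ v in (0 : ℝ)..1, Gu τ (approxU m N (cosC f) v) * fejerSin N (sinC g) v| ≤ C₂ := by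
    have hQ := bddMeas_fejerSin N (sinC g)
    have h4 := intervalIntegral.norm_integral_le_of_norm_le (a := (0 : ℝ)) (b := 1) (μ := volume)
      (f := fun v => Gu τ (approxU m N (cosC f) v) * fejerSin N (sinC g) v)
      (g := fun v => C₂ * |fejerSin N (sinC g) v|) zero_le_one (Eventually.of_forall fun v _ => by
        rw [norm_mul]
        exact mul_le_mul_of_nonneg_right (hC₂ (τ, _)) (abs_nonneg _))
      ((hQ.abs.const_mul C₂).intervalIntegrable _ _)
    rw [intervalIntegral.integral_const_mul] at h4
    refine h4.trans ?_
    exact mul_le_of_le_one_right hC₂0 (integral_abs_fejerSin_le hg N zero_le_one hg1)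
  rw [bulkTerm]
  refine (abs_add_le _ _).trans (add_le_add ((abs_sub _ _).trans (add_le_add h1 ?_)) ?_)
  · rw [abs_mul]
    exact mul_le_mul_of_nonneg_left h2 (abs_nonneg _)
  · rw [abs_mul]
    exact mul_le_mul_of_nonneg_left h3 (abs_nonneg _)

/-- The weak formulation along the change of variables `v ↦ m ∫₀ᵛ (2 - ω)`. -/
theorem IsGlobalTest.limit_identity (hG : IsGlobalTest T G Gt Gu Guu) (hs : 0 < s)
    (hω : IsWeakSolutionRobin (Icc 0 1) s q (fun r => r) h T ωini ω)
    (hm : Measurable fun z : ℝ × ℝ => ω z.1 z.2) (hK : ∀ t u, ω t u ∈ Icc (0 : ℝ) 1)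
    (hmi : Measurable ωini) (hKi : ∀ u, ωini u ∈ Icc (0 : ℝ) 1)
    (hH : BddMeas fun z : ℝ × ℝ => h (ω z.1 z.2)) (hh1 : ∀ t u, |h (ω t u)| ≤ 1) (hm0 : 0 ≤ m)
    (hmass : ∀ t ∈ Icc 0 T, m * (2 - cosC (ω t) 0) = 1) {t : ℝ} (ht : t ∈ Icc 0 T) :
    (∫ v in (0 : ℝ)..1, G t (∫ x in (0 : ℝ)..v, m * (2 - ω t x))) -
        ∫ v in (0 : ℝ)..1, G 0 (∫ x in (0 : ℝ)..v, m * (2 - ωini x)) =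
      (∫ τ in (0 : ℝ)..t, bulkTerm s q m Gt Gu Guu τ (fun v => ∫ x in (0 : ℝ)..v, m * (2 - ω τ x))
        (ω τ) (fun v => h (ω τ v))) +
      s * m * ∫ τ in (0 : ℝ)..t, (Gu τ 1 * (2 - ω τ 1) - Gu τ 0 * (2 - ω τ 0)) := by
  have hT : 0 ≤ T := ht.1.trans ht.2
  have hωb := bddMeas_uncurry hm hK
  obtain ⟨C₀, hC₀⟩ := hG.bdd.bdd
  obtain ⟨C, hC⟩ := hG.exists_bulkTerm_bound s q hm0
  have c₀ : ∀ r, Continuous (G r) := fun r => hG.cont.comp (continuous_const.prodMk continuous_id)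
  have hL := (tendsto_integral_comp_approxU hm0 (hωb.prodMk_left t) (c₀ t)
    fun x => hC₀ (t, x)).sub (tendsto_integral_comp_approxU hm0 (BddMeas.of_mem_Icc hmi hKi) (c₀ 0)
    fun x => hC₀ (0, x))
  have bU : ∀ N, Measurable fun z : ℝ × ℝ => (z.1, approxU m N (cosC (ω z.1)) z.2) :=
    fun N => measurable_fst.prodMk (measurable_approxU hωb N)
  have bX : ∀ N, BddMeas fun τ => bulkTerm s q m Gt Gu Guu τ (approxU m N (cosC (ω τ)))
      (fejerCos N (cosC (ω τ))) (fejerSin N (sinC fun u => h (ω τ u))) := by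
    intro N
    have b1 : BddMeas fun z : ℝ × ℝ => Gt z.1 (approxU m N (cosC (ω z.1)) z.2) :=
      hG.bdd_t.comp (bU N)
    have b2 : BddMeas fun z : ℝ × ℝ => Gu z.1 (approxU m N (cosC (ω z.1)) z.2) :=
      hG.bdd_u.comp (bU N)
    have b3 : BddMeas fun z : ℝ × ℝ => Guu z.1 (approxU m N (cosC (ω z.1)) z.2) :=
      hG.bdd_uu.comp (bU N)
    have b4 := (((BddMeas.const 2).sub (bddMeas_fejerCos_time hm hK N)).const_mul m).pow 2
    have b5 := bddMeas_fejerSin_time (H := fun t u => h (ω t u)) hH N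
    exact ((BddMeas.integral (f := fun τ v => Gt τ (approxU m N (cosC (ω τ)) v)) b1 0 1).sub
      ((BddMeas.integral (f := fun τ v => Guu τ (approxU m N (cosC (ω τ)) v) *
        (m * (2 - fejerCos N (cosC (ω τ)) v)) ^ 2) (b3.mul b4) 0 1).const_mul s)).add
      ((BddMeas.integral (f := fun τ v => Gu τ (approxU m N (cosC (ω τ)) v) *
        fejerSin N (sinC fun u => h (ω τ u)) v) (b2.mul b5) 0 1).const_mul (m * q))
  have hX : Tendsto (fun N => ∫ τ in (0 : ℝ)..t, bulkTerm s q m Gt Gu Guu τ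
      (approxU m N (cosC (ω τ))) (fejerCos N (cosC (ω τ))) (fejerSin N (sinC fun u => h (ω τ u))))
      atTop (𝓝 (∫ τ in (0 : ℝ)..t, bulkTerm s q m Gt Gu Guu τ
        (fun v => ∫ x in (0 : ℝ)..v, m * (2 - ω τ x)) (ω τ) (fun v => h (ω τ v)))) := by
    refine intervalIntegral.tendsto_integral_filter_of_dominated_convergence (fun _ => C)
      (Eventually.of_forall fun N => (bX N).meas.aestronglyMeasurable) ?_
      ((BddMeas.const C).intervalIntegrable _ _) (Eventually.of_forall fun τ _ =>
        hG.tendsto_bulkTerm s q hm0 (hωb.prodMk_left τ) (hK τ) (hH.prodMk_left τ) τ)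
    filter_upwards [eventually_gt_atTop 0] with N hN
    exact Eventually.of_forall fun τ _ => hC _ (hωb.prodMk_left τ) (hK τ) _ (hH.prodMk_left τ)
      (hh1 τ) N hN τ
  have cGu : ∀ b, Continuous fun τ => Gu τ b := fun b =>
    hG.cont_u.comp (continuous_id.prodMk continuous_const)
  have bGu : ∀ b, BddMeas fun τ => Gu τ b := fun b =>
    hG.bdd_u.comp (measurable_id.prodMk measurable_const)
  have bω : ∀ b, BddMeas fun τ => ω τ b := fun b =>
    hωb.comp (measurable_id.prodMk measurable_const)
  have bP : ∀ N b, BddMeas fun τ => fejerCos N (cosC (ω τ)) b := fun N b =>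
    bddMeas_fejerCos_left hm hK N b
  have h2 := BddMeas.const (α := ℝ) 2
  -- The boundary terms are written as those with the true values of ω plus the differences that
  -- `tendsto_boundary` sends to zero.
  have hB : Tendsto (fun N => s * m * ((∫ τ in (0 : ℝ)..t, (Gu τ 1 * (2 - ω τ 1) -
      Gu τ 0 * (2 - ω τ 0))) - ((∫ τ in (0 : ℝ)..t, Gu τ 1 * (fejerCos N (cosC (ω τ)) 1 - ω τ 1)) -
      ∫ τ in (0 : ℝ)..t, Gu τ 0 * (fejerCos N (cosC (ω τ)) 0 - ω τ 0)))) atTop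
      (𝓝 (s * m * ((∫ τ in (0 : ℝ)..t, (Gu τ 1 * (2 - ω τ 1) - Gu τ 0 * (2 - ω τ 0))) -
        (0 - 0)))) :=
    ((((tendsto_boundary hT hs hω hm hK hKi hh1 (Or.inr rfl) (cGu 1) ht).sub
      (tendsto_boundary hT hs hω hm hK hKi hh1 (Or.inl rfl) (cGu 0) ht)).const_sub _).const_mul _)
  have hR := hX.add hB
  rw [sub_zero, sub_zero] at hR
  refine tendsto_nhds_unique_of_eventuallyEq hL hR ?_
  filter_upwards [eventually_gt_atTop 0] with N hN
  have hi : ∀ b, IntervalIntegrable (fun τ => Gu τ b * (fejerCos N (cosC (ω τ)) b - ω τ b))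
      volume 0 t := fun b => ((bGu b).mul ((bP N b).sub (bω b))).intervalIntegrable _ _
  have hi2 : IntervalIntegrable (fun τ => Gu τ 1 * (2 - ω τ 1) - Gu τ 0 * (2 - ω τ 0))
      volume 0 t := (((bGu 1).mul (h2.sub (bω 1))).sub
        ((bGu 0).mul (h2.sub (bω 0)))).intervalIntegrable _ _
  rw [hG.approx_identity hω hm hK hH hm0 hmass hN ht, ← intervalIntegral.integral_sub (hi 1) (hi 0),
    ← intervalIntegral.integral_sub hi2 ((hi 1).sub (hi 0)), ← intervalIntegral.integral_const_mul,
    ← intervalIntegral.integral_add ((bX N).intervalIntegrable _ _)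
      ((hi2.sub ((hi 1).sub (hi 0))).const_mul _)]
  congr 1
  funext τ
  rw [bulkTerm]
  ring

end Limit

/-! ### Transformation of weak solutions -/

theorem two_sub_ne_zero {w : ℝ} (hw : w ∈ Icc (0 : ℝ) 1) : 2 - w ≠ 0 := by linarith [hw.2]

theorem frakH_one_div {w : ℝ} (hw : 2 - w ≠ 0) : frakH (1 / (2 - w)) * (2 - w) = currentJ w := by
  rw [frakH, currentJ]
  field_simp
  ring

theorem PhiInv_iso {w : ℝ → ℝ} (hm : Measurable w) (hK : ∀ x, w x ∈ Icc (0 : ℝ) 1) {v : ℝ}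
    (hv : v ∈ Icc (0 : ℝ) 1) : PhiInv w ((isDensity_two_sub hm hK).iso v) = 1 / (2 - w v) := by
  rw [PhiInv_eq hm hK (fun _ _ => rfl) (IsDensity.iso_mem _ hv), OrderIso.symm_apply_apply]

theorem PhiInv_zero {w : ℝ → ℝ} (hm : Measurable w) (hK : ∀ x, w x ∈ Icc (0 : ℝ) 1) :
    PhiInv w 0 = 1 / (2 - w 0) := by
  have := PhiInv_iso hm hK (left_mem_Icc.2 zero_le_one)
  rwa [IsDensity.iso_zero] at this

theorem PhiInv_one {w : ℝ → ℝ} (hm : Measurable w) (hK : ∀ x, w x ∈ Icc (0 : ℝ) 1) :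
    PhiInv w 1 = 1 / (2 - w 1) := by
  have := PhiInv_iso hm hK (right_mem_Icc.2 zero_le_one)
  rwa [IsDensity.iso_one] at this

/-- The substitution u = m ∫₀ᵛ (2 - w), with Jacobian m(2 - w). -/
theorem integral_comp_PhiInv {w : ℝ → ℝ} (hm : Measurable w) (hK : ∀ x, w x ∈ Icc (0 : ℝ) 1)
    {m : ℝ} (hw : m * ∫ v in (0 : ℝ)..1, (2 - w v) = 1) (F : ℝ → ℝ → ℝ) :
    ∫ u in (0 : ℝ)..1, F (PhiInv w u) u = ∫ v in (0 : ℝ)..1,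
      F (1 / (2 - w v)) (∫ x in (0 : ℝ)..v, m * (2 - w x)) * (m * (2 - w v)) := by
  obtain rfl : 1 / ∫ v in (0 : ℝ)..1, (2 - w v) = m := (eq_one_div_of_mul_eq_one_left hw).symm
  rw [(isDensity_two_sub hm hK).integral_comp_zero_one]
  apply intervalIntegral_congr_Icc (hu := right_mem_Icc.2 zero_le_one)
  intro v hv
  simp only
  rw [PhiInv_iso hm hK hv, IsDensity.iso_apply]

/-- Rescaling to the fixed interval [0,1] makes this an integral depending on a parameter. -/
theorem measurable_primitive {f : ℝ → ℝ → ℝ} (hf : BddMeas fun z : ℝ × ℝ => f z.1 z.2) :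
    Measurable fun z : ℝ × ℝ => ∫ x in (0 : ℝ)..z.2, f z.1 x := by
  have h1 : BddMeas fun y : (ℝ × ℝ) × ℝ => f y.1.1 (y.1.2 * y.2) :=
    hf.comp (φ := fun y : (ℝ × ℝ) × ℝ => (y.1.1, y.1.2 * y.2)) (by fun_prop)
  have h2 := BddMeas.integral (f := fun (z : ℝ × ℝ) x => f z.1 (z.2 * x)) h1 0 1
  have e : (fun z : ℝ × ℝ => ∫ x in (0 : ℝ)..z.2, f z.1 x) =
      fun z => z.2 * ∫ x in (0 : ℝ)..1, f z.1 (z.2 * x) := by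
    funext z
    rw [intervalIntegral.mul_integral_comp_mul_left, mul_zero, mul_one]
  rw [e]
  exact measurable_snd.mul h2.meas

theorem measurable_PhiInv {ω : ℝ → ℝ → ℝ} (hm : Measurable fun z : ℝ × ℝ => ω z.1 z.2)
    (hK : ∀ t u, ω t u ∈ Icc (0 : ℝ) 1) (T : ℝ) :
    Measurable fun z : Icc (0 : ℝ) T × Icc (0 : ℝ) 1 => PhiInv (ω z.1) z.2 := by
  have hωb := bddMeas_uncurry hm hK
  have hmt : ∀ t, Measurable (ω t) := fun t => hm.comp measurable_prodMk_left
  have h2 := BddMeas.const (α := ℝ × ℝ) 2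
  have hS : Measurable fun z : Icc (0 : ℝ) T × Icc (0 : ℝ) 1 =>
      (isDensity_two_sub (hmt z.1) (hK z.1)).iso.symm z.2 := by
    -- The inverse map is at most c exactly when its argument is at most the direct map at c, and
    -- the direct map at a fixed point is measurable in time.
    refine measurable_of_Iic fun c => ?_
    have e : (fun z : Icc (0 : ℝ) T × Icc (0 : ℝ) 1 =>
        (isDensity_two_sub (hmt z.1) (hK z.1)).iso.symm z.2) ⁻¹' Iic c =
        {z | (z.2 : ℝ) ≤ (1 / ∫ v in (0 : ℝ)..1, (2 - ω z.1 v)) *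
          ∫ v in (0 : ℝ)..c, (2 - ω z.1 v)} := by
      ext z
      rw [mem_preimage, mem_Iic, mem_ofPred_eq, OrderIso.symm_apply_le, IsDensity.iso_apply,
        intervalIntegral.integral_const_mul]
    have h3 : ∀ c, Measurable fun t => ∫ v in (0 : ℝ)..c, (2 - ω t v) := fun c =>
      (BddMeas.integral (f := fun t v => 2 - ω t v) (h2.sub hωb) 0 c).meas
    rw [e]
    refine measurableSet_le (measurable_subtype_coe.comp measurable_snd) ?_
    have h4 : Measurable fun t => (1 / ∫ v in (0 : ℝ)..1, (2 - ω t v)) *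
        ∫ v in (0 : ℝ)..c, (2 - ω t v) := ((h3 1).const_div 1).mul (h3 c)
    exact h4.comp (measurable_subtype_coe.comp measurable_fst)
  have e : (fun z : Icc (0 : ℝ) T × Icc (0 : ℝ) 1 => PhiInv (ω z.1) z.2) = fun z =>
      1 / (2 - ω z.1 ((isDensity_two_sub (hmt z.1) (hK z.1)).iso.symm z.2)) :=
    funext fun z => PhiInv_eq (hmt z.1) (hK z.1) (fun _ _ => rfl) z.2.2
  rw [e]
  exact ((hm.comp ((measurable_subtype_coe.comp measurable_fst).prodMk hS)).const_sub 2).const_div 1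

theorem abs_currentJ_le_one {x : ℝ} (hx : x ∈ Icc (0 : ℝ) 1) : |currentJ x| ≤ 1 := by
  rw [currentJ, abs_of_nonneg (mul_nonneg hx.1 (by linarith [hx.2]))]
  nlinarith [hx.1, hx.2]

theorem measurable_currentJ : Measurable currentJ := measurable_id.mul (measurable_id.const_sub 1)

theorem measurable_frakA : Measurable frakA :=
  ((measurable_id.const_mul 2).sub_const 1).div measurable_id

theorem measurable_frakH : Measurable frakH :=
  ((measurable_id.const_sub 1).mul ((measurable_id.const_mul 2).sub_const 1)).div measurable_id

theorem cosC_zero {f : ℝ → ℝ} : cosC f 0 = ∫ x in (0 : ℝ)..1, f x := by simp [cosC]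

theorem integral_two_sub {f : ℝ → ℝ} (hf : BddMeas f) :
    ∫ x in (0 : ℝ)..1, (2 - f x) = 2 - cosC f 0 := by
  rw [intervalIntegral.integral_sub ((BddMeas.const 2).intervalIntegrable _ _)
    (hf.intervalIntegrable _ _), cosC_zero]
  simp

/-- The map `Φ⁻¹` transforms weak solutions of the viscous Burgers equation into weak solutions of
the convection-diffusion equation, for initial data `Φ⁻¹(ωini)`. -/
theorem IsWeakSolutionRobin.phiInv {s q m T : ℝ} {ωini : ℝ → ℝ} {ω : ℝ → ℝ → ℝ} (hs : 0 < s)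
    (hm0 : 0 ≤ m) (hT : 0 ≤ T)
    (hω : IsWeakSolutionRobin (Icc 0 1) s q (fun r => r) currentJ T ωini ω)
    (hm : Measurable fun z : ℝ × ℝ => ω z.1 z.2) (hK : ∀ t u, ω t u ∈ Icc (0 : ℝ) 1)
    (hmi : Measurable ωini) (hKi : ∀ u, ωini u ∈ Icc (0 : ℝ) 1)
    (hmass : m * ∫ v in (0 : ℝ)..1, (2 - ωini v) = 1) :
    IsWeakSolutionRobin (Icc (1 / 2) 1) (s * m ^ 2) (m * q) frakA frakH T (PhiInv ωini)
      fun t => PhiInv (ω t) := by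
  have hωb := bddMeas_uncurry hm hK
  have hmt : ∀ t, Measurable (ω t) := fun t => hm.comp measurable_prodMk_left
  have hJ : BddMeas fun z : ℝ × ℝ => currentJ (ω z.1 z.2) :=
    ⟨measurable_currentJ.comp hm, 1, fun z => abs_currentJ_le_one (hK z.1 z.2)⟩
  -- Conservation of mass is the mode n = 0, whose rate vanishes. Hence the same m normalizes the
  -- change of variables at all times.
  have hcos : ∀ t ∈ Icc 0 T, m * (2 - cosC (ω t) 0) = 1 := fun t ht => by
    have := hω.cosC_sub hωb hJ 0 ht
    simp only [coeffRate, Int.cast_zero, zero_mul, mul_zero, ne_eq, OfNat.ofNat_ne_zero,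
      not_false_eq_true, zero_pow, sub_zero, intervalIntegral.integral_zero] at this
    rw [sub_eq_zero.1 this, ← integral_two_sub (BddMeas.of_mem_Icc hmi hKi), hmass]
  have hmassω : ∀ t ∈ Icc 0 T, m * ∫ v in (0 : ℝ)..1, (2 - ω t v) = 1 := fun t ht => by
    rw [integral_two_sub (hωb.prodMk_left t), hcos t ht]
  refine ⟨measurable_PhiInv hm hK T, fun t _ u hu => ?_, fun G Gt Gu Guu hG t ht => ?_⟩
  · rw [PhiInv_eq (hmt t) (hK t) (fun _ _ => rfl) hu]
    exact one_div_two_sub_mem (hK _ _)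
  have h01 : (1 : ℝ) ∈ Icc (0 : ℝ) 1 := right_mem_Icc.2 zero_le_one
  have h00 : (0 : ℝ) ∈ Icc (0 : ℝ) 1 := left_mem_Icc.2 zero_le_one
  have hX := hG.rectExtend hT
  have hRE : ∀ (F : ℝ → ℝ → ℝ), ∀ r ∈ Icc 0 T, ∀ u ∈ Icc (0 : ℝ) 1, F r u = rectExtend hT F r u :=
    fun F r hr u hu => (rectExtend_eq hT hr hu).symm
  set X := rectExtend hT G
  set Xt := rectExtend hT Gt
  set Xu := rectExtend hT Gu
  set Xuu := rectExtend hT Guu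
  set U : ℝ → ℝ → ℝ := fun r v => ∫ x in (0 : ℝ)..v, m * (2 - ω r x)
  have h2 := BddMeas.const (α := ℝ × ℝ) 2
  have bg : BddMeas fun z : ℝ × ℝ => m * (2 - ω z.1 z.2) := (h2.sub hωb).const_mul m
  have hUm : Measurable fun z : ℝ × ℝ => (z.1, U z.1 z.2) :=
    measurable_fst.prodMk (measurable_primitive (f := fun r x => m * (2 - ω r x)) bg)
  have e0 : ∀ w : ℝ → ℝ, Measurable w → (∀ x, w x ∈ Icc (0 : ℝ) 1) →
      m * (∫ v in (0 : ℝ)..1, (2 - w v)) = 1 → ∀ F : ℝ → ℝ,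
      ∫ u in (0 : ℝ)..1, PhiInv w u * F u =
        m * ∫ v in (0 : ℝ)..1, F (∫ x in (0 : ℝ)..v, m * (2 - w x)) := by
    intro w hw hwK hwm F
    rw [integral_comp_PhiInv hw hwK hwm fun r u => r * F u, ← intervalIntegral.integral_const_mul]
    congr 1
    funext v
    have := two_sub_ne_zero (hwK v)
    field_simp
  have eA : ∀ r ∈ Icc 0 T, ∀ F : ℝ → ℝ, ∫ u in (0 : ℝ)..1, frakA (PhiInv (ω r) u) * F u =
      ∫ v in (0 : ℝ)..1, F (U r v) * (ω r v * (m * (2 - ω r v))) := by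
    intro r hr F
    rw [integral_comp_PhiInv (hmt r) (hK r) (hmassω r hr) fun r u => frakA r * F u]
    congr 1
    funext v
    rw [frakA_one_div (two_sub_ne_zero (hK r v))]
    ring
  have eH : ∀ r ∈ Icc 0 T, ∀ F : ℝ → ℝ, ∫ u in (0 : ℝ)..1, frakH (PhiInv (ω r) u) * F u =
      m * ∫ v in (0 : ℝ)..1, F (U r v) * currentJ (ω r v) := by
    intro r hr F
    rw [integral_comp_PhiInv (hmt r) (hK r) (hmassω r hr) fun r u => frakH r * F u,
      ← intervalIntegral.integral_const_mul]
    congr 1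
    funext v
    rw [← frakH_one_div (two_sub_ne_zero (hK r v))]
    ring
  -- The fundamental theorem of calculus in u, read in the variable v.
  have eD : ∀ r ∈ Icc 0 T, Xu r 1 - Xu r 0 = ∫ v in (0 : ℝ)..1, Xuu r (U r v) * (m * (2 - ω r v)) := by
    intro r hr
    rw [← integral_comp_PhiInv (hmt r) (hK r) (hmassω r hr) fun _ u => Xuu r u]
    have c₃ : Continuous (Xuu r) := hX.cont_uu.comp (continuous_const.prodMk continuous_id)
    have c₂ : Continuous (Xu r) := hX.cont_u.comp (continuous_const.prodMk continuous_id)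
    refine (intervalIntegral.integral_eq_sub_of_hasDerivAt_of_le zero_le_one c₂.continuousOn
      (fun u hu => ?_) (c₃.intervalIntegrable _ _)).symm
    exact (hX.test.deriv_uu r hr u (Ioo_subset_Icc_self hu)).hasDerivAt (Icc_mem_nhds hu.1 hu.2)
  have bT : BddMeas fun r => ∫ v in (0 : ℝ)..1, Xt r (U r v) :=
    BddMeas.integral (f := fun r v => Xt r (U r v)) (hX.bdd_t.comp hUm) 0 1
  have bUU : BddMeas fun z : ℝ × ℝ => Xuu z.1 (U z.1 z.2) := hX.bdd_uu.comp hUm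
  have bA : BddMeas fun r => ∫ v in (0 : ℝ)..1, Xuu r (U r v) * (ω r v * (m * (2 - ω r v))) :=
    BddMeas.integral (f := fun r v => Xuu r (U r v) * (ω r v * (m * (2 - ω r v))))
      (bUU.mul (hωb.mul bg)) 0 1
  have bH : BddMeas fun r => ∫ v in (0 : ℝ)..1, Xu r (U r v) * currentJ (ω r v) :=
    BddMeas.integral (f := fun r v => Xu r (U r v) * currentJ (ω r v))
      ((hX.bdd_u.comp hUm).mul hJ) 0 1
  have bS : BddMeas fun r => ∫ v in (0 : ℝ)..1, Xuu r (U r v) * (m * (2 - ω r v)) ^ 2 :=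
    BddMeas.integral (f := fun r v => Xuu r (U r v) * (m * (2 - ω r v)) ^ 2)
      (bUU.mul (bg.pow 2)) 0 1
  have bω : ∀ b, BddMeas fun r => ω r b := fun b => hωb.comp (measurable_id.prodMk measurable_const)
  have bX : ∀ b, BddMeas fun r => Xu r b := fun b =>
    hX.bdd_u.comp (measurable_id.prodMk measurable_const)
  have bC := BddMeas.const (α := ℝ) 2
  have bB := ((bω 1).mul (bX 1)).sub ((bω 0).mul (bX 0))
  have bE := ((bX 1).mul (bC.sub (bω 1))).sub ((bX 0).mul (bC.sub (bω 0)))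
  have bK : BddMeas fun r => bulkTerm s q m Xt Xu Xuu r (U r) (ω r) fun v => currentJ (ω r v) :=
    (bT.sub (bS.const_mul s)).add (bH.const_mul (m * q))
  have hsub : ∀ r ∈ uIcc 0 t, r ∈ Icc 0 T := fun r hr => by
    rw [uIcc_of_le ht.1] at hr
    exact ⟨hr.1, hr.2.trans ht.2⟩
  have i1 : ∫ u in (0 : ℝ)..1, PhiInv (ω t) u * G t u = m * ∫ v in (0 : ℝ)..1, X t (U t v) := by
    rw [← e0 (ω t) (hmt t) (hK t) (hmassω t ht)]
    exact intervalIntegral_congr_Icc (fun u hu => by simp only [hRE G t ht u hu, X]) h01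
  have i2 : ∫ u in (0 : ℝ)..1, PhiInv ωini u * G 0 u =
      m * ∫ v in (0 : ℝ)..1, X 0 (∫ x in (0 : ℝ)..v, m * (2 - ωini x)) := by
    rw [← e0 ωini hmi hKi hmass]
    exact intervalIntegral_congr_Icc
      (fun u hu => by simp only [hRE G 0 (left_mem_Icc.2 hT) u hu, X]) h01
  have i3 : ∫ r in (0 : ℝ)..t, ∫ u in (0 : ℝ)..1, PhiInv (ω r) u * Gt r u =
      ∫ r in (0 : ℝ)..t, m * ∫ v in (0 : ℝ)..1, Xt r (U r v) := by
    refine intervalIntegral.integral_congr fun r hr => ?_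
    rw [← e0 (ω r) (hmt r) (hK r) (hmassω r (hsub r hr))]
    exact intervalIntegral_congr_Icc (fun u hu => by simp only [hRE Gt r (hsub r hr) u hu, Xt]) h01
  have i4 : ∫ r in (0 : ℝ)..t, ∫ u in (0 : ℝ)..1, frakA (PhiInv (ω r) u) * Guu r u =
      ∫ r in (0 : ℝ)..t, ∫ v in (0 : ℝ)..1, Xuu r (U r v) * (ω r v * (m * (2 - ω r v))) := by
    refine intervalIntegral.integral_congr fun r hr => ?_
    rw [← eA r (hsub r hr)]
    exact intervalIntegral_congr_Icc (fun u hu => by simp only [hRE Guu r (hsub r hr) u hu, Xuu]) h01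
  have i5 : ∫ r in (0 : ℝ)..t, ∫ u in (0 : ℝ)..1, frakH (PhiInv (ω r) u) * Gu r u =
      ∫ r in (0 : ℝ)..t, m * ∫ v in (0 : ℝ)..1, Xu r (U r v) * currentJ (ω r v) := by
    refine intervalIntegral.integral_congr fun r hr => ?_
    rw [← eH r (hsub r hr)]
    exact intervalIntegral_congr_Icc (fun u hu => by simp only [hRE Gu r (hsub r hr) u hu, Xu]) h01
  have i6 : ∫ r in (0 : ℝ)..t, (frakA (PhiInv (ω r) 1) * Gu r 1 - frakA (PhiInv (ω r) 0) * Gu r 0) =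
      ∫ r in (0 : ℝ)..t, (ω r 1 * Xu r 1 - ω r 0 * Xu r 0) := by
    refine intervalIntegral.integral_congr fun r hr => ?_
    rw [PhiInv_one (hmt r) (hK r), PhiInv_zero (hmt r) (hK r),
      frakA_one_div (two_sub_ne_zero (hK r 1)), frakA_one_div (two_sub_ne_zero (hK r 0)),
      hRE Gu r (hsub r hr) 1 h01, hRE Gu r (hsub r hr) 0 h00]
  have hL := hX.limit_identity hs hω hm hK hmi hKi hJ (fun r u => abs_currentJ_le_one (hK r u)) hm0
    hcos ht
  have key : ∀ r ∈ uIcc 0 t,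
      m * bulkTerm s q m Xt Xu Xuu r (U r) (ω r) (fun v => currentJ (ω r v)) +
        s * m ^ 2 * (Xu r 1 * (2 - ω r 1) - Xu r 0 * (2 - ω r 0)) =
      m * (∫ v in (0 : ℝ)..1, Xt r (U r v)) +
        s * m ^ 2 * (∫ v in (0 : ℝ)..1, Xuu r (U r v) * (ω r v * (m * (2 - ω r v)))) +
        m * q * (m * ∫ v in (0 : ℝ)..1, Xu r (U r v) * currentJ (ω r v)) -
        s * m ^ 2 * (ω r 1 * Xu r 1 - ω r 0 * Xu r 0) := by
    intro r hr
    -- From (2 - ω)² = 2(2 - ω) - ω(2 - ω). The first part integrates to boundary values of ∂ᵤG,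
    -- which cancel the constant 2 in the boundary term of the limit identity; the second is the
    -- diffusion term with 𝔞(ρ) = ω.
    have h5 : m * ∫ v in (0 : ℝ)..1, Xuu r (U r v) * (m * (2 - ω r v)) ^ 2 =
        m ^ 2 * (2 * (Xu r 1 - Xu r 0) -
          ∫ v in (0 : ℝ)..1, Xuu r (U r v) * (ω r v * (m * (2 - ω r v)))) := by
      have j1 := (bUU.prodMk_left r).mul (bg.prodMk_left r)
      have j2 := (bUU.prodMk_left r).mul ((hωb.mul bg).prodMk_left r)
      rw [eD r (hsub r hr), ← intervalIntegral.integral_const_mul,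
        ← intervalIntegral.integral_const_mul,
        ← intervalIntegral.integral_sub ((j1.const_mul 2).intervalIntegrable _ _)
          (j2.intervalIntegrable _ _), ← intervalIntegral.integral_const_mul]
      congr 1
      funext v
      ring
    rw [bulkTerm]
    linear_combination (-s) * h5
  have hint : ∫ r in (0 : ℝ)..t,
      (m * bulkTerm s q m Xt Xu Xuu r (U r) (ω r) (fun v => currentJ (ω r v)) +
        s * m ^ 2 * (Xu r 1 * (2 - ω r 1) - Xu r 0 * (2 - ω r 0))) = _ :=
    intervalIntegral.integral_congr key
  have ii : ∀ {f : ℝ → ℝ}, BddMeas f → IntervalIntegrable f volume 0 t :=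
    fun hf => hf.intervalIntegrable _ _
  rw [intervalIntegral.integral_add (ii (bK.const_mul m)) (ii (bE.const_mul _)),
    intervalIntegral.integral_sub (ii (((bT.const_mul m).add (bA.const_mul _)).add
      ((bH.const_mul m).const_mul _))) (ii (bB.const_mul _)),
    intervalIntegral.integral_add (ii ((bT.const_mul m).add (bA.const_mul _)))
      (ii ((bH.const_mul m).const_mul _)),
    intervalIntegral.integral_add (ii (bT.const_mul m)) (ii (bA.const_mul _))] at hint
  rw [intervalIntegral.integral_const_mul (s * m ^ 2), intervalIntegral.integral_const_mul (s * m ^ 2),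
    intervalIntegral.integral_const_mul (s * m ^ 2), intervalIntegral.integral_const_mul (m * q),
    intervalIntegral.integral_const_mul m (fun r => bulkTerm _ _ _ _ _ _ _ _ _ _)] at hint
  rw [i1, i2, i3, i4, i5, i6]
  linear_combination m * hL + hint

/-! ### Uniqueness -/

theorem isUniqueIn_burgers {s q T : ℝ} {ωini : ℝ → ℝ} {ω : ℝ → ℝ → ℝ} (hT : 0 ≤ T) (hs : 0 < s)
    (hω : IsWeakSolutionRobin (Icc 0 1) s q (fun r => r) currentJ T ωini ω) :
    IsUniqueIn T (IsWeakSolutionRobin (Icc 0 1) s q (fun r => r) currentJ T ωini) ω := by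
  refine ⟨hω, fun ω' hω' => hω'.ae_eq (κ := 1) (L := 1) (B := 1) hT hs one_pos measurable_id'
    measurable_currentJ (fun x => abs_le_one_of_mem) (fun x => abs_le_one_of_mem)
    (fun x => abs_currentJ_le_one) (fun x _ y _ => le_of_eq (by ring)) (fun x hx y hy => ?_) hω⟩
  -- The first factor lies in [-1, 1], so J has Lipschitz constant 1.
  have e : currentJ x - currentJ y = (1 - x - y) * (x - y) := by
    rw [currentJ, currentJ]
    ring
  rw [e, abs_mul]
  refine mul_le_mul_of_nonneg_right (abs_le.2 ⟨?_, ?_⟩) (abs_nonneg _) <;>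
    linarith [hx.1, hx.2, hy.1, hy.2]

theorem frakH_mem {r : ℝ} (hr : r ∈ Icc (1 / 2 : ℝ) 1) : frakH r ∈ Icc (0 : ℝ) 1 := by
  have hA := frakA_mem hr
  have e : frakH r = (1 - r) * frakA r := by rw [frakH, frakA, mul_div_assoc]
  rw [e]
  exact ⟨mul_nonneg (by linarith [hr.2]) hA.1,
    mul_le_one₀ (by linarith [hr.1]) hA.1 hA.2⟩

/-- Both constants come from 1/4 ≤ xy ≤ 1 on [1/2, 1]: the slope of 𝔞 between x and y is 1/(xy) ≥ 1,
and that of 𝔥 is 1/(xy) - 2, which lies in [-1, 2]. -/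
theorem isUniqueIn_convectionDiffusion {σ p T : ℝ} {ρini : ℝ → ℝ} {ρ : ℝ → ℝ → ℝ} (hT : 0 ≤ T)
    (hσ : 0 < σ) (hρ : IsWeakSolutionRobin (Icc (1 / 2) 1) σ p frakA frakH T ρini ρ) :
    IsUniqueIn T (IsWeakSolutionRobin (Icc (1 / 2) 1) σ p frakA frakH T ρini) ρ := by
  refine ⟨hρ, fun ρ' hρ' => hρ'.ae_eq (κ := 1) (L := 2) (B := 1) hT hσ one_pos measurable_frakA
    measurable_frakH (fun x hx => abs_le_one_of_mem ⟨by linarith [hx.1], hx.2⟩)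
    (fun x hx => abs_le_one_of_mem (frakA_mem hx)) (fun x hx => abs_le_one_of_mem (frakH_mem hx))
    (fun x hx y hy => ?_) (fun x hx y hy => ?_) hρ⟩
  all_goals
    have hx0 : 0 < x := by linarith [hx.1]
    have hy0 : 0 < y := by linarith [hy.1]
    have hxy0 : 0 < x * y := mul_pos hx0 hy0
    have hxy1 : x * y ≤ 1 := mul_le_one₀ hx.2 hy0.le hy.2
  · have e : (x - y) * (frakA x - frakA y) = (x - y) ^ 2 / (x * y) := by
      rw [frakA, frakA]
      field_simp
      ring
    rw [e, one_mul, le_div_iff₀ hxy0]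
    exact mul_le_of_le_one_right (sq_nonneg _) hxy1
  · have hxy4 : 1 / 4 ≤ x * y := by nlinarith [hx.1, hy.1]
    have e : frakH x - frakH y = (1 / (x * y) - 2) * (x - y) := by
      rw [frakH, frakH]
      field_simp
      ring
    rw [e, abs_mul]
    refine mul_le_mul_of_nonneg_right (abs_le.2 ⟨?_, ?_⟩) (abs_nonneg _)
    · linarith [one_div_pos.2 hxy0]
    · rw [sub_le_iff_le_add, div_le_iff₀ hxy0]
      linarith

theorem isWeakSolutionNeumann_iff {K : Set ℝ} {σ T : ℝ} {a ρini : ℝ → ℝ} (h : ℝ → ℝ)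
    {ρ : ℝ → ℝ → ℝ} :
    IsWeakSolutionNeumann K σ a T ρini ρ ↔ IsWeakSolutionRobin K σ 0 a h T ρini ρ := by
  constructor <;> refine fun H => ⟨H.measurable, H.mem, fun G Gt Gu Guu hG t ht => ?_⟩ <;>
    simpa only [zero_mul, add_zero] using H.weak G Gt Gu Guu hG t ht

theorem isUniqueIn_phiInv {σ p T : ℝ} (hσ : 0 < σ) (hT : 0 ≤ T) {ρini : ℝ → ℝ}
    (hρini : IsProfile (Icc (1 / 2) 1) ρini) {ω : ℝ → ℝ → ℝ}
    (hω : IsWeakSolutionRobin (Icc 0 1) (σ / totalMass ρini ^ 2) (p / totalMass ρini)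
      (fun r => r) currentJ T (Phi ρini) ω) :
    IsUniqueIn T (IsWeakSolutionRobin (Icc (1 / 2) 1) σ p frakA frakH T ρini)
      (fun t => PhiInv (ω t)) := by
  have hm0 : 0 < totalMass ρini := by linarith [(totalMass_mem hρini).1]
  obtain ⟨ω', hm, hK, he⟩ := hω.exists_extension hT
  obtain ⟨w, hmw, hKw, hew⟩ := exists_extension (isProfile_Phi hρini)
  have hmass : totalMass ρini * ∫ v in (0 : ℝ)..1, (2 - w v) = 1 := by
    rw [← intervalIntegral_congr_Icc (f := fun v => 2 - Phi ρini v)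
      (fun v hv => by simp only [hew hv]) (right_mem_Icc.2 zero_le_one), integral_Phi hρini,
      mul_one_div_cancel hm0.ne']
  have h1 := (hω.congr he hew).phiInv (by positivity) hm0.le hT hm hK hmw hKw hmass
  -- The transformed coefficients are (σ/m²)·m² = σ and m·(p/m) = p.
  rw [div_mul_cancel₀ _ (by positivity), mul_div_cancel₀ _ hm0.ne'] at h1
  refine isUniqueIn_convectionDiffusion hT hσ (h1.congr (fun t ht u hu => ?_) fun u hu => ?_)
  · have hmt : Measurable (ω' t) := hm.comp measurable_prodMk_left
    rw [PhiInv_eq hmt (hK t) (fun _ _ => rfl) hu, PhiInv_eq hmt (hK t) (he t ht) hu]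
  · rw [PhiInv_eq hmw hKw (fun _ _ => rfl) hu, ← PhiInv_eq hmw hKw hew hu, PhiInv_Phi hρini hu]

end FacilitatedExclusion

theorem mainTheorem4 (σ p T : ℝ) (hσ : 0 < σ) (hp : 0 ≤ p) (hT : 0 < T)
    (ρini : ℝ → ℝ) (hρini : IsProfile (Icc (1 / 2) 1) ρini)
    (ωini : ℝ → ℝ) (hωini : ωini = Phi ρini) (m : ℝ) (hm : m = totalMass ρini) :
    -- `Φ` is a bijection between profiles, with inverse `Φ⁻¹`
    (∀ r : ℝ → ℝ, IsProfile (Icc (1 / 2) 1) r →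
      IsProfile (Icc 0 1) (Phi r) ∧ EqOn (PhiInv (Phi r)) r (Icc 0 1)) ∧
    (∀ w : ℝ → ℝ, IsProfile (Icc 0 1) w →
      IsProfile (Icc (1 / 2) 1) (PhiInv w) ∧ EqOn (Phi (PhiInv w)) w (Icc 0 1)) ∧
    -- (i) heat equation to fast diffusion equation, Neumann boundary conditions
    (∀ ω : ℝ → ℝ → ℝ,
      IsWeakSolutionNeumann (Icc 0 1) (σ / m ^ 2) (fun r => r) T ωini ω →
        IsUniqueIn T (IsWeakSolutionNeumann (Icc 0 1) (σ / m ^ 2) (fun r => r) T ωini) ω ∧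
        IsUniqueIn T (IsWeakSolutionNeumann (Icc (1 / 2) 1) σ frakA T ρini)
          (fun t => PhiInv (ω t))) ∧
    -- (ii) viscous Burgers equation to convection-diffusion equation, Robin boundary conditions
    (∀ ω : ℝ → ℝ → ℝ,
      IsWeakSolutionRobin (Icc 0 1) (σ / m ^ 2) (p / m) (fun r => r) currentJ T ωini ω →
        IsUniqueIn T
          (IsWeakSolutionRobin (Icc 0 1) (σ / m ^ 2) (p / m) (fun r => r) currentJ T ωini) ω ∧
        IsUniqueIn T (IsWeakSolutionRobin (Icc (1 / 2) 1) σ p frakA frakH T ρini)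
          (fun t => PhiInv (ω t))) := by
  subst hωini hm
  have hm0 : 0 < totalMass ρini := by linarith [(totalMass_mem hρini).1]
  have hs : 0 < σ / totalMass ρini ^ 2 := by positivity
  refine ⟨fun r hr => ⟨isProfile_Phi hr, PhiInv_Phi hr⟩,
    fun w hw => ⟨isProfile_PhiInv hw, Phi_PhiInv hw⟩, fun ω hω => ?_,
    fun ω hω => ⟨isUniqueIn_burgers hT.le hs hω, isUniqueIn_phiInv hσ hT.le hρini hω⟩⟩
  -- The Neumann problem is the Robin problem with zero drift and any flux function. Choosing J and
  -- 𝔥, and writing the drift 0 as 0/m, makes (i) the case p = 0 of (ii).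
  have e1 : IsWeakSolutionNeumann (Icc 0 1) (σ / totalMass ρini ^ 2) (fun r => r) T (Phi ρini) =
      IsWeakSolutionRobin (Icc 0 1) (σ / totalMass ρini ^ 2) (0 / totalMass ρini) (fun r => r)
        currentJ T (Phi ρini) := by
    rw [zero_div]
    exact funext fun _ => propext (isWeakSolutionNeumann_iff currentJ)
  have e2 : IsWeakSolutionNeumann (Icc (1 / 2) 1) σ frakA T ρini =
      IsWeakSolutionRobin (Icc (1 / 2) 1) σ 0 frakA frakH T ρini :=
    funext fun _ => propext (isWeakSolutionNeumann_iff frakH)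
  rw [e1] at hω ⊢
  rw [e2]
  exact ⟨isUniqueIn_burgers hT.le hs hω, isUniqueIn_phiInv hσ hT.le hρini hω⟩
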